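/- Let $S^3=\{s\in\mathbb R^4: s_1^2+s_2^2+s_3^2+s_4^2=1\}$, $J_{jk}=s_j\partial_{s_k}-s_k\partial_{s_j}$, let $\Delta_S=\sum_{1\le j<k\le 4}J_{jk}^2$ be the Laplace-Beltrami operator on $S^3$, and write $\{A,B\}=AB+BA$. Let $W$ be a nonempty connected open subset of $\{s\in S^3: s_1\ne0,\ s_2\ne0\}$. For complex parameters $a_1,a_2,a_3,a_4$ consider, on smooth complex-valued functions on $W$, the operators $$H=\Delta_S+\frac{a_1s_4}{\sqrt{s_1^2+s_2^2+s_3^2}}+\frac{a_2}{s_1^2}+\frac{a_3}{s_2^2}+a_4,$$ $$L_{12}=J_{12}^2+\frac{a_3s_1^2}{s_2^2}+\frac{a_2s_2^2}{s_1^2},\quad L_{13}=J_{13}^2+\frac{a_2s_3^2}{s_1^2},\quad L_{23}=J_{23}^2+\frac{a_3s_3^2}{s_2^2},$$ $$L=\{J_{13},J_{14}\}+\{J_{23},J_{24}\}+\frac{a_1s_3}{\sqrt{s_1^2+s_2^2+s_3^2}}+2s_3s_4\Big(\frac{a_2}{s_1^2}+\frac{a_3}{s_2^2}\Big).$$ By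 a second-order symmetry of $H$ we mean a linear differential operator of order at most two with smooth coefficients on $W$ that commutes with $H$. Functions are called functionally independent if their differentials are linearly independent on a dense subset of the domain, and second-order operators if their principal symbols are functionally independent on the cotangent bundle $T^*W$. Then: 1. For all $a_1,a_2,a_3,a_4$, the operators $H,L_{12},L_{13},L_{23},L$ are second-order symmetries of $H$ and are functionally independent, so that $H$ is 2nd-order superintegrable; moreover $1,H,L_{12},L_{13},L_{23},L$ are linearly independent. 2. If $a_1,a_2,a_3$ are all nonzero, then $\{H,L_{12},L_{13},L_{23},L\}$ is, together with the trivial symmetry $1$, a basis of the space of all second-order symmetries of $H$. 3. The functions $\dfrac{s_4}{\sqrt{s_1^2+s_2^2+s_3^2}},\ \dfrac1{s_1^2},\ \dfrac1{s_2^2}$ are functionally independent, and the three-parameter system $H$ is semidegenerate: for all parameter values it admits five functionally independent second-order symmetries (one of them $H$), its three-parameter potential is functionally independent, and for generic $(a_1,a_2,a_3)$ (in a dense open subset of $\mathbb C^3$, for every $a_4$) it does not admit six second-order symmetries that are linearly independent modulo constants. 4. The system is conformally Stäckel equivalent to the flat-space system $$H_{flat}=\partial_x^2+\partial_y^2+\partial_z^2+\frac{2a_1(1-r^2)}{r(r^2+1)^2}+\frac{a_2}{x^2}+\frac{a_3}{y^2}+\frac{4a_4}{(r^2+1)^2},\qquad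 r^2=x^2+y^2+z^2.$$ Precisely, put $U=4/(r^2+1)^2$, the coefficient of $a_4$ in $H_{flat}$, and $\Phi(x,y,z)=\frac1{r^2+1}(2x,2y,2z,1-r^2)$. Then $\Phi$ is a smooth bijection of the open set $\Phi^{-1}(W)$ onto $W$ that pulls the metric of $S^3$ back to $U(dx^2+dy^2+dz^2)$, and in these coordinates, for all $a_1,a_2,a_3,a_4$, the Stäckel transform $U^{-1/4}\,U^{-1}H_{flat}\,U^{1/4}$ of $H_{flat}$ by $U$, in self-adjoint form, is the operator $H$ with parameters $(a_1,a_2,a_3,a_4-\tfrac34)$. -/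

import Mathlib

open scoped Manifold ContDiff InnerProductSpace
open TopologicalSpace

namespace SphereSystem

noncomputable section

/-- Euclidean 4-space with coordinates `(s₁, s₂, s₃, s₄) = (s 0, s 1, s 2, s 3)`. -/
abbrev E4 := EuclideanSpace ℝ (Fin 4)

/-- Euclidean 3-space with coordinates `(x, y, z) = (x 0, x 1, x 2)`. -/
abbrev E3 := EuclideanSpace ℝ (Fin 3)

/-- The unit 3-sphere, with Mathlib's smooth structure. -/
abbrev S3 := Metric.sphere (0 : E4) 1

instance finrank_E4 : Fact (Module.finrank ℝ E4 = 3 + 1) := ⟨finrank_euclideanSpace_fin⟩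

/-! ### Smooth functions on an open subset of the sphere -/

/-- The algebra of smooth complex-valued functions on an open subset `W` of the 3-sphere. -/
def SmoothFn (W : Opens S3) : Subalgebra ℂ (W → ℂ) where
  carrier := {f | ContMDiff (𝓡 3) 𝓘(ℝ, ℂ) ∞ f}
  mul_mem' := by
    intro f g hf hg
    have h : ContDiff ℝ ∞ (fun z : ℂ × ℂ => z.1 * z.2) := contDiff_fst.mul contDiff_snd
    exact h.contMDiff.comp (hf.prodMk_space hg)
  add_mem' := by
    intro f g hf hg
    have h : ContDiff ℝ ∞ (fun z : ℂ × ℂ => z.1 + z.2) := contDiff_fst.add contDiff_snd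
    exact h.contMDiff.comp (hf.prodMk_space hg)
  algebraMap_mem' := fun c => contMDiff_const

/-- Radial projection `x ↦ x / ‖x‖` of a nonzero vector to the sphere. -/
def toSphere (x : E4) (hx : x ≠ 0) : S3 :=
  ⟨‖x‖⁻¹ • x, by simp [norm_smul, hx]⟩

/-- The open cone over `W`. -/
def cone (W : Opens S3) : Set E4 := {x | ∃ hx : x ≠ 0, toSphere x hx ∈ W}

open Classical in
/-- The extension of a function on `W` to the cone over `W` that is constant on rays (and `0` off
the cone). -/
def radialExt {W : Opens S3} (f : W → ℂ) : E4 → ℂ := fun x =>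
  if h : x ∈ cone W then f ⟨toSphere x h.1, h.2⟩ else 0

lemma S3.ne_zero (s : S3) : (s : E4) ≠ 0 := ne_zero_of_mem_unit_sphere s

lemma toSphere_coe (s : S3) (h : (s : E4) ≠ 0) : toSphere s h = s := by
  apply Subtype.ext; simp [toSphere]

lemma coe_mem_cone {W : Opens S3} (s : W) : ((s : S3) : E4) ∈ cone W :=
  ⟨S3.ne_zero _, by rw [toSphere_coe]; exact s.2⟩

@[simp] lemma radialExt_coe {W : Opens S3} (f : W → ℂ) (s : W) :
    radialExt f ((s : S3) : E4) = f s := by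
  rw [radialExt, dif_pos (coe_mem_cone s)]
  exact congrArg f (Subtype.ext (toSphere_coe _ (S3.ne_zero _)))

lemma continuous_toSphere :
    Continuous (fun x : {x : E4 // x ≠ 0} => toSphere x.1 x.2) := by
  apply Continuous.subtype_mk
  exact ((continuous_norm.comp continuous_subtype_val).inv₀
    (fun x => norm_ne_zero_iff.2 x.2)).smul continuous_subtype_val

lemma isOpen_cone (W : Opens S3) : IsOpen (cone W) := by
  have h1 : IsOpen {x : E4 | x ≠ 0} := isOpen_ne
  have h := h1.isOpenEmbedding_subtypeVal.isOpenMap _ (W.isOpen.preimage continuous_toSphere)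
  convert h using 1
  ext x
  simp [cone]

/-- Smoothness on `W` in the sense of manifolds is smoothness of the radial extension. -/
lemma contMDiff_iff_radialExt {W : Opens S3} (f : W → ℂ) :
    ContMDiff (𝓡 3) 𝓘(ℝ, ℂ) ∞ f ↔ ContDiffOn ℝ ∞ (radialExt f) (cone W) := by
  constructor
  · intro hf
    let C : Opens E4 := ⟨cone W, isOpen_cone W⟩
    have h1 : ContMDiff 𝓘(ℝ, E4) 𝓘(ℝ, E4) ∞ (fun x : C => ‖(x : E4)‖⁻¹ • (x : E4)) := by
      intro x
      have hx : (x : E4) ≠ 0 := x.2.1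
      have h : ContDiffAt ℝ ∞ (fun x : E4 => ‖x‖⁻¹ • x) x :=
        ((contDiffAt_norm ℝ hx).inv (norm_ne_zero_iff.2 hx)).smul contDiffAt_id
      exact h.contMDiffAt.comp x contMDiff_subtype_val.contMDiffAt
    have h2 := h1.codRestrict_sphere (n := 3) (fun x => (toSphere x.1 x.2.1).2)
    have h3 : ContMDiff 𝓘(ℝ, E4) (𝓡 3) ∞
        (fun x : C => (⟨toSphere x.1 x.2.1, x.2.2⟩ : W)) :=
      (ContMDiff.subtypeVal_comp_iff W _).1 h2
    have h4 := hf.comp h3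
    intro x hx
    have h5 := h4 ⟨x, hx⟩
    have h6 : (f ∘ fun x : C => (⟨toSphere x.1 x.2.1, x.2.2⟩ : W))
        = fun x : C => radialExt f x := by
      funext y
      have hy : (y : E4) ∈ cone W := y.2
      simp [radialExt, hy]
    rw [h6] at h5
    exact (contMDiffAt_subtype_iff.1 h5).contDiffAt.contDiffWithinAt
  · intro hf s
    have h1 : ContDiffAt ℝ ∞ (radialExt f) ((s : S3) : E4) :=
      hf.contDiffAt ((isOpen_cone W).mem_nhds (coe_mem_cone s))
    have h2 : ContMDiff (𝓡 3) 𝓘(ℝ, E4) ∞ (fun s : W => ((s : S3) : E4)) :=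
      contMDiff_coe_sphere.comp contMDiff_subtype_val
    have h3 := h1.contMDiffAt.comp s h2.contMDiffAt
    have h4 : (radialExt f ∘ fun s : W => ((s : S3) : E4)) = f := by
      funext t; simp
    rwa [h4] at h3

/-- The restriction to `W` of a function of `(s₁, s₂, s₃, s₄)` that is smooth near `W`. -/
def ofAmbient (W : Opens S3) (g : E4 → ℂ) (hg : ∀ s ∈ W, ContDiffAt ℝ ∞ g (s : E4)) :
    SmoothFn W :=
  ⟨fun s => g (s : S3), fun s => by
    have h2 : ContMDiff (𝓡 3) 𝓘(ℝ, E4) ∞ (fun s : W => ((s : S3) : E4)) :=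
      contMDiff_coe_sphere.comp contMDiff_subtype_val
    exact (hg s s.2).contMDiffAt.comp s h2.contMDiffAt⟩

/-! ### Differential operators on an open subset of the sphere -/

/-- Linear operators on smooth functions on `W`. -/
abbrev Op (W : Opens S3) := Module.End ℂ (SmoothFn W)

/-- Multiplication by a smooth function. -/
abbrev mulOp {W : Opens S3} : SmoothFn W →ₐ[ℂ] Op W := Algebra.lmul ℂ (SmoothFn W)

/-- The `k`-th coordinate vector of 4-space. -/
abbrev e (k : Fin 4) : E4 := EuclideanSpace.single k 1

/-- The function `s_j ∂f/∂s_k - s_k ∂f/∂s_j` on `W`. As `s_j ∂_{s_k} - s_k ∂_{s_j}` is tangent to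
the sphere, the choice of the radial extension of `f` is immaterial. -/
def rot {W : Opens S3} (j k : Fin 4) (f : W → ℂ) : W → ℂ := fun s =>
  ((s : S3) : E4) j * fderiv ℝ (radialExt f) ((s : S3) : E4) (e k)
    - ((s : S3) : E4) k * fderiv ℝ (radialExt f) ((s : S3) : E4) (e j)

lemma differentiableAt_radialExt {W : Opens S3} (f : SmoothFn W) (s : W) :
    DifferentiableAt ℝ (radialExt (f : W → ℂ)) ((s : S3) : E4) :=
  (((contMDiff_iff_radialExt _).1 f.2).contDiffAt
    ((isOpen_cone W).mem_nhds (coe_mem_cone s))).differentiableAt (by simp)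

lemma contMDiff_rot {W : Opens S3} (j k : Fin 4) (f : SmoothFn W) :
    ContMDiff (𝓡 3) 𝓘(ℝ, ℂ) ∞ (rot j k (f : W → ℂ)) := by
  have hc (i : Fin 4) : ContDiff ℝ ∞ (fun x : E4 => ((x i : ℝ) : ℂ)) := by
    exact Complex.ofRealCLM.contDiff.comp (contDiff_piLp_apply (p := 2))
  refine (ofAmbient W (fun x => x j * fderiv ℝ (radialExt (f : W → ℂ)) x (e k)
    - x k * fderiv ℝ (radialExt (f : W → ℂ)) x (e j)) ?_).2
  intro s hs
  have h1 : ContDiffAt ℝ ∞ (radialExt (f : W → ℂ)) (s : E4) :=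
    ((contMDiff_iff_radialExt _).1 f.2).contDiffAt
      ((isOpen_cone W).mem_nhds (coe_mem_cone (⟨s, hs⟩ : W)))
  have h2 : ContDiffAt ℝ ∞ (fderiv ℝ (radialExt (f : W → ℂ))) (s : E4) :=
    h1.fderiv_right (m := ∞) (by simp)
  have h3 (v : E4) : ContDiffAt ℝ ∞ (fun x => fderiv ℝ (radialExt (f : W → ℂ)) x v) (s : E4) :=
    h2.clm_apply contDiffAt_const
  exact ((hc j).contDiffAt.mul (h3 _)).sub ((hc k).contDiffAt.mul (h3 _))

lemma radialExt_add {W : Opens S3} (f g : W → ℂ) :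
    radialExt (f + g) = radialExt f + radialExt g := by
  funext x
  by_cases h : x ∈ cone W <;> simp [radialExt, h]

lemma radialExt_smul {W : Opens S3} (c : ℂ) (f : W → ℂ) :
    radialExt (c • f) = c • radialExt f := by
  funext x
  by_cases h : x ∈ cone W <;> simp [radialExt, h]

/-- On restrictions to the sphere of functions `g(s₁, s₂, s₃, s₄)`, `rot j k` is literally
`s_j ∂g/∂s_k - s_k ∂g/∂s_j`. -/
lemma rot_ofAmbient {W : Opens S3} (g : E4 → ℂ) (hg : ∀ s ∈ W, ContDiffAt ℝ ∞ g (s : E4))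
    (j k : Fin 4) (s : W) :
    rot j k (ofAmbient W g hg : W → ℂ) s =
      ((s : S3) : E4) j * fderiv ℝ g ((s : S3) : E4) (e k)
        - ((s : S3) : E4) k * fderiv ℝ g ((s : S3) : E4) (e j) := by
  set x : E4 := ((s : S3) : E4) with hx
  have hx0 : x ≠ 0 := S3.ne_zero _
  have hn : ‖x‖ = 1 := by simp [hx]
  have hev : radialExt (ofAmbient W g hg : W → ℂ) =ᶠ[nhds x] g ∘ fun y : E4 => ‖y‖⁻¹ • y := by
    filter_upwards [(isOpen_cone W).mem_nhds (coe_mem_cone s)] with y hy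
    simp [radialExt, hy, ofAmbient, toSphere]
  have hgd : DifferentiableAt ℝ g x := (hg s s.2).differentiableAt (by simp)
  set N : E4 → E4 := fun y => ‖y‖⁻¹ • y
  have hN : DifferentiableAt ℝ N x := by
    have h : ContDiffAt ℝ ∞ (fun x : E4 => ‖x‖⁻¹ • x) x :=
        ((contDiffAt_norm ℝ hx0).inv (norm_ne_zero_iff.2 hx0)).smul contDiffAt_id
    exact h.differentiableAt (by simp)
  have hNx : N x = x := by simp [N, hn]
  have key : (x j : ℝ) • fderiv ℝ N x (e k) - (x k : ℝ) • fderiv ℝ N x (e j)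
      = (x j : ℝ) • e k - (x k : ℝ) • e j := by
    rw [← map_smul, ← map_smul, ← map_sub]
    set v : E4 := (x j : ℝ) • e k - (x k : ℝ) • e j
    have hv : inner ℝ x v = 0 := by
      simp [v, inner_sub_right, inner_smul_right, EuclideanSpace.inner_single_right]; ring
    have hnorm : DifferentiableAt ℝ (fun y : E4 => ‖y‖) x := (contDiffAt_norm ℝ hx0 (n := ∞)).differentiableAt (by simp)
    have hd0 : fderiv ℝ (fun y : E4 => ‖y‖) x v = 0 := by
      have h1 : HasFDerivAt (fun y : E4 => ‖y‖^2) (2 • (innerSL ℝ x)) x := (hasStrictFDerivAt_norm_sq x).hasFDerivAt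
      have h2 := (hnorm.hasFDerivAt.pow 2).unique h1
      have h3 := congrArg (fun T => T v) h2
      simpa [hn, hv] using h3
    have hinv := (hasDerivAt_inv (norm_ne_zero_iff.2 hx0)).comp_hasFDerivAt x hnorm.hasFDerivAt
    have := (hinv.smul (hasFDerivAt_id x)).fderiv
    have h5 := congrArg (fun T => T v) this
    simp only [] at h5
    refine h5.trans ?_
    simp [hn, hd0]
  rw [rot, hev.fderiv_eq, fderiv_comp x (by rw [hNx]; exact hgd) hN, hNx]
  have := congrArg (fderiv ℝ g x) key
  simpa using this

/-- The operator `J_{jk} = s_j ∂_{s_k} - s_k ∂_{s_j}` on `W`. -/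
def J {W : Opens S3} (j k : Fin 4) : Op W where
  toFun f := ⟨rot j k (f : W → ℂ), contMDiff_rot j k f⟩
  map_add' f g := by
    apply Subtype.ext; funext s
    have hf := differentiableAt_radialExt f s
    have hg := differentiableAt_radialExt g s
    simp only [rot, AddMemClass.coe_add, radialExt_add, fderiv_add hf hg, Pi.add_apply,
      _root_.add_apply]
    ring
  map_smul' c f := by
    apply Subtype.ext; funext s
    have hf := differentiableAt_radialExt f s
    simp only [rot, SetLike.val_smul, radialExt_smul, fderiv_const_smul hf c, Pi.smul_apply,
      _root_.smul_apply, smul_eq_mul, RingHom.id_apply]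
    ring

/-- The linear differential operators of order at most `n` with smooth coefficients on `W`: those
of order `0` are the multiplications by functions, and an operator of order at most `n + 1` is a sum
of one of order at most `n` and of products `P J_{jk}`, `P` of order at most `n` (the `J_{jk}` span
every tangent space of the sphere). -/
def diffOps (W : Opens S3) : ℕ → Submodule ℂ (Op W)
  | 0 => LinearMap.range (mulOp (W := W)).toLinearMap
  | n + 1 => diffOps W n ⊔
      ⨆ (j : Fin 4) (k : Fin 4), (diffOps W n).map (LinearMap.mulRight ℂ (J j k))

/-- The symmetry operators of `H` of order at most two: the differential operators of order at most
two that commute with `H`. -/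
def symmetries (W : Opens S3) (H : Op W) : Submodule ℂ (Op W) :=
  diffOps W 2 ⊓ (Subalgebra.centralizer ℂ {H}).toSubmodule

/-- The linear function `s ↦ ⟨p, s⟩` on `W`. -/
def linearFn {W : Opens S3} (p : E4) : SmoothFn W :=
  ofAmbient W (fun s => ((inner ℝ p s : ℝ) : ℂ)) (fun _ _ =>
    (Complex.ofRealCLM.contDiff.comp (innerSL ℝ p).contDiff).contDiffAt)

/-- The second-order symbol `σ(P)(s, p) = ½ [[P, ℓ], ℓ] 1 (s)`, `ℓ = ⟨p, ·⟩`, of an operator of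
order at most two at the covector of the sphere at `s` given by the restriction of `⟨p, ·⟩` to the
tangent space. (The symbol of `J_{jk}²` is `(s_j p_k - s_k p_j)²`.) It is extended to be constant on
rays in `s`; so it is the pullback of the symbol on the cotangent bundle of `W` under a submersion
from `cone W × ℝ⁴`. -/
def symbol {W : Opens S3} (P : Op W) : E4 × E4 → ℂ := fun q =>
  let l : Op W := mulOp (linearFn q.2)
  radialExt (((1 / 2 : ℂ) • ⁅⁅P, l⁆, l⁆ (1 : SmoothFn W) : SmoothFn W) : W → ℂ) q.1

/-- Functional independence of smooth functions on `Ω`: their differentials are linearly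
independent on a dense subset of `Ω`. -/
def FunctionallyIndependentOn {ι E : Type*} [NormedAddCommGroup E] [NormedSpace ℝ E]
    (f : ι → E → ℂ) (Ω : Set E) : Prop :=
  (∀ i, ContDiffOn ℝ ∞ (f i) Ω) ∧
    Ω ⊆ closure {x ∈ Ω | LinearIndependent ℂ (fun i => fderiv ℝ (f i) x)}

/-- Functional independence of operators of order two: that of their symbols on phase space. -/
def OpsFunctionallyIndependent {W : Opens S3} {ι : Type*} (P : ι → Op W) : Prop :=
  FunctionallyIndependentOn (fun i => symbol (P i)) (cone W ×ˢ Set.univ)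

/-- The Laplace-Beltrami operator `Δ_S = ∑_{j<k} J_{jk}²` of the 3-sphere. -/
def laplaceS {W : Opens S3} : Op W :=
  ∑ q : Fin 4 × Fin 4 with q.1 < q.2, J q.1 q.2 ^ 2

/-- The operator `Δ_S + a₁ V₁ + a₂ V₂ + a₃ V₃ + c`. -/
def helmholtz {W : Opens S3} (V : Fin 3 → SmoothFn W) (a : Fin 3 → ℂ) (c : ℂ) : Op W :=
  laplaceS + mulOp (∑ i, a i • V i) + c • 1

/-- Second-order superintegrability in dimension three: `H` is one of `5 = 2·3 - 1` functionally
independent symmetry operators of order two. -/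
def IsSuperintegrable {W : Opens S3} (H : Op W) : Prop :=
  ∃ S : Fin 5 → Op W, S 0 = H ∧ (∀ i, S i ∈ symmetries W H) ∧ OpsFunctionallyIndependent S

/-- `H` admits six symmetry operators of order at most two that are linearly independent (modulo the
trivial symmetries, the constants). -/
def AdmitsSixSymmetries {W : Opens S3} (H : Op W) : Prop :=
  ∃ S : Fin 6 → Op W, (∀ i, S i ∈ symmetries W H) ∧
    LinearIndependent ℂ (Fin.cons 1 S : Fin 7 → Op W)

/-- The three-parameter system `Δ_S + a₁ V₁ + a₂ V₂ + a₃ V₃ + c` is semidegenerate: it is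
second-order superintegrable for all values of the parameters, its potential is functionally
independent, and for generic values of the parameters it does not admit six linearly independent
second-order symmetries (it is not nondegenerate). -/
def IsSemidegenerate {W : Opens S3} (V : Fin 3 → SmoothFn W) : Prop :=
  (∀ a c, IsSuperintegrable (helmholtz V a c)) ∧
  FunctionallyIndependentOn (fun i => radialExt (V i : W → ℂ)) (cone W) ∧
  ∃ G : Set (Fin 3 → ℂ), IsOpen G ∧ Dense G ∧
    ∀ a ∈ G, ∀ c, ¬ AdmitsSixSymmetries (helmholtz V a c)

/-! ### The system -/

/-- The part of the 3-sphere where the potential is defined: `s₁ ≠ 0` and `s₂ ≠ 0`. -/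
def regular : Opens S3 where
  carrier := {s | (s : E4) 0 ≠ 0 ∧ (s : E4) 1 ≠ 0}
  is_open' := by
    have h (i : Fin 4) : IsOpen {s : S3 | (s : E4) i ≠ 0} :=
      isOpen_ne.preimage (by fun_prop : Continuous fun s : S3 => (s : E4) i)
    exact (h 0).inter (h 1)

lemma contDiff_coordC (i : Fin 4) : ContDiff ℝ ∞ (fun x : E4 => ((x i : ℝ) : ℂ)) :=
  Complex.ofRealCLM.contDiff.comp (contDiff_piLp_apply (p := 2))

lemma contDiffAt_div {f g : E4 → ℂ} {s : E4} (hf : ContDiffAt ℝ ∞ f s) (hg : ContDiffAt ℝ ∞ g s)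
    (h : g s ≠ 0) : ContDiffAt ℝ ∞ (fun x => f x / g x) s := by
  simp only [div_eq_mul_inv]
  exact hf.mul (hg.inv h)

lemma contDiffAt_pot1 (i : Fin 4) {s : E4} (h0 : s 0 ≠ 0) : ContDiffAt ℝ ∞
    (fun s : E4 => ((s i / √(s 0 ^ 2 + s 1 ^ 2 + s 2 ^ 2) : ℝ) : ℂ)) s := by
  have hc (i : Fin 4) : ContDiffAt ℝ ∞ (fun x : E4 => x i) s :=
    (contDiff_piLp_apply (p := 2)).contDiffAt
  have hpos : 0 < s 0 ^ 2 + s 1 ^ 2 + s 2 ^ 2 := by positivity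
  have h1 : ContDiffAt ℝ ∞ (fun s : E4 => s i / √(s 0 ^ 2 + s 1 ^ 2 + s 2 ^ 2)) s :=
    (hc i).div (((((hc 0).pow 2).add ((hc 1).pow 2)).add ((hc 2).pow 2)).sqrt hpos.ne')
      (Real.sqrt_pos.2 hpos).ne'
  exact Complex.ofRealCLM.contDiff.contDiffAt.comp s h1

variable {W : Opens S3}

/-- `V₁ = s₄ / √(s₁² + s₂² + s₃²)`. -/
def V1 (hW : W ≤ regular) : SmoothFn W :=
  ofAmbient W (fun s => ((s 3 / √(s 0 ^ 2 + s 1 ^ 2 + s 2 ^ 2) : ℝ) : ℂ))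
    (fun _ hs => contDiffAt_pot1 3 (hW hs).1)

/-- `V₂ = 1 / s₁²`. -/
def V2 (hW : W ≤ regular) : SmoothFn W :=
  ofAmbient W (fun s => 1 / (s 0 : ℂ) ^ 2) (fun _ hs => contDiffAt_div contDiffAt_const
    ((contDiff_coordC 0).contDiffAt.pow 2)
      (pow_ne_zero 2 (Complex.ofReal_ne_zero.2 (hW hs).1)))

/-- `V₃ = 1 / s₂²`. -/
def V3 (hW : W ≤ regular) : SmoothFn W :=
  ofAmbient W (fun s => 1 / (s 1 : ℂ) ^ 2) (fun _ hs => contDiffAt_div contDiffAt_const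
    ((contDiff_coordC 1).contDiffAt.pow 2)
      (pow_ne_zero 2 (Complex.ofReal_ne_zero.2 (hW hs).2)))

/-- `H = Δ_S + a₁ s₄/√(s₁² + s₂² + s₃²) + a₂/s₁² + a₃/s₂² + a₄`. -/
def Hcoul (hW : W ≤ regular) (a₁ a₂ a₃ a₄ : ℂ) : Op W :=
  helmholtz ![V1 hW, V2 hW, V3 hW] ![a₁, a₂, a₃] a₄

/-- `L₁₂ = J₁₂² + a₃ s₁²/s₂² + a₂ s₂²/s₁²`. -/
def L12 (hW : W ≤ regular) (a₂ a₃ : ℂ) : Op W :=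
  J 0 1 ^ 2 + mulOp (ofAmbient W
    (fun s => a₃ * (s 0 : ℂ) ^ 2 / (s 1 : ℂ) ^ 2 + a₂ * (s 1 : ℂ) ^ 2 / (s 0 : ℂ) ^ 2)
    (fun s hs => by
      have h0 := pow_ne_zero 2 (Complex.ofReal_ne_zero.2 (hW hs).1)
      have h1 := pow_ne_zero 2 (Complex.ofReal_ne_zero.2 (hW hs).2)
      have hc (i : Fin 4) := ((contDiff_coordC i).pow 2).contDiffAt (x := (s : E4))
      exact (contDiffAt_div (contDiffAt_const.mul (hc 0)) (hc 1) h1).add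
        (contDiffAt_div (contDiffAt_const.mul (hc 1)) (hc 0) h0)))

/-- `L₁₃ = J₁₃² + a₂ s₃²/s₁²`. -/
def L13 (hW : W ≤ regular) (a₂ : ℂ) : Op W :=
  J 0 2 ^ 2 + mulOp (ofAmbient W (fun s => a₂ * (s 2 : ℂ) ^ 2 / (s 0 : ℂ) ^ 2)
    (fun _ hs => contDiffAt_div (contDiffAt_const.mul ((contDiff_coordC 2).pow 2).contDiffAt)
      ((contDiff_coordC 0).pow 2).contDiffAt
      (pow_ne_zero 2 (Complex.ofReal_ne_zero.2 (hW hs).1))))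

/-- `L₂₃ = J₂₃² + a₃ s₃²/s₂²`. -/
def L23 (hW : W ≤ regular) (a₃ : ℂ) : Op W :=
  J 1 2 ^ 2 + mulOp (ofAmbient W (fun s => a₃ * (s 2 : ℂ) ^ 2 / (s 1 : ℂ) ^ 2)
    (fun _ hs => contDiffAt_div (contDiffAt_const.mul ((contDiff_coordC 2).pow 2).contDiffAt)
      ((contDiff_coordC 1).pow 2).contDiffAt
      (pow_ne_zero 2 (Complex.ofReal_ne_zero.2 (hW hs).2))))

/-- The symmetrizer `{A, B} = AB + BA`. -/
def symm (A B : Op W) : Op W := A * B + B * A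

/-- `L = {J₁₃, J₁₄} + {J₂₃, J₂₄} + a₁ s₃/√(s₁² + s₂² + s₃²) + 2 s₃ s₄ (a₂/s₁² + a₃/s₂²)`. -/
def L (hW : W ≤ regular) (a₁ a₂ a₃ : ℂ) : Op W :=
  symm (J 0 2) (J 0 3) + symm (J 1 2) (J 1 3) + mulOp (ofAmbient W
    (fun s => a₁ * ((s 2 / √(s 0 ^ 2 + s 1 ^ 2 + s 2 ^ 2) : ℝ) : ℂ)
      + 2 * s 2 * s 3 * (a₂ / (s 0 : ℂ) ^ 2 + a₃ / (s 1 : ℂ) ^ 2))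
    (fun s hs => by
      have h0 := pow_ne_zero 2 (Complex.ofReal_ne_zero.2 (hW hs).1)
      have h1 := pow_ne_zero 2 (Complex.ofReal_ne_zero.2 (hW hs).2)
      have hc (i : Fin 4) := (contDiff_coordC i).contDiffAt (x := (s : E4))
      exact (contDiffAt_const.mul (contDiffAt_pot1 2 (hW hs).1)).add
        (((contDiffAt_const.mul (hc 2)).mul (hc 3)).mul
          ((contDiffAt_div contDiffAt_const ((hc 0).pow 2) h0).add
            (contDiffAt_div contDiffAt_const ((hc 1).pow 2) h1)))))

/-! ### The flat-space system and the Stäckel transform -/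

/-- Inverse stereographic projection
`s₁ = 2x/(r²+1)`, `s₂ = 2y/(r²+1)`, `s₃ = 2z/(r²+1)`, `s₄ = (1-r²)/(r²+1)`. -/
def stereo (x : E3) : S3 :=
  ⟨!₂[2 * x 0 / (‖x‖ ^ 2 + 1), 2 * x 1 / (‖x‖ ^ 2 + 1), 2 * x 2 / (‖x‖ ^ 2 + 1),
      (1 - ‖x‖ ^ 2) / (‖x‖ ^ 2 + 1)], by
    have h : ‖x‖ ^ 2 = x 0 ^ 2 + x 1 ^ 2 + x 2 ^ 2 := by
      simp [EuclideanSpace.norm_sq_eq, Fin.sum_univ_three]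
    have hp : ‖x‖ ^ 2 + 1 ≠ 0 := by positivity
    rw [mem_sphere_zero_iff_norm, ← sq_eq_sq₀ (norm_nonneg _) zero_le_one,
      EuclideanSpace.norm_sq_eq]
    simp only [Fin.sum_univ_four, Real.norm_eq_abs, sq_abs]
    simp
    field_simp
    rw [h]; ring⟩

/-- The potential of the flat-space system:
`2a₁(1-r²)/(r(r²+1)²) + a₂/x² + a₃/y² + 4a₄/(r²+1)²`. -/
def flatPotential (a₁ a₂ a₃ a₄ : ℂ) (x : E3) : ℂ :=
  2 * a₁ * (1 - ‖x‖ ^ 2) / (‖x‖ * (‖x‖ ^ 2 + 1) ^ 2) + a₂ / (x 0) ^ 2 + a₃ / (x 1) ^ 2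
    + 4 * a₄ / (‖x‖ ^ 2 + 1) ^ 2

/-- `H_flat = ∂_x² + ∂_y² + ∂_z² + flatPotential`, with Mathlib's Euclidean Laplacian. -/
def Hflat (a₁ a₂ a₃ a₄ : ℂ) (ψ : E3 → ℂ) : E3 → ℂ := fun x =>
  Laplacian.laplacian ψ x + flatPotential a₁ a₂ a₃ a₄ x * ψ x

/-- The conformal Stäckel transform by `U`, in self-adjoint form, of an operator `H` on functions on
3-space: `ψ ↦ S⁻¹ U⁻¹ H (S ψ)`, `S = U^{1/4}`. -/
def staeckelTransform (U : E3 → ℝ) (H : (E3 → ℂ) → (E3 → ℂ)) (ψ : E3 → ℂ) : E3 → ℂ := fun x =>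
  (((U x ^ (1 / 4 : ℝ))⁻¹ * (U x)⁻¹ : ℝ) : ℂ) * H (fun y => ((U y ^ (1 / 4 : ℝ) : ℝ) : ℂ) * ψ y) x

/-- The operator `K` on `W` is, in the coordinates given by `Φ`, the conformal Stäckel transform by
`U` of the operator `H` on an open subset of 3-space: `Φ` maps `Φ⁻¹(W)` diffeomorphically onto `W`,
the metric of the sphere is `U (dx² + dy² + dz²)`, and `K` is the transformed operator. -/
def IsStaeckelTransform (Φ : E3 → S3) (U : E3 → ℝ) (H : (E3 → ℂ) → (E3 → ℂ)) (K : Op W) : Prop :=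
  IsOpen (Φ ⁻¹' W) ∧ Set.BijOn Φ (Φ ⁻¹' W) W ∧
  ContDiffOn ℝ ∞ (fun x => (Φ x : E4)) (Φ ⁻¹' W) ∧
  (∀ x ∈ Φ ⁻¹' W, 0 < U x ∧
    ∀ v : E3, ‖fderiv ℝ (fun x => (Φ x : E4)) x v‖ ^ 2 = U x * ‖v‖ ^ 2) ∧
  ∀ (f : SmoothFn W) (x : E3) (hx : Φ x ∈ W),
    (K f : W → ℂ) ⟨Φ x, hx⟩ =
      staeckelTransform U H (fun y => radialExt (f : W → ℂ) (Φ y)) x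

end

end SphereSystem

namespace SphereSystem

noncomputable section

variable {W : Opens S3}

/-! ### The coordinate derivations of the sphere -/

/-! Functions on `W` are studied through homogeneous extensions to the cone over `W`. The tangential
parts `D k` of ∂/∂s_k are derivations with Σ s_k D_k = 0 and Δ_S = Σ D_k², so the geometry of the
sphere becomes algebra in `crd` and `D`. The symbol of an operator P of order two is polarized to a
symmetric biderivation `Gam P`.

Existence. A quadratic expression Q in the rotations commutes with Δ_S and is in divergence form.
Hence Q + f commutes with Δ_S + V as soon as ∇f is the image of ∇V under the symbol of Q
(`commute_of_D_eq_Gam`), and each of the operators other than H is reduced to such a gradient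
identity.

Completeness. Let S be a symmetry. The third-order part of [S, Δ_S + V] = 0 says that its symbol is
a Killing tensor (`wd_Gam_cyclic`). Prolongation shows that the third derivatives of the degree-2
extension vanish, so the symbol is quadratic in the coordinates, its coefficients being an algebraic
curvature tensor c (`exists_curvature`); every such tensor is the symbol of a quadratic expression
in the rotations (`exists_quadOps`). The lower orders show that the first-order part is a Killing
field annihilating V and that the zeroth-order part f has the prescribed gradient
(`symmetry_structure`). This gradient must be curl-free. Cleared of poles, its curl is analytic and
homogeneous off the axis s₁ = s₂ = s₃ = 0, whose complement is connected, so it vanishes there, in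
particular on s₁ = 0 and s₂ = 0 (`eq_zero_of_homogeneous`). The leading polar terms there kill
components of c (`curvature_zero`, `curvature_one`), and the Coulomb term gives three more relations
(`IsReduced.relations`). Five free components remain, matched by the five symbols. Subtracting the
corresponding combination leaves a Killing field annihilating V, which is zero (`killing_eq_zero`),
plus a constant.

Independence. A polynomial in (x, p) that is nonzero somewhere is nonzero on a dense set; off the
zeros of `symsDet` the differentials of the five symbols are independent. Six further symmetries
beside 1 would exceed the dimension of the span.

Stäckel transform. Inverse stereographic projection is the radial projection of the paraboloid x ↦
(2x, 1 − r²) in ℝ⁴. For an extension homogeneous of degree −1/2, the flat Laplacian of its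
restriction to the paraboloid is 4 times its Laplacian in ℝ⁴, which in that degree is Δ_S − 3/4 up
to a power of the norm (`laplacian_homExt_paraboloid`). This explains both the factor U^{1/4} and
the shift of a₄. -/

lemma SmoothFn.ext {f g : SmoothFn W} (h : ∀ s : W, (f : W → ℂ) s = (g : W → ℂ) s) : f = g :=
  Subtype.ext (funext h)

lemma contDiffAt_radialExt (f : SmoothFn W) {x : E4} (hx : x ∈ cone W) :
    ContDiffAt ℝ ∞ (radialExt (f : W → ℂ)) x :=
  ((contMDiff_iff_radialExt _).1 f.2).contDiffAt ((isOpen_cone W).mem_nhds hx)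

lemma radialExt_mul (f g : W → ℂ) : radialExt (f * g) = radialExt f * radialExt g := by
  funext x
  by_cases h : x ∈ cone W <;> simp [radialExt, h]

lemma toSphere_smul {r : ℝ} (hr : 0 < r) (x : E4) (hx : x ≠ 0) (hrx : r • x ≠ 0) :
    toSphere (r • x) hrx = toSphere x hx := by
  apply Subtype.ext
  simp only [toSphere, norm_smul, Real.norm_eq_abs, abs_of_pos hr, smul_smul, mul_inv]
  congr 1
  field_simp

lemma smul_mem_cone {r : ℝ} (hr : 0 < r) {x : E4} (hx : x ∈ cone W) : r • x ∈ cone W :=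
  ⟨smul_ne_zero hr.ne' hx.1, by rw [toSphere_smul hr x hx.1]; exact hx.2⟩

lemma smul_mem_cone_iff {r : ℝ} (hr : 0 < r) {x : E4} : r • x ∈ cone W ↔ x ∈ cone W := by
  refine ⟨fun h => ?_, smul_mem_cone hr⟩
  simpa [smul_smul, inv_mul_cancel₀ hr.ne'] using smul_mem_cone (inv_pos.2 hr) h

lemma radialExt_homogeneous (f : W → ℂ) {r : ℝ} (hr : 0 < r) (x : E4) :
    radialExt f (r • x) = radialExt f x := by
  by_cases h : x ∈ cone W
  · rw [radialExt, radialExt, dif_pos h, dif_pos (smul_mem_cone hr h)]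
    exact congrArg f (Subtype.ext (toSphere_smul hr x h.1 (smul_mem_cone hr h).1))
  · rw [radialExt, radialExt, dif_neg h, dif_neg (mt (smul_mem_cone_iff hr).1 h)]

lemma fderiv_radialExt_smul (f : W → ℂ) {r : ℝ} (hr : 0 < r) (x : E4) :
    r • fderiv ℝ (radialExt f) (r • x) = fderiv ℝ (radialExt f) x := by
  have h : (fun y => radialExt f (r • y)) = radialExt f :=
    funext fun y => radialExt_homogeneous f hr y
  rw [← fderiv_comp_smul, h]

/-- Euler's relation in degree 0: differentiate along the ray t ↦ t x at t = 1. -/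
lemma fderiv_radialExt_self (f : SmoothFn W) {x : E4} (hx : x ∈ cone W) :
    fderiv ℝ (radialExt (f : W → ℂ)) x x = 0 := by
  have hd := ((contDiffAt_radialExt f hx).differentiableAt (by simp)).hasFDerivAt
  have hp : HasDerivAt (fun t : ℝ => t • x) x 1 := by
    simpa using (hasDerivAt_id (1 : ℝ)).smul_const x
  have h1 : HasDerivAt (fun t : ℝ => radialExt (f : W → ℂ) (t • x))
      (fderiv ℝ (radialExt (f : W → ℂ)) x x) 1 := by
    have hd' : HasFDerivAt (radialExt (f : W → ℂ)) (fderiv ℝ (radialExt (f : W → ℂ)) x)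
        ((1 : ℝ) • x) := by rwa [one_smul]
    exact hd'.comp_hasDerivAt (1 : ℝ) hp
  have h2 : HasDerivAt (fun t : ℝ => radialExt (f : W → ℂ) (t • x)) 0 1 := by
    refine (hasDerivAt_const (1 : ℝ) (radialExt (f : W → ℂ) x)).congr_of_eventuallyEq ?_
    filter_upwards [lt_mem_nhds (zero_lt_one (α := ℝ))] with t ht
    exact radialExt_homogeneous _ ht x
  exact h1.unique h2

/-- The tangential part of `∂/∂s_k`, a derivation of the algebra of smooth functions on `W`. -/
def D (k : Fin 4) : Derivation ℂ (SmoothFn W) (SmoothFn W) :=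
  Derivation.mk'
    { toFun := fun f => ofAmbient W (fun x => fderiv ℝ (radialExt (f : W → ℂ)) x (e k))
        (fun s hs => ((contDiffAt_radialExt f (coe_mem_cone (⟨s, hs⟩ : W))).fderiv_right
          (m := ∞) (by simp)).clm_apply contDiffAt_const)
      map_add' := fun f g => by
        apply SmoothFn.ext; intro s
        simp only [ofAmbient, AddMemClass.coe_add, radialExt_add, Pi.add_apply,
          fderiv_add (differentiableAt_radialExt f s) (differentiableAt_radialExt g s),
          _root_.add_apply]
      map_smul' := fun c f => by
        apply SmoothFn.ext; intro s
        simp only [ofAmbient, SetLike.val_smul, radialExt_smul, Pi.smul_apply,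
          fderiv_const_smul (differentiableAt_radialExt f s) c, _root_.smul_apply,
          RingHom.id_apply] }
    (fun f g => by
      apply SmoothFn.ext; intro s
      have h := ((differentiableAt_radialExt f s).hasFDerivAt.mul
        (differentiableAt_radialExt g s).hasFDerivAt).fderiv
      simp only [LinearMap.coe_mk, AddHom.coe_mk, ofAmbient, MulMemClass.coe_mul, radialExt_mul,
        smul_eq_mul, AddMemClass.coe_add, Pi.add_apply, Pi.mul_apply]
      rw [h]
      simp)

lemma D_apply (k : Fin 4) (f : SmoothFn W) (s : W) :
    (D k f : W → ℂ) s = fderiv ℝ (radialExt (f : W → ℂ)) ((s : S3) : E4) (e k) := rfl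

/-- The partial derivative of a radial extension has degree −1, whereas the extension of `D k f` is
constant on rays; the factor `‖x‖` makes up the difference. -/
lemma radialExt_D (k : Fin 4) (f : SmoothFn W) {x : E4} (hx : x ∈ cone W) :
    radialExt (D k f : W → ℂ) x = ‖x‖ * fderiv ℝ (radialExt (f : W → ℂ)) x (e k) := by
  have h := fderiv_radialExt_smul (f : W → ℂ) (inv_pos.2 (norm_pos_iff.2 hx.1)) x
  rw [← h, radialExt, dif_pos hx, D_apply]
  have : (‖x‖ : ℂ) ≠ 0 := Complex.ofReal_ne_zero.2 (norm_ne_zero_iff.2 hx.1)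
  simp [toSphere, this]

/-- The coordinate function `s_i` on `W`. -/
def crd (i : Fin 4) : SmoothFn W := ofAmbient W (fun s => ((s i : ℝ) : ℂ))
  (fun _ _ => (contDiff_coordC i).contDiffAt)

@[simp] lemma crd_apply (i : Fin 4) (s : W) :
    ((crd i : SmoothFn W) : W → ℂ) s = (((s : S3) : E4) i : ℝ) := rfl

lemma sum_sq_coord (s : S3) :
    (s : E4) 0 ^ 2 + (s : E4) 1 ^ 2 + (s : E4) 2 ^ 2 + (s : E4) 3 ^ 2 = 1 := by
  have h : ‖(s : E4)‖ ^ 2 = 1 := by simp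
  rw [EuclideanSpace.norm_sq_eq] at h
  simpa [Fin.sum_univ_four] using h

lemma sum_crd_sq : ∑ i, crd i ^ 2 = (1 : SmoothFn W) := by
  apply SmoothFn.ext; intro s
  have h := congrArg (fun t : ℝ => (t : ℂ)) (sum_sq_coord (s : S3))
  simp only [Fin.sum_univ_four]
  simpa using h

lemma fderiv_eq_sum (T : E4 →L[ℝ] ℂ) (v : E4) : T v = ∑ k, (v k : ℂ) * T (e k) := by
  have h : v = ∑ k, v k • e k := by
    ext i; simp [e, Pi.single_apply]
  conv_lhs => rw [h]
  simp

lemma sum_crd_mul_D (f : SmoothFn W) : ∑ k, crd k * D k f = 0 := by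
  apply SmoothFn.ext; intro s
  have h := fderiv_radialExt_self f (coe_mem_cone s)
  rw [fderiv_eq_sum] at h
  simp only [Fin.sum_univ_four] at h ⊢
  simpa [D_apply] using h

/-- An ambient function need not be constant on rays, hence the subtraction of its radial
derivative. Since Σ s_j² = 1 and Σ s_j D_j = 0, one has D_k = Σ_j s_j J_{jk}, and rotations may be
computed with any ambient extension (`rot_ofAmbient`). -/
lemma D_ofAmbient (g : E4 → ℂ) (hg : ∀ s ∈ W, ContDiffAt ℝ ∞ g (s : E4)) (k : Fin 4) (s : W) :
    (D k (ofAmbient W g hg) : W → ℂ) s = fderiv ℝ g ((s : S3) : E4) (e k)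
      - ((s : S3) : E4) k * fderiv ℝ g ((s : S3) : E4) ((s : S3) : E4) := by
  have h : (D k (ofAmbient W g hg) : W → ℂ) s
      = ∑ j, ((s : S3) : E4) j * rot j k (ofAmbient W g hg : W → ℂ) s := by
    have h1 := congrArg (fun f : SmoothFn W => (f : W → ℂ) s) (sum_crd_mul_D (ofAmbient W g hg))
    have h2 := congrArg (fun f : SmoothFn W => (f : W → ℂ) s) (sum_crd_sq (W := W))
    simp only [Fin.sum_univ_four, rot] at h1 h2 ⊢
    simp [D_apply] at h1 h2 ⊢
    linear_combination (-fderiv ℝ (radialExt (ofAmbient W g hg : W → ℂ)) ((s : S3) : E4) (e k)) * h2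
      + (((s : S3) : E4) k : ℂ) * h1
  rw [h, fderiv_eq_sum _ (((s : S3) : E4))]
  have h2 := congrArg (fun f : SmoothFn W => (f : W → ℂ) s) (sum_crd_sq (W := W))
  simp only [rot_ofAmbient]
  simp only [Fin.sum_univ_four] at h2 ⊢
  simp at h2 ⊢
  linear_combination (fderiv ℝ g ((s : S3) : E4) (e k)) * h2

/-- Orthogonal projections to the tangent spaces, as a matrix of functions. -/
def proj (i j : Fin 4) : SmoothFn W := (if i = j then 1 else 0) - crd i * crd j

lemma proj_comm (i j : Fin 4) : (proj i j : SmoothFn W) = proj j i := by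
  simp only [proj, eq_comm, mul_comm]

@[simp] lemma D_crd (k i : Fin 4) : D k (crd i : SmoothFn W) = proj k i := by
  apply SmoothFn.ext; intro s
  rw [crd, D_ofAmbient]
  have h (x : E4) : HasFDerivAt (fun x : E4 => ((x i : ℝ) : ℂ))
      (Complex.ofRealCLM ∘L (EuclideanSpace.proj i : E4 →L[ℝ] ℝ)) x :=
    (Complex.ofRealCLM ∘L (EuclideanSpace.proj i : E4 →L[ℝ] ℝ)).hasFDerivAt
  rw [(h _).fderiv]
  by_cases hik : k = i <;> simp [proj, hik, e, eq_comm]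

/-- Schwarz's theorem for the radial extension F. As D_j f extends as ‖x‖ ∂_j F, a further
derivative gives ∂_i ∂_j F, which is symmetric, plus x_i ∂_j F from differentiating ‖x‖, which is
not. -/
lemma D_D_sub (i j : Fin 4) (f : SmoothFn W) :
    D i (D j f) - D j (D i f) = crd i * D j f - crd j * D i f := by
  apply SmoothFn.ext; intro s
  set x : E4 := ((s : S3) : E4) with hx
  set F := radialExt (f : W → ℂ)
  have hxc : x ∈ cone W := coe_mem_cone s
  have hx0 : x ≠ 0 := hxc.1
  have hn : ‖x‖ = 1 := by simp [hx]
  have hF := contDiffAt_radialExt f hxc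
  have hF' : DifferentiableAt ℝ (fderiv ℝ F) x :=
    (hF.fderiv_right (m := 1) (by norm_cast)).differentiableAt (by simp)
  have hN : HasFDerivAt (fun y : E4 => ((‖y‖ : ℝ) : ℂ)) (Complex.ofRealCLM ∘L innerSL ℝ x) x := by
    have h := (contDiffAt_norm ℝ hx0 (n := 1)).differentiableAt (by simp)
    have h1 : HasFDerivAt (fun y : E4 => ‖y‖ ^ 2) (2 • (innerSL ℝ x)) x :=
      (hasStrictFDerivAt_norm_sq x).hasFDerivAt
    have h2 := (h.hasFDerivAt.pow 2).unique h1
    have h3 : fderiv ℝ (fun y : E4 => ‖y‖) x = innerSL ℝ x := by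
      ext v
      have := congrArg (fun T => T v) h2
      simpa [hn] using this
    rw [← h3]
    exact Complex.ofRealCLM.hasFDerivAt.comp x h.hasFDerivAt
  have key (i j : Fin 4) : (D i (D j f) : W → ℂ) s
      = x i * fderiv ℝ F x (e j) + fderiv ℝ (fderiv ℝ F) x (e i) (e j) := by
    have hev : radialExt (D j f : W → ℂ) =ᶠ[nhds x] fun y => ((‖y‖ : ℝ) : ℂ) * fderiv ℝ F y (e j) := by
      filter_upwards [(isOpen_cone W).mem_nhds hxc] with y hy
      exact radialExt_D j f hy
    have h1 := hN.fun_mul (hF'.hasFDerivAt.clm_apply (hasFDerivAt_const (e j) x))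
    rw [D_apply, hev.fderiv_eq, h1.fderiv]
    simp [hn, e, EuclideanSpace.inner_single_right]
    ring
  have hs : IsSymmSndFDerivAt ℝ F x :=
    hF.isSymmSndFDerivAt (by simp; norm_cast)
  have := hs (e i) (e j)
  simp only [AddSubgroupClass.coe_sub, MulMemClass.coe_mul, Pi.sub_apply, Pi.mul_apply, key,
    D_apply, crd_apply]
  rw [this]
  ring

lemma J_apply (j k : Fin 4) (f : SmoothFn W) : J j k f = crd j * D k f - crd k * D j f := rfl

/-- On a connected open set, only constants have vanishing derivatives. -/
lemma exists_eq_algebraMap_of_D_eq_zero (hW : IsPreconnected (W : Set S3)) [Nonempty W]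
    (f : SmoothFn W) (hf : ∀ k, D k f = 0) : ∃ c : ℂ, f = algebraMap ℂ (SmoothFn W) c := by
  have hz : ∀ x ∈ cone W, fderiv ℝ (radialExt (f : W → ℂ)) x = 0 := by
    intro x hx
    ext v
    rw [fderiv_eq_sum]
    refine Finset.sum_eq_zero fun k _ => ?_
    have h := radialExt_D k f hx
    rw [hf k] at h
    have h0 : radialExt ((0 : SmoothFn W) : W → ℂ) x = 0 := by simp [radialExt]
    have : (‖x‖ : ℂ) ≠ 0 := Complex.ofReal_ne_zero.2 (norm_ne_zero_iff.2 hx.1)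
    rw [h0] at h
    have := (mul_eq_zero.1 h.symm).resolve_left this
    rw [this, mul_zero]
  have hdiff : DifferentiableOn ℝ (radialExt (f : W → ℂ)) (cone W) := fun x hx =>
    ((contDiffAt_radialExt f hx).differentiableAt (by simp)).differentiableWithinAt
  have hpre : IsPreconnected (cone W) := by
    -- Polar coordinates exhibit the cone as a continuous image of W × (0, ∞).
    have h1 : cone W = (fun q : S3 × ℝ => q.2 • (q.1 : E4)) '' ((W : Set S3) ×ˢ Set.Ioi 0) := by
      ext x
      constructor
      · intro hx
        refine ⟨(toSphere x hx.1, ‖x‖), ⟨hx.2, norm_pos_iff.2 hx.1⟩, ?_⟩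
        simp [toSphere, hx.1]
      · rintro ⟨⟨s, r⟩, ⟨hs, hr⟩, rfl⟩
        exact smul_mem_cone hr (coe_mem_cone ⟨s, hs⟩)
    rw [h1]
    exact (hW.prod isPreconnected_Ioi).image _ (by fun_prop)
  obtain ⟨s₀⟩ := ‹Nonempty W›
  refine ⟨(f : W → ℂ) s₀, SmoothFn.ext fun s => ?_⟩
  have := (isOpen_cone W).is_const_of_fderiv_eq_zero hpre hdiff hz
    (coe_mem_cone s) (coe_mem_cone s₀)
  simpa using this

/-! ### Relations between the coordinates and the derivations -/

lemma D_mul (k : Fin 4) (f g : SmoothFn W) : D k (f * g) = f * D k g + g * D k f := by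
  simp [Derivation.leibniz]

@[simp] lemma D_one (k : Fin 4) : D k (1 : SmoothFn W) = 0 := (D k).map_one_eq_zero

lemma sum_proj_mul_D (i : Fin 4) (f : SmoothFn W) : ∑ j, proj i j * D j f = D i f := by
  have h : ∀ j, (proj i j : SmoothFn W) * D j f = (if i = j then D j f else 0)
      - crd i * (crd j * D j f) := by
    intro j
    rw [proj]
    split_ifs <;> ring
  simp only [h, Finset.sum_sub_distrib, ← Finset.mul_sum, sum_crd_mul_D]
  simp

lemma sum_crd_mul_proj (i : Fin 4) : ∑ j, crd j * (proj i j : SmoothFn W) = 0 := by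
  simpa [proj_comm] using sum_crd_mul_D (crd i : SmoothFn W)

lemma J_mul (a b : Fin 4) (f g : SmoothFn W) :
    J a b (f * g) = f * J a b g + g * J a b f := by
  simp only [J_apply, D_mul]; ring

@[simp] lemma J_one (a b : Fin 4) : J a b (1 : SmoothFn W) = 0 := by simp [J_apply]

lemma J_crd (a b k : Fin 4) : J a b (crd k : SmoothFn W) =
    (if b = k then crd a else 0) - (if a = k then crd b else 0) := by
  simp only [J_apply, D_crd, proj]
  split_ifs <;> ring

lemma sum_J_crd_mul_D (a b : Fin 4) (g : SmoothFn W) : ∑ k, J a b (crd k) * D k g = J a b g := by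
  simp only [J_apply a b g, ← sum_proj_mul_D a g, ← sum_proj_mul_D b g]
  simp only [J_apply, D_crd, Finset.mul_sum, ← Finset.sum_sub_distrib]
  exact Finset.sum_congr rfl fun k _ => by ring

/-- The `D k` rotate like the components of a vector; this is what makes Σ D_k² rotation invariant.
-/
lemma J_D_sub (a b k : Fin 4) (f : SmoothFn W) : J a b (D k f) - D k (J a b f) =
    (if b = k then D a f else 0) - (if a = k then D b f else 0) := by
  have h1 := D_D_sub b k f
  have h2 := D_D_sub a k f
  simp only [J_apply, map_sub, D_mul, D_crd, proj]
  simp only [eq_comm (a := k)]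
  split_ifs <;> linear_combination crd a * h1 - crd b * h2

/-! ### Symbols as biderivations -/

/-- The symmetric biderivation `½ [[P, g], h] 1` that polarizes the symbol of `P`. -/
def Gam (P : Op W) (g h : SmoothFn W) : SmoothFn W :=
  (1 / 2 : ℂ) • ⁅⁅P, mulOp g⁆, mulOp h⁆ (1 : SmoothFn W)

lemma lie_lie_apply (P : Op W) (g h f : SmoothFn W) : ⁅⁅P, mulOp g⁆, mulOp h⁆ f =
    P (g * (h * f)) - g * P (h * f) - h * P (g * f) + h * (g * P f) := by
  simp only [Ring.lie_def, LinearMap.sub_apply, Module.End.mul_apply, mulOp, Algebra.coe_lmul_eq_mul,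
    LinearMap.mul_apply', mul_sub]
  ring

lemma smul_two_half (f : SmoothFn W) : (2 : SmoothFn W) * ((1 / 2 : ℂ) • f) = f := by
  have h : (2 : SmoothFn W) = algebraMap ℂ (SmoothFn W) 2 := (map_ofNat _ 2).symm
  rw [Algebra.smul_def, h, ← mul_assoc, ← map_mul]
  norm_num

/-- The double commutator evaluated at 1, solved for P(gh). It holds for every linear operator;
order at most two enters only when `Gam P` has to be a biderivation. -/
lemma apply_mul (P : Op W) (g h : SmoothFn W) :
    P (g * h) = g * P h + h * P g + 2 * Gam P g h - g * (h * P 1) := by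
  rw [Gam, smul_two_half, lie_lie_apply]
  simp only [mul_one]
  ring

lemma Gam_eq_of_two_mul {P : Op W} {g h r : SmoothFn W}
    (H : P (g * h) - g * P h - h * P g + g * (h * P 1) = 2 * r) : Gam P g h = r := by
  have h1 := apply_mul P g h
  have h2 : (2 : SmoothFn W) * Gam P g h = 2 * r := by rw [← H, h1]; ring
  have h3 := congrArg (fun f => (1 / 2 : ℂ) • f) h2
  simpa only [← mul_smul_comm, smul_two_half] using h3

lemma Gam_comm (P : Op W) (g h : SmoothFn W) : Gam P g h = Gam P h g := by
  apply Gam_eq_of_two_mul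
  have := apply_mul P h g
  rw [mul_comm g h, this]; ring

@[simp] lemma Gam_add (P Q : Op W) (g h : SmoothFn W) : Gam (P + Q) g h = Gam P g h + Gam Q g h := by
  apply Gam_eq_of_two_mul
  simp only [LinearMap.add_apply]
  linear_combination apply_mul P g h + apply_mul Q g h

@[simp] lemma Gam_zero (g h : SmoothFn W) : Gam (0 : Op W) g h = 0 := by
  apply Gam_eq_of_two_mul
  simp

@[simp] lemma Gam_sub (P Q : Op W) (g h : SmoothFn W) : Gam (P - Q) g h = Gam P g h - Gam Q g h := by
  apply Gam_eq_of_two_mul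
  simp only [LinearMap.sub_apply]
  linear_combination apply_mul P g h - apply_mul Q g h

@[simp] lemma Gam_smul (c : ℂ) (P : Op W) (g h : SmoothFn W) : Gam (c • P) g h = c • Gam P g h := by
  apply Gam_eq_of_two_mul
  have hc : ∀ f : SmoothFn W, (c • P) f = algebraMap ℂ (SmoothFn W) c * P f := fun f => by
    rw [← Algebra.smul_def]; rfl
  simp only [hc, Algebra.smul_def c (Gam P g h)]
  linear_combination algebraMap ℂ (SmoothFn W) c * apply_mul P g h

@[simp] lemma Gam_mulOp (f g h : SmoothFn W) : Gam (mulOp f) g h = 0 := by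
  apply Gam_eq_of_two_mul
  simp [mulOp]
  ring

@[simp] lemma Gam_one_op (g h : SmoothFn W) : Gam (1 : Op W) g h = 0 := by
  rw [← map_one (mulOp (W := W)), Gam_mulOp]

lemma Gam_symm_J (a b c d : Fin 4) (g h : SmoothFn W) :
    Gam (symm (J a b) (J c d)) g h = J a b g * J c d h + J c d g * J a b h := by
  apply Gam_eq_of_two_mul
  simp only [symm, LinearMap.add_apply, Module.End.mul_apply, J_mul, map_add, J_one, map_zero]
  ring

lemma Gam_sq_J (a b : Fin 4) (g h : SmoothFn W) :
    Gam (J a b ^ 2) g h = J a b g * J a b h := by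
  apply Gam_eq_of_two_mul
  simp only [sq, Module.End.mul_apply, J_mul, map_add, J_one, map_zero]
  ring

lemma op_sub_mem {S : Submodule ℂ (Op W)} {P Q : Op W} (hP : P ∈ S) (hQ : Q ∈ S) : P - Q ∈ S := by
  have h : P - Q = P + (-1 : ℂ) • Q := LinearMap.ext fun f => by
    have : ((-1 : ℂ) • Q) f = (-1 : ℂ) • Q f := rfl
    simp [this, sub_eq_add_neg]
  rw [h]
  exact S.add_mem hP (S.smul_mem _ hQ)

/-! ### Coefficients of differential operators -/

/-- Operators `∑ βₖ Dₖ + c`. -/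
def firstOrder (W : Opens S3) : Submodule ℂ (Op W) where
  carrier := {P | ∃ (b : Fin 4 → SmoothFn W) (c : SmoothFn W), ∀ f, P f = ∑ k, b k * D k f + c * f}
  add_mem' := by
    rintro P Q ⟨b, c, hP⟩ ⟨b', c', hQ⟩
    refine ⟨b + b', c + c', fun f => ?_⟩
    simp only [LinearMap.add_apply, hP, hQ, Pi.add_apply, add_mul, Finset.sum_add_distrib]
    ring
  zero_mem' := ⟨0, 0, fun f => by simp⟩
  smul_mem' := by
    rintro r P ⟨b, c, hP⟩
    refine ⟨r • b, r • c, fun f => ?_⟩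
    simp [hP, smul_add, Finset.smul_sum]

/-- Operators `∑ αᵢⱼ Dᵢ Dⱼ + ∑ βₖ Dₖ + c`. -/
def secondOrder (W : Opens S3) : Submodule ℂ (Op W) where
  carrier := {P | ∃ (a : Fin 4 → Fin 4 → SmoothFn W) (b : Fin 4 → SmoothFn W) (c : SmoothFn W),
    ∀ f, P f = ∑ i, ∑ j, a i j * D i (D j f) + ∑ k, b k * D k f + c * f}
  add_mem' := by
    rintro P Q ⟨a, b, c, hP⟩ ⟨a', b', c', hQ⟩
    refine ⟨a + a', b + b', c + c', fun f => ?_⟩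
    simp only [LinearMap.add_apply, hP, hQ, Pi.add_apply, add_mul, Finset.sum_add_distrib]
    ring
  zero_mem' := ⟨0, 0, 0, fun f => by simp⟩
  smul_mem' := by
    rintro r P ⟨a, b, c, hP⟩
    refine ⟨r • a, r • b, r • c, fun f => ?_⟩
    simp [hP, smul_add, Finset.smul_sum]

lemma diffOps_one_le : diffOps W 1 ≤ firstOrder W := by
  refine sup_le ?_ (iSup_le fun j => iSup_le fun k => ?_)
  · rintro _ ⟨c, rfl⟩
    exact ⟨0, c, fun f => by simp⟩
  · rintro _ ⟨_, ⟨c, rfl⟩, rfl⟩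
    refine ⟨fun i => (if i = k then c * crd j else 0) - (if i = j then c * crd k else 0), 0,
      fun f => ?_⟩
    simp [sub_mul, J_apply, mul_sub, mul_assoc]

lemma firstOrder_mul_D {Q : Op W} (hQ : Q ∈ firstOrder W) (g : SmoothFn W) (k : Fin 4) :
    Q * (mulOp g * ((D k).toLinearMap : Op W)) ∈ secondOrder W := by
  obtain ⟨b, c, h⟩ := hQ
  refine ⟨fun i j => if j = k then b i * g else 0,
    fun j => if j = k then ∑ i, b i * D i g + c * g else 0, 0, fun f => ?_⟩
  simp only [Module.End.mul_apply, h, Algebra.coe_lmul_eq_mul, LinearMap.mul_apply',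
    Derivation.coeFn_coe, D_mul, mul_add, Finset.sum_add_distrib, ite_mul, zero_mul,
    Finset.sum_ite_eq', Finset.mem_univ, if_true, add_mul, Finset.sum_mul]
  have h1 : ∀ i, b i * (D k f * D i g) = b i * D i g * D k f := fun i => by ring
  have h2 : ∀ i, b i * (g * D i (D k f)) = b i * g * D i (D k f) := fun i => by ring
  simp only [h1, h2]
  ring

/-- Rotations are combinations of the `D k`, and Leibniz moves coefficients to the left. The
resulting coefficients are not unique, because Σ s_k D_k = 0 and the `D k` do not commute, so
invariant statements are made about `Gam` instead. -/
lemma diffOps_two_le : diffOps W 2 ≤ secondOrder W := by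
  refine sup_le ?_ (iSup_le fun j => iSup_le fun k => ?_)
  · intro P hP
    obtain ⟨b, c, h⟩ := diffOps_one_le hP
    exact ⟨0, b, c, fun f => by simp [h]⟩
  · rintro _ ⟨Q, hQ, rfl⟩
    have hQ := diffOps_one_le hQ
    have h : Q * J j k = Q * (mulOp (crd j) * ((D k).toLinearMap : Op W))
        - Q * (mulOp (crd k) * ((D j).toLinearMap : Op W)) :=
      LinearMap.ext fun f => Q.map_sub (crd j * D k f) (crd k * D j f)
    rw [LinearMap.mulRight_apply, h]
    exact op_sub_mem (firstOrder_mul_D hQ _ _) (firstOrder_mul_D hQ _ _)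

/-- The double commutator removes everything of order at most one and leaves only the cross terms of
the second derivatives, so f itself is not differentiated. -/
lemma lie_lie_secondOrder {P : Op W} {a : Fin 4 → Fin 4 → SmoothFn W} {b : Fin 4 → SmoothFn W}
    {c : SmoothFn W}
    (hP : ∀ f, P f = ∑ i, ∑ j, a i j * D i (D j f) + ∑ k, b k * D k f + c * f)
    (g h f : SmoothFn W) : ⁅⁅P, mulOp g⁆, mulOp h⁆ f =
      (∑ i, ∑ j, a i j * (D i g * D j h + D j g * D i h)) * f := by
  rw [lie_lie_apply]
  simp only [hP, Finset.mul_sum, mul_add, Finset.sum_mul]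
  have e1 : ∀ A B C E A' B' C' E' A'' B'' C'' E'' : SmoothFn W,
      (A + B + C) - (A' + B' + C') - (A'' + B'' + C'') + (E + E' + E'')
      = (A - A' - A'' + E) + (B - B' - B'' + E') + (C - C' - C'' + E'') := by intros; ring
  rw [e1]
  simp only [← Finset.sum_sub_distrib, ← Finset.sum_add_distrib, D_mul, map_add]
  have e2 : (c * (g * (h * f)) - g * (c * (h * f)) - h * (c * (g * f)) + h * (g * (c * f))) = 0 := by
    ring
  rw [e2, add_zero]
  have e3 : ∑ k, (b k * (g * (h * D k f + f * D k h) + h * f * D k g)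
      - g * (b k * (h * D k f + f * D k h)) - h * (b k * (g * D k f + f * D k g))
      + h * (g * (b k * D k f))) = 0 := Finset.sum_eq_zero fun k _ => by ring
  rw [Finset.sum_add_distrib, e3, add_zero]
  exact Finset.sum_congr rfl fun i _ => Finset.sum_congr rfl fun j _ => by ring

lemma lie_lie_eq_mulOp {P : Op W} (hP : P ∈ diffOps W 2) (g h : SmoothFn W) :
    ⁅⁅P, mulOp g⁆, mulOp h⁆ = mulOp (2 * Gam P g h) := by
  obtain ⟨a, b, c, hP⟩ := diffOps_two_le hP
  apply LinearMap.ext; intro f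
  rw [Gam, smul_two_half, lie_lie_secondOrder hP, lie_lie_secondOrder hP, mul_one]
  rfl

lemma Gam_secondOrder {P : Op W} {a : Fin 4 → Fin 4 → SmoothFn W} {b : Fin 4 → SmoothFn W}
    {c : SmoothFn W}
    (hP : ∀ f, P f = ∑ i, ∑ j, a i j * D i (D j f) + ∑ k, b k * D k f + c * f)
    (g h : SmoothFn W) :
    2 * Gam P g h = ∑ i, ∑ j, a i j * (D i g * D j h + D j g * D i h) := by
  rw [Gam, smul_two_half, lie_lie_secondOrder hP, mul_one]

lemma two_mul_cancel {f g : SmoothFn W} (h : 2 * f = 2 * g) : f = g := by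
  have h3 := congrArg (fun f => (1 / 2 : ℂ) • f) h
  simpa only [← mul_smul_comm, smul_two_half] using h3

/-- The chain rule in the second slot: `Gam P g` is a combination of the `D k`, hence fixed by its
values on the coordinates. From this follow the Leibniz rule and tangency. -/
lemma sum_Gam_crd_mul_D {P : Op W} (hP : P ∈ diffOps W 2) (g h : SmoothFn W) :
    ∑ k, Gam P g (crd k) * D k h = Gam P g h := by
  obtain ⟨a, b, c, hP⟩ := diffOps_two_le hP
  apply two_mul_cancel
  rw [Gam_secondOrder hP, Finset.mul_sum]
  simp only [← mul_assoc, Gam_secondOrder hP, Finset.sum_mul]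
  rw [Finset.sum_comm]
  refine Finset.sum_congr rfl fun i _ => ?_
  rw [Finset.sum_comm]
  refine Finset.sum_congr rfl fun j _ => ?_
  simp only [D_crd]
  rw [← sum_proj_mul_D i h, ← sum_proj_mul_D j h, Finset.mul_sum, Finset.mul_sum,
    ← Finset.sum_add_distrib, Finset.mul_sum]
  exact Finset.sum_congr rfl fun k _ => by ring

lemma Gam_mul {P : Op W} (hP : P ∈ diffOps W 2) (g f h : SmoothFn W) :
    Gam P g (f * h) = f * Gam P g h + h * Gam P g f := by
  rw [← sum_Gam_crd_mul_D hP g (f * h), ← sum_Gam_crd_mul_D hP g f, ← sum_Gam_crd_mul_D hP g h]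
  simp only [D_mul, Finset.mul_sum, ← Finset.sum_add_distrib]
  exact Finset.sum_congr rfl fun k _ => by ring

lemma Gam_one {P : Op W} (hP : P ∈ diffOps W 2) (g : SmoothFn W) : Gam P g 1 = 0 := by
  rw [← sum_Gam_crd_mul_D hP]
  simp

lemma sum_crd_mul_Gam {P : Op W} (hP : P ∈ diffOps W 2) (g : SmoothFn W) :
    ∑ k, crd k * Gam P g (crd k) = 0 := by
  have h1 : ∀ k, crd k * Gam P g (crd k) = ∑ l, crd k * (Gam P g (crd l) * proj l k) := by
    intro k
    conv_lhs => rw [← sum_Gam_crd_mul_D hP g (crd k)]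
    simp only [D_crd, Finset.mul_sum]
  simp only [h1]
  rw [Finset.sum_comm]
  refine Finset.sum_eq_zero fun k _ => ?_
  have := sum_crd_mul_proj (W := W) k
  calc ∑ i, crd i * (Gam P g (crd k) * proj k i) = Gam P g (crd k) * ∑ i, crd i * proj k i := by
        rw [Finset.mul_sum]; exact Finset.sum_congr rfl fun i _ => by ring
    _ = 0 := by rw [this, mul_zero]

/-- An operator of order at most two with vanishing symbol is of order at most one. -/
lemma exists_firstOrder_of_Gam_eq_zero {P : Op W} (hP : P ∈ diffOps W 2)
    (h0 : ∀ i j, Gam P (crd i) (crd j) = 0) :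
    ∃ (b : Fin 4 → SmoothFn W) (c : SmoothFn W), ∑ k, crd k * b k = 0 ∧
      ∀ f, P f = ∑ k, b k * D k f + c * f := by
  obtain ⟨a, b, c, hP⟩ := diffOps_two_le hP
  -- The coefficient matrix projected to the tangent space. A vanishing symbol makes it
  -- antisymmetric, and an antisymmetric combination of the D_k D_l is of first order by `D_D_sub`.
  set t : Fin 4 → Fin 4 → SmoothFn W := fun k l => ∑ i, ∑ j, a i j * (proj i k * proj j l) with ht
  have hanti : ∀ k l, t k l = - t l k := by
    intro k l
    have h := Gam_secondOrder hP (crd k) (crd l)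
    rw [h0, mul_zero] at h
    simp only [D_crd, mul_add, Finset.sum_add_distrib] at h
    rw [ht]
    simp only
    rw [eq_neg_iff_add_eq_zero, h]
    congr 1
    exact Finset.sum_congr rfl fun i _ => Finset.sum_congr rfl fun j _ => by ring
  set u : Fin 4 → SmoothFn W := fun l => ∑ i, ∑ j, a i j * D i (proj j l) with hu
  have h1 : ∀ f, ∑ i, ∑ j, a i j * D i (D j f)
      = ∑ k, ∑ l, t k l * D k (D l f) + ∑ l, u l * D l f := by
    intro f
    have e1 : ∀ i j, D i (D j f) = ∑ l, (∑ k, proj i k * proj j l * D k (D l f)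
        + D i (proj j l) * D l f) := by
      intro i j
      conv_lhs => rw [← sum_proj_mul_D j f]
      rw [map_sum]
      refine Finset.sum_congr rfl fun l _ => ?_
      rw [D_mul, ← sum_proj_mul_D i (D l f), Finset.mul_sum]
      congr 1
      · exact Finset.sum_congr rfl fun k _ => by ring
      · ring
    have e2 : ∀ i j, a i j * D i (D j f) = ∑ k, ∑ l, a i j * (proj i k * proj j l) * D k (D l f)
        + ∑ l, a i j * D i (proj j l) * D l f := by
      intro i j
      rw [e1, Finset.sum_add_distrib, mul_add, Finset.sum_comm, Finset.mul_sum, Finset.mul_sum]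
      congr 1
      · refine Finset.sum_congr rfl fun k _ => ?_
        rw [Finset.mul_sum]
        exact Finset.sum_congr rfl fun l _ => by ring
      · exact Finset.sum_congr rfl fun l _ => by ring
    simp only [e2, Finset.sum_add_distrib]
    congr 1
    · have : ∀ k l, t k l * D k (D l f)
          = ∑ i, ∑ j, a i j * (proj i k * proj j l) * D k (D l f) := by
        intro k l; rw [ht]; simp only [Finset.sum_mul]
      simp only [this]
      have s1 : ∀ i, ∑ j, ∑ k, ∑ l, a i j * (proj i k * proj j l) * D k (D l f)
          = ∑ k, ∑ l, ∑ j, a i j * (proj i k * proj j l) * D k (D l f) := by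
        intro i
        rw [Finset.sum_comm]
        exact Finset.sum_congr rfl fun k _ => Finset.sum_comm
      simp only [s1]
      rw [Finset.sum_comm]
      exact Finset.sum_congr rfl fun k _ => Finset.sum_comm
    · have : ∀ l, u l * D l f = ∑ i, ∑ j, a i j * D i (proj j l) * D l f := by
        intro l; rw [hu]; simp only [Finset.sum_mul]
      simp only [this]
      calc ∑ i, ∑ j, ∑ l, a i j * D i (proj j l) * D l f
          = ∑ i, ∑ l, ∑ j, a i j * D i (proj j l) * D l f :=
            Finset.sum_congr rfl fun i _ => Finset.sum_comm
        _ = _ := Finset.sum_comm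
  have h2 : ∀ f, ∑ k, ∑ l, t k l * D k (D l f) = ∑ l, (∑ k, t k l * crd k) * D l f := by
    intro f
    apply two_mul_cancel
    have e1 : ∑ k, ∑ l, t k l * D k (D l f) = ∑ k, ∑ l, t l k * D l (D k f) := Finset.sum_comm
    have e2 : ∑ k, ∑ l, t k l * (crd k * D l f) = ∑ k, ∑ l, t l k * (crd l * D k f) :=
      Finset.sum_comm
    have e3 : ∑ l, (∑ k, t k l * crd k) * D l f = ∑ k, ∑ l, t k l * (crd k * D l f) := by
      rw [Finset.sum_comm]
      refine Finset.sum_congr rfl fun l _ => ?_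
      rw [Finset.sum_mul]
      exact Finset.sum_congr rfl fun k _ => by ring
    rw [e3, two_mul, two_mul]
    nth_rewrite 2 [e1]
    nth_rewrite 2 [e2]
    simp only [← Finset.sum_add_distrib]
    refine Finset.sum_congr rfl fun k _ => Finset.sum_congr rfl fun l _ => ?_
    rw [hanti l k]
    linear_combination t k l * D_D_sub k l f
  set v : Fin 4 → SmoothFn W := fun l => ∑ k, t k l * crd k + u l + b l with hv
  have h3 : ∀ f, P f = ∑ l, v l * D l f + c * f := by
    intro f
    rw [hP, h1, h2, hv]
    simp only [add_mul, Finset.sum_add_distrib]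
  -- Removing the radial component makes the field tangent and does not change the operator, as Σ
  -- s_k D_k = 0.
  refine ⟨fun k => v k - crd k * ∑ j, crd j * v j, c, ?_, fun f => ?_⟩
  · have h4 : ∀ k, crd k * (v k - crd k * ∑ j, crd j * v j)
        = crd k * v k - crd k ^ 2 * ∑ j, crd j * v j := fun k => by ring
    simp only [h4, Finset.sum_sub_distrib, ← Finset.sum_mul, sum_crd_sq, one_mul, sub_self]
  · have h5 : ∀ k, (v k - crd k * ∑ j, crd j * v j) * D k f
        = v k * D k f - (∑ j, crd j * v j) * (crd k * D k f) := fun k => by ring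
    simp only [h5, Finset.sum_sub_distrib, ← Finset.mul_sum, sum_crd_mul_D, mul_zero, sub_zero, h3]

/-! ### Quadratic operators in the rotations -/

lemma diffOps_le_succ (n : ℕ) : diffOps W n ≤ diffOps W (n + 1) := le_sup_left

lemma mulOp_mem_diffOps_two (f : SmoothFn W) : mulOp f ∈ diffOps W 2 :=
  diffOps_le_succ 1 (diffOps_le_succ 0 ⟨f, rfl⟩)

lemma mul_J_mem_diffOps {n : ℕ} {P : Op W} (hP : P ∈ diffOps W n) (j k : Fin 4) :
    P * J j k ∈ diffOps W (n + 1) :=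
  (le_sup_right : _ ≤ diffOps W (n + 1)) (Submodule.mem_iSup_of_mem j
    (Submodule.mem_iSup_of_mem k ⟨P, hP, rfl⟩))

lemma J_mul_J_mem_diffOps (a b c d : Fin 4) : J a b * J c d ∈ diffOps W 2 := by
  refine mul_J_mem_diffOps ?_ c d
  have h : (1 : Op W) ∈ diffOps W 0 := ⟨1, map_one mulOp⟩
  simpa using mul_J_mem_diffOps h a b

/-- Linear combinations of the symmetrized products `{J_{ab}, J_{cd}}`. -/
def quadOps (W : Opens S3) : Submodule ℂ (Op W) :=
  Submodule.span ℂ {Q | ∃ a b c d, Q = symm (J a b) (J c d)}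

lemma symm_J_mem_quadOps (a b c d : Fin 4) : symm (J a b) (J c d) ∈ quadOps W :=
  Submodule.subset_span ⟨a, b, c, d, rfl⟩

lemma J_sq_mem_quadOps (a b : Fin 4) : (J a b ^ 2 : Op W) ∈ quadOps W := by
  have h : (J a b ^ 2 : Op W) = (1 / 2 : ℂ) • (symm (J a b) (J a b) : Op W) := by
    apply LinearMap.ext; intro f
    have : ((1 / 2 : ℂ) • (symm (J a b) (J a b) : Op W)) f = (1 / 2 : ℂ) • (J a b (J a b f) + J a b (J a b f)) :=
      rfl
    rw [this, ← two_mul, ← mul_smul_comm, smul_two_half, sq]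
    rfl
  rw [h]
  exact Submodule.smul_mem _ _ (symm_J_mem_quadOps _ _ _ _)

lemma quadOps_le : quadOps W ≤ diffOps W 2 := by
  refine Submodule.span_le.2 ?_
  rintro _ ⟨a, b, c, d, rfl⟩
  exact Submodule.add_mem _ (J_mul_J_mem_diffOps _ _ _ _) (J_mul_J_mem_diffOps _ _ _ _)

lemma laplaceS_mem_quadOps : laplaceS ∈ quadOps W :=
  Submodule.sum_mem _ fun _ _ => J_sq_mem_quadOps _ _

lemma laplaceS_eq_six : (laplaceS : Op W) = J 0 1 ^ 2 + J 0 2 ^ 2 + J 0 3 ^ 2 + J 1 2 ^ 2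
    + J 1 3 ^ 2 + J 2 3 ^ 2 := by
  have h : (Finset.univ.filter fun q : Fin 4 × Fin 4 => q.1 < q.2)
      = {(0, 1), (0, 2), (0, 3), (1, 2), (1, 3), (2, 3)} := by decide
  rw [laplaceS, h]
  simp [Finset.sum_insert, add_assoc]

/-- Lagrange's identity: in the expansion of Σ_{j<k} (s_j D_k − s_k D_j)², the relation Σ s_j² = 1
leaves Σ D_k², and the rest consists of contractions with Σ s_j D_j = 0. -/
lemma laplaceS_apply (f : SmoothFn W) : laplaceS f = ∑ k, D k (D k f) := by
  have hn := sum_crd_sq (W := W)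
  have h0 := sum_crd_mul_D f
  have h1 : ∀ k, ∑ j, crd j * D j (D k f) = 0 := fun k => sum_crd_mul_D (D k f)
  have hJ : ∀ j k, (J j k ^ 2 : Op W) f = crd j * (crd j * D k (D k f) + D k f * proj k j
      - (crd k * D k (D j f) + D j f * proj k k)) - crd k * (crd j * D j (D k f)
      + D k f * proj j j - (crd k * D j (D j f) + D j f * proj j k)) := by
    intro j k
    rw [sq, Module.End.mul_apply]
    simp only [J_apply, map_sub, D_mul, D_crd]
    ring
  have h10 := h1 0
  have h11 := h1 1
  have h12 := h1 2
  have h13 := h1 3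
  rw [laplaceS_eq_six]
  simp only [LinearMap.add_apply, hJ, proj]
  simp only [Fin.sum_univ_four] at *
  simp only [Fin.reduceEq, if_true, if_false]
  linear_combination (D 0 (D 0 f) + D 1 (D 1 f) + D 2 (D 2 f) + D 3 (D 3 f)) * hn
    - crd 0 * h10 - crd 1 * h11 - crd 2 * h12 - crd 3 * h13 - 3 * h0

lemma Gam_laplaceS (g h : SmoothFn W) : Gam laplaceS g h = ∑ k, D k g * D k h := by
  apply Gam_eq_of_two_mul
  simp only [laplaceS_apply, D_mul, map_add, D_one, map_zero, Finset.sum_const_zero, mul_zero,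
    add_zero, Finset.mul_sum, ← Finset.sum_sub_distrib]
  exact Finset.sum_congr rfl fun k _ => by ring

lemma Gam_laplaceS_crd (k : Fin 4) (g : SmoothFn W) : Gam laplaceS (crd k) g = D k g := by
  simp only [Gam_laplaceS, D_crd]
  rw [← sum_proj_mul_D k g]
  simp only [proj_comm]

/-- `J_D_sub` is applied twice in each summand; the correction terms cancel on summing over k
because a rotation is antisymmetric. -/
lemma commute_laplaceS_J (a b : Fin 4) : Commute (laplaceS : Op W) (J a b) := by
  apply LinearMap.ext; intro f
  simp only [Module.End.mul_apply, laplaceS_apply, map_sum]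
  rw [← sub_eq_zero, ← Finset.sum_sub_distrib]
  have h : ∀ k, D k (D k (J a b f)) - J a b (D k (D k f)) =
      (if a = k then D k (D b f) + D b (D k f) else 0)
      - (if b = k then D k (D a f) + D a (D k f) else 0) := by
    intro k
    have h1 := J_D_sub a b k f
    have h2 := J_D_sub a b k (D k f)
    have h3 : D k (J a b f) = J a b (D k f) - ((if b = k then D a f else 0)
      - (if a = k then D b f else 0)) := by linear_combination -h1
    rw [h3]
    split_ifs at * <;> simp only [map_sub, map_zero] at * <;> linear_combination -h2
  simp only [h, Finset.sum_sub_distrib]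
  simp
  ring

lemma commute_laplaceS_of_mem_quadOps {Q : Op W} (hQ : Q ∈ quadOps W) : Commute laplaceS Q := by
  induction hQ using Submodule.span_induction with
  | mem Q hQ =>
    obtain ⟨a, b, c, d, rfl⟩ := hQ
    have h1 := commute_laplaceS_J (W := W) a b
    have h2 := commute_laplaceS_J (W := W) c d
    exact (h1.mul_right h2).add_right (h2.mul_right h1)
  | zero => exact Commute.zero_right _
  | add P Q _ _ hP hQ => exact hP.add_right hQ
  | smul c Q _ hQ => exact hQ.smul_right c

/-- The left side is the divergence of g times a rotation field. Rotation fields are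
divergence-free, here by the symmetry of `proj`, so only the derivative of g along the field is
left. -/
lemma sum_D_mul_J_crd (a b : Fin 4) (g : SmoothFn W) :
    ∑ k, D k (g * J a b (crd k)) = J a b g := by
  have h : ∀ k, D k (g * J a b (crd k)) = J a b (crd k) * D k g
      + ((if b = k then g * proj k a else 0) - (if a = k then g * proj k b else 0)) := by
    intro k
    rw [J_crd, D_mul]
    split_ifs <;> simp <;> ring
  simp only [h, Finset.sum_add_distrib, sum_J_crd_mul_D, Finset.sum_sub_distrib]
  simp [proj_comm a b]

/-- Elements of `quadOps` are in divergence form. -/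
lemma sum_D_Gam {Q : Op W} (hQ : Q ∈ quadOps W) (V : SmoothFn W) :
    ∑ k, D k (Gam Q V (crd k)) = Q V := by
  induction hQ using Submodule.span_induction with
  | mem Q hQ =>
    obtain ⟨a, b, c, d, rfl⟩ := hQ
    simp only [Gam_symm_J, map_add, Finset.sum_add_distrib, sum_D_mul_J_crd]
    simp only [symm, LinearMap.add_apply, Module.End.mul_apply]
    ring
  | zero => simp
  | add P Q _ _ hP hQ => simp only [Gam_add, map_add, Finset.sum_add_distrib, hP, hQ]; rfl
  | smul c Q _ hQ =>
    have h : (c • Q) V = c • Q V := rfl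
    rw [h, ← hQ, Finset.smul_sum]
    exact Finset.sum_congr rfl fun k _ => by rw [Gam_smul, Derivation.map_smul]

lemma apply_one_of_mem_quadOps {Q : Op W} (hQ : Q ∈ quadOps W) : Q 1 = 0 := by
  rw [← sum_D_Gam hQ]
  simp [Gam_comm Q 1, Gam_one (quadOps_le hQ)]

/-- `Q + f` commutes with `Δ + V` if `∇f = Q(∇V)`. -/
lemma commute_of_D_eq_Gam {Q : Op W} (hQ : Q ∈ quadOps W) {f V : SmoothFn W}
    (h : ∀ k, D k f = Gam Q V (crd k)) :
    Commute (Q + mulOp f) (laplaceS + mulOp V) := by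
  -- The divergence of the hypothesis. It matches the zeroth-order parts of [Q, V] and [Δ, f]; `h3`
  -- below matches their first-order parts, and [Q, Δ] = 0.
  have hL : laplaceS f = Q V := by rw [laplaceS_apply, ← sum_D_Gam hQ]; simp only [h]
  apply LinearMap.ext; intro g
  have h1 := apply_mul Q V g
  have h2 := apply_mul laplaceS f g
  have h3 : Gam Q V g = Gam laplaceS f g := by
    rw [← sum_Gam_crd_mul_D (quadOps_le hQ), Gam_laplaceS]; simp only [h]
  have h4 : laplaceS (Q g) = Q (laplaceS g) :=
    LinearMap.congr_fun (commute_laplaceS_of_mem_quadOps hQ) g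
  rw [apply_one_of_mem_quadOps hQ] at h1
  rw [apply_one_of_mem_quadOps laplaceS_mem_quadOps] at h2
  simp only [Module.End.mul_apply, LinearMap.add_apply, map_add, Algebra.coe_lmul_eq_mul,
    LinearMap.mul_apply']
  rw [h1, h2, h3, h4, hL]
  ring

/-! ### Partial derivatives of homogeneous functions -/

/-- The `k`-th partial derivative of the extension of `g` to the cone which is homogeneous of
degree `d`, restricted to the sphere. -/
def wd (d : ℤ) (k : Fin 4) (g : SmoothFn W) : SmoothFn W := D k g + (d : SmoothFn W) * (crd k * g)

lemma D_intCast (k : Fin 4) (d : ℤ) : D k (d : SmoothFn W) = 0 := (D k).map_intCast d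

/-- Each derivative lowers the degree of homogeneity by one. With the degrees tracked in this way,
these are honest partial derivatives on ℝ⁴ and commute. -/
lemma wd_comm {d d' : ℤ} (h : d' + 1 = d) (i j : Fin 4) (g : SmoothFn W) :
    wd d' i (wd d j g) = wd d' j (wd d i g) := by
  subst h
  have h := D_D_sub i j g
  simp only [wd, map_add, D_mul, D_intCast, D_crd, proj_comm j i]
  push_cast
  linear_combination h

lemma sum_crd_mul_wd (d : ℤ) (g : SmoothFn W) : ∑ k, crd k * wd d k g = (d : SmoothFn W) * g := by
  have h : ∀ k, crd k * wd d k g = crd k * D k g + crd k ^ 2 * ((d : SmoothFn W) * g) := by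
    intro k; rw [wd]; ring
  simp only [h, Finset.sum_add_distrib, sum_crd_mul_D, ← Finset.sum_mul, sum_crd_sq]
  ring

lemma wd_mul (d d' : ℤ) (k : Fin 4) (f g : SmoothFn W) :
    wd (d + d') k (f * g) = f * wd d' k g + wd d k f * g := by
  simp only [wd, D_mul]; push_cast; ring

lemma wd_add (d : ℤ) (k : Fin 4) (f g : SmoothFn W) : wd d k (f + g) = wd d k f + wd d k g := by
  simp only [wd, map_add]; ring

lemma wd_zero' (d : ℤ) (k : Fin 4) : wd d k (0 : SmoothFn W) = 0 := by simp [wd]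

lemma wd_degree_zero (k : Fin 4) (g : SmoothFn W) : wd 0 k g = D k g := by simp [wd]

lemma wd_crd (k i : Fin 4) : wd 1 k (crd i : SmoothFn W) = if k = i then 1 else 0 := by
  simp [wd, proj]

/-! ### Symbols of symmetries are Killing tensors -/

/-- The Leibniz rule for a triple commutator with a commutator. -/
lemma lie_lie_cyclic {R : Type*} [Ring R] {A B X Y Z A₁ A₂ A₃ B₁ B₂ B₃ : R} (hAB : A * B = B * A)
    (hA₃ : ⁅⁅A, X⁆, Y⁆ = A₃) (hA₂ : ⁅⁅A, X⁆, Z⁆ = A₂) (hA₁ : ⁅⁅A, Y⁆, Z⁆ = A₁)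
    (hB₃ : ⁅⁅B, X⁆, Y⁆ = B₃) (hB₂ : ⁅⁅B, X⁆, Z⁆ = B₂) (hB₁ : ⁅⁅B, Y⁆, Z⁆ = B₁)
    (hAZ : A₃ * Z = Z * A₃) (hBZ : B₃ * Z = Z * B₃) :
    ⁅⁅A, X⁆, B₁⁆ + ⁅⁅A, Y⁆, B₂⁆ + ⁅⁅A, Z⁆, B₃⁆ =
      ⁅⁅B, X⁆, A₁⁆ + ⁅⁅B, Y⁆, A₂⁆ + ⁅⁅B, Z⁆, A₃⁆ := by
  have add : ∀ P Q T : R, ⁅P + Q, T⁆ = ⁅P, T⁆ + ⁅Q, T⁆ := by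
    intro P Q T; simp only [Ring.lie_def]; noncomm_ring
  have skew : ∀ P Q : R, ⁅P, Q⁆ = -⁅Q, P⁆ := by
    intro P Q; simp only [Ring.lie_def]; noncomm_ring
  have zl : ∀ P : R, ⁅(0 : R), P⁆ = 0 := by intro P; simp [Ring.lie_def]
  have zr : ∀ P : R, ⁅P, (0 : R)⁆ = 0 := by intro P; simp [Ring.lie_def]
  have key : ∀ P Q T : R, ⁅⁅P, Q⁆, T⁆ = ⁅⁅P, T⁆, Q⁆ + ⁅P, ⁅Q, T⁆⁆ := by
    intro P Q T; simp only [Ring.lie_def]; noncomm_ring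
  -- Leibniz distributes X, Y, Z over A and B. Terms in which one factor receives all three vanish
  -- by `h1` and `h2`; the terms left put two on one factor and one on the other.
  have h0 : ⁅⁅⁅⁅A, B⁆, X⁆, Y⁆, Z⁆ = 0 := by
    rw [Ring.lie_def A B, hAB, sub_self, zl, zl, zl]
  have h1 : ⁅⁅⁅A, X⁆, Y⁆, Z⁆ = 0 := by rw [hA₃, Ring.lie_def, hAZ, sub_self]
  have h2 : ⁅⁅⁅B, X⁆, Y⁆, Z⁆ = 0 := by rw [hB₃, Ring.lie_def, hBZ, sub_self]
  rw [key A B X, add, key ⁅A, X⁆ B Y, key A ⁅B, X⁆ Y] at h0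
  simp only [add] at h0
  rw [key ⁅⁅A, X⁆, Y⁆ B Z, key ⁅A, X⁆ ⁅B, Y⁆ Z, key ⁅A, Y⁆ ⁅B, X⁆ Z, key A ⁅⁅B, X⁆, Y⁆ Z, h1, h2,
    hA₁, hA₂, hA₃, hB₁, hB₂, hB₃, zl, zr, skew A₃, skew A₂, skew A₁] at h0
  rw [← sub_eq_zero, ← h0]
  abel

lemma mulOp_injective : Function.Injective (mulOp (W := W)) := fun f g h => by
  simpa using LinearMap.congr_fun h 1

/-- The third-order part of `[P, Q] = 0`: the symbols of commuting operators Poisson commute. -/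
lemma Gam_cyclic {P Q : Op W} (hP : P ∈ diffOps W 2) (hQ : Q ∈ diffOps W 2) (h : Commute P Q)
    (x y z : SmoothFn W) :
    Gam P x (Gam Q y z) + Gam P y (Gam Q x z) + Gam P z (Gam Q x y) =
      Gam Q x (Gam P y z) + Gam Q y (Gam P x z) + Gam Q z (Gam P x y) := by
  have hc : ∀ f g : SmoothFn W, mulOp f * mulOp g = mulOp g * mulOp f := fun f g => by
    rw [← map_mul, mul_comm, map_mul]
  have h1 := lie_lie_cyclic (R := Op W) h (lie_lie_eq_mulOp hP x y)
    (lie_lie_eq_mulOp hP x z) (lie_lie_eq_mulOp hP y z) (lie_lie_eq_mulOp hQ x y)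
    (lie_lie_eq_mulOp hQ x z) (lie_lie_eq_mulOp hQ y z) (hc _ _) (hc _ _)
  simp only [lie_lie_eq_mulOp hP, lie_lie_eq_mulOp hQ, ← map_add] at h1
  have h2 := mulOp_injective h1
  have h3 : ∀ {T : Op W}, T ∈ diffOps W 2 → ∀ f g, Gam T f (2 * g) = 2 * Gam T f g := by
    intro T hT f g
    rw [two_mul, two_mul, ← sum_Gam_crd_mul_D hT f (g + g), ← sum_Gam_crd_mul_D hT f g]
    simp [mul_add, Finset.sum_add_distrib]
  simp only [h3 hP, h3 hQ] at h2
  apply two_mul_cancel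
  apply two_mul_cancel
  linear_combination h2

/-- The symbol of a symmetry of `Δ + V` is a Killing tensor. -/
lemma wd_Gam_cyclic {S : Op W} (hS : S ∈ diffOps W 2) {V : SmoothFn W}
    (h : Commute S (laplaceS + mulOp V)) (k l m : Fin 4) :
    wd 2 k (Gam S (crd l) (crd m)) + wd 2 l (Gam S (crd k) (crd m))
      + wd 2 m (Gam S (crd k) (crd l)) = 0 := by
  have hH : laplaceS + mulOp V ∈ diffOps W 2 :=
    Submodule.add_mem _ (quadOps_le laplaceS_mem_quadOps) (mulOp_mem_diffOps_two V)
  have h1 := Gam_cyclic hS hH h (crd k) (crd l) (crd m)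
  -- The Kronecker part of `proj` is constant and contributes nothing; the products of coordinates
  -- give the terms that turn `D` into `wd 2`.
  have h2 : ∀ i j n, Gam S (crd i) (proj j n)
      = -(crd j * Gam S (crd i) (crd n) + crd n * Gam S (crd i) (crd j)) := by
    intro i j n
    have : Gam S (crd i) (if j = n then 1 else 0 : SmoothFn W) = 0 := by
      split_ifs
      · exact Gam_one hS _
      · rw [← sum_Gam_crd_mul_D hS]; simp
    rw [proj, ← sum_Gam_crd_mul_D hS] at *
    simp only [map_sub, mul_sub, Finset.sum_sub_distrib]
    rw [this, sum_Gam_crd_mul_D hS, Gam_mul hS]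
    ring
  simp only [Gam_add, Gam_laplaceS_crd, Gam_mulOp, add_zero, D_crd, h2] at h1
  rw [Gam_comm S (crd m) (crd k), Gam_comm S (crd m) (crd l), Gam_comm S (crd l) (crd k)] at h1
  simp only [wd]
  push_cast
  linear_combination -h1

/-! ### Prolongation of Killing tensors and algebraic curvature tensors. -/

/-- A tensor of type `S³ ⊗ S²` whose symmetrization over the last four places vanishes is zero. -/
lemma eq_zero_of_cyclic {ι R : Type*} [CommRing R] (T : ι → ι → ι → ι → ι → R)
    (h1 : ∀ i j k l m, T i j k l m = T j i k l m) (h2 : ∀ i j k l m, T i j k l m = T i k j l m)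
    (hc : ∀ i j k l m, T i j k l m + T i j l k m + T i j m k l = 0) (i j k l m : ι) :
    6 * T i j k l m = 0 := by
  have e1 := hc i j k l m
  have e2 := hc i k j l m
  have e3 := hc i l j k m
  have e4 := hc i m j k l
  have e5 := hc j k i l m
  have e6 := hc j l i k m
  have e7 := hc j m i k l
  have e8 := hc k l i j m
  have e9 := hc k m i j l
  have e10 := hc l m i j k
  simp only [h1, h2] at e1 e2 e3 e4 e5 e6 e7 e8 e9 e10 ⊢
  -- The entries of T are labelled by the pair in the last two places, and each relation sums over
  -- the three pairs disjoint from a given pair. So the system is the adjacency matrix A of the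
  -- Petersen graph, with eigenvalues 3, 1, −2. The coefficients are a row of 6A⁻¹ = 3A + 3I − J,
  -- with J the all-ones matrix.
  linear_combination 2 * e10 + 2 * e1 + 2 * e2 + 2 * e5 - e3 - e4 - e6 - e7 - e8 - e9

/-- The tensor `c` is an algebraic curvature tensor in symmetric form: `c i j l m` is symmetric in
`i, j` and in `l, m`, and its symmetrization over the last three places vanishes. -/
structure IsCurvature (c : Fin 4 → Fin 4 → Fin 4 → Fin 4 → ℂ) : Prop where
  symm_left : ∀ i j l m, c i j l m = c j i l m
  symm_right : ∀ i j l m, c i j l m = c i j m l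
  cyclic : ∀ i j l m, c i j l m + c i l j m + c i m j l = 0

/-- Add the cyclic identities with i and with j in the first place and subtract those with l and
with m: the mixed terms cancel, and twice the difference of the two sides remains. -/
lemma IsCurvature.pair_symm {c : Fin 4 → Fin 4 → Fin 4 → Fin 4 → ℂ} (hc : IsCurvature c)
    (i j l m : Fin 4) : c i j l m = c l m i j := by
  have e1 := hc.cyclic i j l m
  have e2 := hc.cyclic j i l m
  have e3 := hc.cyclic l m i j
  have e4 := hc.cyclic m l i j
  have s1 := hc.symm_left j i l m
  have s2 := hc.symm_left m l i j
  have s3 := hc.symm_left l i m j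
  have s3' := hc.symm_right i l m j
  have s4 := hc.symm_left l j m i
  have s4' := hc.symm_right j l m i
  have s5 := hc.symm_left m i l j
  have s5' := hc.symm_right i m l j
  have s6 := hc.symm_left m j l i
  have s6' := hc.symm_right j m l i
  linear_combination (e1 + e2 - e3 - e4 - s1 + s2 + s3 + s3' + s4 + s4' + s5 + s5' + s6 + s6') / 2

lemma algebraMap_injective [Nonempty W] : Function.Injective (algebraMap ℂ (SmoothFn W)) := by
  intro a b h
  obtain ⟨s⟩ := ‹Nonempty W›
  exact congrArg (fun f : SmoothFn W => (f : W → ℂ) s) h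

lemma mul_natCast_cancel {n : ℕ} (hn : n ≠ 0) {f : SmoothFn W} (h : (n : SmoothFn W) * f = 0) :
    f = 0 := by
  have h2 : (n : SmoothFn W) = algebraMap ℂ (SmoothFn W) n := (map_natCast _ n).symm
  have h3 : algebraMap ℂ (SmoothFn W) (n : ℂ)⁻¹ * algebraMap ℂ (SmoothFn W) n = 1 := by
    rw [← map_mul, inv_mul_cancel₀ (Nat.cast_ne_zero.2 hn), map_one]
  rw [h2] at h
  linear_combination algebraMap ℂ (SmoothFn W) (n : ℂ)⁻¹ * h - f * h3

/-- Symbols of symmetries of `Δ + V` are quadratic forms with constant coefficients in the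
rotations. -/
lemma exists_curvature (hW : IsPreconnected (W : Set S3)) [Nonempty W] {S : Op W}
    (hS : S ∈ diffOps W 2) {V : SmoothFn W} (h : Commute S (laplaceS + mulOp V)) :
    ∃ c, IsCurvature c ∧
      (∀ j l m, wd 2 j (Gam S (crd l) (crd m))
        = ∑ i, crd i * algebraMap ℂ (SmoothFn W) (c i j l m)) ∧
      ∀ l m, 2 * Gam S (crd l) (crd m)
        = ∑ i, ∑ j, crd i * crd j * algebraMap ℂ (SmoothFn W) (c i j l m) := by
  set A : Fin 4 → Fin 4 → SmoothFn W := fun l m => Gam S (crd l) (crd m) with hA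
  have hAs : ∀ l m, A l m = A m l := fun l m => Gam_comm _ _ _
  have hcyc : ∀ k l m, wd 2 k (A l m) + wd 2 l (A k m) + wd 2 m (A k l) = 0 :=
    wd_Gam_cyclic hS h
  have hcyc2 : ∀ j k l m, wd 1 j (wd 2 k (A l m)) + wd 1 j (wd 2 l (A k m))
      + wd 1 j (wd 2 m (A k l)) = 0 := by
    intro j k l m
    rw [← wd_add, ← wd_add, hcyc, wd_zero']
  -- Third derivatives of the symbol are symmetric in the three derivations, and the Killing
  -- equation makes their cyclic sums vanish, so they are zero and the second derivatives are
  -- locally constant.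
  have h6 := eq_zero_of_cyclic (fun i j k l m => D i (wd 1 j (wd 2 k (A l m))))
    (fun i j k l m => by
      have := wd_comm (d := 1) (d' := 0) (by norm_num) i j (wd 2 k (A l m))
      simpa only [wd_degree_zero] using this)
    (fun i j k l m => by simp only [wd_comm (d := 2) (d' := 1) (by norm_num) j k])
    (fun i j k l m => by
      simp only [← map_add]
      exact (congrArg (D i) (hcyc2 j k l m)).trans (map_zero (D i)))
  have h7 : ∀ j k l m, ∃ c : ℂ, wd 1 j (wd 2 k (A l m)) = algebraMap ℂ (SmoothFn W) c := by
    intro j k l m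
    refine exists_eq_algebraMap_of_D_eq_zero hW _ fun i => ?_
    exact mul_natCast_cancel (n := 6) (by norm_num) (by exact_mod_cast h6 i j k l m)
  choose c hc using h7
  -- Euler's relation recovers first derivatives, of degree 1, from the constant second derivatives;
  -- below, in degree 2, it recovers the symbol itself.
  have hsum : ∀ j l m, wd 2 j (A l m) = ∑ i, crd i * algebraMap ℂ (SmoothFn W) (c i j l m) := by
    intro j l m
    have := sum_crd_mul_wd 1 (wd 2 j (A l m))
    simp only [hc] at this
    rw [this]; simp
  refine ⟨c, ⟨fun i j l m => ?_, fun i j l m => ?_, fun i j l m => ?_⟩, hsum, fun l m => ?_⟩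
  · apply algebraMap_injective (W := W)
    rw [← hc, ← hc, wd_comm (d := 2) (d' := 1) (by norm_num)]
  · apply algebraMap_injective (W := W)
    rw [← hc, ← hc, hAs]
  · apply algebraMap_injective (W := W)
    rw [map_add, map_add, ← hc, ← hc, ← hc, map_zero, hcyc2]
  · have := sum_crd_mul_wd 2 (A l m)
    simp only [hsum] at this
    rw [Finset.sum_comm]
    rw [show (2 : SmoothFn W) = ((2 : ℤ) : SmoothFn W) by norm_num, ← this]
    refine Finset.sum_congr rfl fun j _ => ?_
    rw [Finset.mul_sum]
    exact Finset.sum_congr rfl fun i _ => by ring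

lemma Gam_sum {ι : Type*} (s : Finset ι) (P : ι → Op W) (g h : SmoothFn W) :
    Gam (∑ i ∈ s, P i) g h = ∑ i ∈ s, Gam (P i) g h := by
  classical
  induction s using Finset.induction_on with
  | empty => simp
  | insert a s ha ih => rw [Finset.sum_insert ha, Finset.sum_insert ha, Gam_add, ih]

lemma sum_J_crd_mul (k : Fin 4) (G : Fin 4 → Fin 4 → SmoothFn W) :
    ∑ i, ∑ l, J i l (crd k) * G i l = ∑ i, crd i * G i k - ∑ l, crd l * G k l := by
  simp only [J_crd, sub_mul, Finset.sum_sub_distrib]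
  congr 1
  · simp
  · rw [Finset.sum_comm]; simp

/-- A quadratic form in the rotations with a given curvature tensor as its symbol. -/
lemma exists_quadOps {S : Op W} {c : Fin 4 → Fin 4 → Fin 4 → Fin 4 → ℂ} (hc : IsCurvature c)
    (hA : ∀ l m, 2 * Gam S (crd l) (crd m)
        = ∑ i, ∑ j, crd i * crd j * algebraMap ℂ (SmoothFn W) (c i j l m)) :
    ∃ Q ∈ quadOps W, ∀ l m, Gam Q (crd l) (crd m) = Gam S (crd l) (crd m) := by
  -- Normalization: with B = Σ s_i s_j c_{ij··}, each half of the symmetrized product contributes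
  -- 3B, so 12 `Gam Q` = 6B, while the hypothesis reads 2 `Gam S` = B.
  let R (i j l m : Fin 4) : Op W := (c i j l m / 12) • (symm (J i l) (J j m) : Op W)
  refine ⟨∑ i, ∑ j, ∑ l, ∑ m, R i j l m, ?_, fun k n => ?_⟩
  · exact Submodule.sum_mem _ fun i _ => Submodule.sum_mem _ fun j _ => Submodule.sum_mem _
      fun l _ => Submodule.sum_mem _ fun m _ => Submodule.smul_mem _ _ (symm_J_mem_quadOps _ _ _ _)
  set K : Fin 4 → Fin 4 → Fin 4 → Fin 4 → SmoothFn W :=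
    fun i j l m => algebraMap ℂ (SmoothFn W) (c i j l m) with hK
  have hKs : ∀ i j l m, K i j l m = K j i l m := fun i j l m => by
    simp only [hK]; rw [hc.symm_left]
  have hKr : ∀ i j l m, K i j l m = K i j m l := fun i j l m => by
    simp only [hK]; rw [hc.symm_right]
  have hKp : ∀ i j l m, K i j l m = K l m i j := fun i j l m => by
    simp only [hK]; rw [hc.pair_symm]
  have hKc : ∀ i j l m, K i j l m + K i l j m + K i m j l = 0 := fun i j l m => by
    simp only [hK]; rw [← map_add, ← map_add, hc.cyclic, map_zero]
  set B : Fin 4 → Fin 4 → SmoothFn W := fun k n => ∑ i, ∑ j, crd i * crd j * K i j k n with hB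
  have hBs : ∀ k n, B k n = B n k := fun k n => by simp only [hB, hKr _ _ k n]
  have hR : ∀ i j l m, 12 * Gam (R i j l m) (crd k) (crd n) =
      K i j l m * (J i l (crd k) * J j m (crd n)) + K i j l m * (J j m (crd k) * J i l (crd n)) := by
    intro i j l m
    have h12 : (12 : SmoothFn W) * algebraMap ℂ (SmoothFn W) (c i j l m / 12) = K i j l m := by
      rw [show (12 : SmoothFn W) = algebraMap ℂ (SmoothFn W) 12 from (map_ofNat _ 12).symm,
        ← map_mul, hK]
      simp only
      congr 1
      field_simp
    simp only [R]
    rw [Gam_smul, Gam_symm_J, Algebra.smul_def, ← mul_assoc, h12]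
    ring
  have hP : ∀ k n, ∑ i, ∑ j, ∑ l, ∑ m, K i j l m * (J i l (crd k) * J j m (crd n)) = 3 * B k n := by
    intro k n
    have e1 : ∑ i, ∑ j, ∑ l, ∑ m, K i j l m * (J i l (crd k) * J j m (crd n))
        = ∑ i, ∑ l, J i l (crd k) * ∑ j, ∑ m, J j m (crd n) * K i j l m := by
      refine Finset.sum_congr rfl fun i _ => ?_
      rw [Finset.sum_comm]
      refine Finset.sum_congr rfl fun l _ => ?_
      rw [Finset.mul_sum]
      refine Finset.sum_congr rfl fun j _ => ?_
      rw [Finset.mul_sum]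
      exact Finset.sum_congr rfl fun m _ => by ring
    rw [e1]
    simp only [sum_J_crd_mul n]
    rw [sum_J_crd_mul k (fun i l => ∑ j, crd j * K i j l n - ∑ m, crd m * K i n l m)]
    simp only [mul_sub, Finset.sum_sub_distrib, Finset.mul_sum,
      ← mul_assoc]
    set Z : SmoothFn W := ∑ i, ∑ m, crd i * crd m * K i n k m with hZ
    have e2 : ∑ l, ∑ m, crd l * crd m * K k n l m = B k n := by simp only [hB, hKp k n]
    have e3 : ∑ l, ∑ j, crd l * crd j * K k j l n = Z := by
      simp only [hZ, fun l j => hKp k j l n]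
    have e4 : ∑ i, ∑ m, crd i * crd m * K i k n m = Z := by
      rw [hZ, Finset.sum_comm]
      refine Finset.sum_congr rfl fun i _ => Finset.sum_congr rfl fun m _ => ?_
      rw [hKp m k n i, hKs n i, hKr i n m k]
      ring
    -- The four terms of the contraction are B − Z − Z + B, and the cyclic identity turns −2Z into
    -- B; this gives the factor 3.
    have e5 : Z + Z + B k n = 0 := by
      nth_rewrite 2 [← e4]
      rw [hZ, hB]
      simp only [← Finset.sum_add_distrib, ← mul_add]
      refine Finset.sum_eq_zero fun i _ => Finset.sum_eq_zero fun m _ => ?_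
      rw [hKr i m k n, hKc i n k m, mul_zero]
    rw [e2, e3]
    linear_combination -e5
  have hQ : 12 * Gam (∑ i, ∑ j, ∑ l, ∑ m, R i j l m) (crd k) (crd n) = 6 * B k n := by
    simp only [Gam_sum, Finset.mul_sum, hR, Finset.sum_add_distrib]
    have h2 := hP n k
    rw [hP k n]
    have : ∑ i, ∑ j, ∑ l, ∑ m, K i j l m * (J j m (crd k) * J i l (crd n)) = 3 * B n k := by
      rw [← h2]
      refine Finset.sum_congr rfl fun i _ => Finset.sum_congr rfl fun j _ =>
        Finset.sum_congr rfl fun l _ => Finset.sum_congr rfl fun m _ => by ring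
    rw [this, hBs n k]
    ring
  have := hA k n
  rw [← sub_eq_zero]
  refine mul_natCast_cancel (n := 12) (by norm_num) ?_
  push_cast
  linear_combination hQ - 6 * this

/-! ### The part of order one -/

/-- The vector field `∑ bₖ Dₖ`. -/
def vf (b : Fin 4 → SmoothFn W) : Derivation ℂ (SmoothFn W) (SmoothFn W) := ∑ k, b k • D k

lemma vf_apply (b : Fin 4 → SmoothFn W) (f : SmoothFn W) : vf b f = ∑ k, b k * D k f := by
  simp [vf, Fin.sum_univ_four]

lemma vf_crd {b : Fin 4 → SmoothFn W} (hb : ∑ k, crd k * b k = 0) (i : Fin 4) :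
    vf b (crd i) = b i := by
  have h : ∀ k, b k * proj k i = (if k = i then b k else 0) - crd k * b k * crd i := by
    intro k; rw [proj]; split_ifs <;> ring
  simp only [vf_apply, D_crd, h, Finset.sum_sub_distrib, ← Finset.sum_mul, hb]
  simp

/-- The structure of a symmetry of `Δ + V` given the part of it that is quadratic in the
rotations: the first-order part is a Killing vector field, which annihilates `V`. -/
lemma symmetry_structure (hW : IsPreconnected (W : Set S3)) [Nonempty W] {S Q : Op W}
    (hS : S ∈ diffOps W 2) {V : SmoothFn W} (h : Commute S (laplaceS + mulOp V))
    (hQ : Q ∈ quadOps W) (hSQ : ∀ l m, Gam Q (crd l) (crd m) = Gam S (crd l) (crd m)) :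
    ∃ (b : Fin 4 → Fin 4 → ℂ) (f : SmoothFn W), (∀ j k, b j k = - b k j) ∧
      (∀ k, D k f = Gam S V (crd k)) ∧
      (∑ j, ∑ k, algebraMap ℂ (SmoothFn W) (b j k) * crd j * D k V = 0) ∧
      ∀ g, S g = Q g + ∑ j, ∑ k, algebraMap ℂ (SmoothFn W) (b j k) * crd j * D k g + f * g := by
  obtain ⟨B, f, hB, hT⟩ := exists_firstOrder_of_Gam_eq_zero
    (P := S - Q) (op_sub_mem hS (quadOps_le hQ)) (fun i j => by rw [Gam_sub, hSQ, sub_self])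
  have hSg : ∀ g, S g = Q g + vf B g + f * g := by
    intro g
    have := hT g
    rw [← vf_apply, LinearMap.sub_apply] at this
    linear_combination this
  -- What is left of [S, Δ + V] = 0 once [Q, Δ] = 0 has been used.
  have hE : ∀ g, Q (V * g) - V * Q g + (vf B (laplaceS g) - laplaceS (vf B g))
      + g * vf B V + f * laplaceS g - laplaceS (f * g) = 0 := by
    intro g
    have h1 := LinearMap.congr_fun h g
    have h4 : laplaceS (Q g) = Q (laplaceS g) :=
      LinearMap.congr_fun (commute_laplaceS_of_mem_quadOps hQ) g
    simp only [Module.End.mul_apply, LinearMap.add_apply, Algebra.coe_lmul_eq_mul,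
      LinearMap.mul_apply', hSg, map_add, h4, Derivation.leibniz, smul_eq_mul] at h1
    linear_combination h1
  have hQ1 := apply_one_of_mem_quadOps hQ
  have hL1 := apply_one_of_mem_quadOps (laplaceS_mem_quadOps (W := W))
  have hQ2 := quadOps_le hQ
  have hL2 := quadOps_le (laplaceS_mem_quadOps (W := W))
  -- Combining the identity at gh, g, h and 1 isolates its second-order part, which comes from [X,
  -- Δ] alone for the vector field X: it says that X preserves the metric.
  have hkill : ∀ g h, vf B (Gam laplaceS g h) = Gam laplaceS g (vf B h) + Gam laplaceS h (vf B g) := by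
    intro g h
    have e1 := hE (g * h)
    have e2 := hE g
    have e3 := hE h
    have e4 := hE 1
    simp only [apply_mul Q V, apply_mul laplaceS f, hQ1, hL1, mul_zero, sub_zero, map_zero] at e1 e2 e3 e4
    rw [apply_mul laplaceS g h, Derivation.leibniz] at e1
    simp only [smul_eq_mul, map_add, apply_mul laplaceS g, apply_mul laplaceS h, hL1, mul_zero,
      sub_zero, Derivation.leibniz, Gam_mul hQ2, Gam_mul hL2, apply_mul Q g h, hQ1,
      Derivation.map_one_eq_zero, Gam_one hQ2, Gam_one hL2, map_zero] at e1 e4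
    have h2 : vf B (2 * Gam laplaceS g h) = 2 * vf B (Gam laplaceS g h) := by
      rw [two_mul, map_add, two_mul]
    apply two_mul_cancel
    have h3 : vf B (2 : SmoothFn W) = 0 := (vf B).map_natCast 2
    rw [h3] at e1
    linear_combination e1 - g * e3 - h * e2 + g * h * e4
  have hX : ∀ i, vf B (crd i) = B i := vf_crd hB
  have hwd : ∀ i j, wd 1 i (B j) = - wd 1 j (B i) := by
    intro i j
    have e1 := hkill (crd i) (crd j)
    have e2 : vf B (if i = j then 1 else 0 : SmoothFn W) = 0 := by split_ifs <;> simp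
    simp only [Gam_laplaceS_crd, hX, D_crd, proj, map_sub, e2, Derivation.leibniz, smul_eq_mul] at e1
    simp only [wd, Int.cast_one]
    linear_combination -e1
  -- Symmetric in i, j as second derivatives and antisymmetric in j, k by Killing's equation, hence
  -- zero.
  have hT : ∀ i j k, D i (wd 1 j (B k)) = 0 := by
    have s1 : ∀ i j k, D i (wd 1 j (B k)) = D j (wd 1 i (B k)) := by
      intro i j k
      have := wd_comm (d := 1) (d' := 0) (by norm_num) i j (B k)
      simpa only [wd_degree_zero] using this
    have s2 : ∀ i j k, D i (wd 1 j (B k)) = - D i (wd 1 k (B j)) := by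
      intro i j k
      rw [hwd, map_neg]
    intro i j k
    refine mul_natCast_cancel (n := 2) (by norm_num) ?_
    have : D i (wd 1 j (B k)) = - D i (wd 1 j (B k)) := by
      calc D i (wd 1 j (B k)) = - D i (wd 1 k (B j)) := s2 _ _ _
        _ = - D k (wd 1 i (B j)) := by rw [s1]
        _ = D k (wd 1 j (B i)) := by rw [s2, neg_neg]
        _ = D j (wd 1 k (B i)) := s1 _ _ _
        _ = - D j (wd 1 i (B k)) := s2 _ _ _
        _ = - D i (wd 1 j (B k)) := by rw [s1]
    push_cast
    linear_combination this
  choose b hb using fun j k => exists_eq_algebraMap_of_D_eq_zero hW _ (fun i => hT i j k)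
  have hBb : ∀ k, B k = ∑ j, algebraMap ℂ (SmoothFn W) (b j k) * crd j := by
    intro k
    have := sum_crd_mul_wd 1 (B k)
    simp only [hb] at this
    rw [Int.cast_one, one_mul] at this
    rw [← this]
    exact Finset.sum_congr rfl fun j _ => mul_comm _ _
  have hanti : ∀ j k, b j k = - b k j := by
    intro j k
    apply algebraMap_injective (W := W)
    rw [map_neg, ← hb, ← hb, hwd]
  have hvf : ∀ g, vf B g = ∑ j, ∑ k, algebraMap ℂ (SmoothFn W) (b j k) * crd j * D k g := by
    intro g
    rw [vf_apply, Finset.sum_comm]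
    simp only [hBb, Finset.sum_mul]
  have hvJ : ∀ g, vf B g = ∑ j, ∑ k, (b j k / 2) • J j k g := by
    intro g
    apply two_mul_cancel
    have e1 : ∑ j, ∑ k, algebraMap ℂ (SmoothFn W) (b j k) * crd j * D k g
        = ∑ j, ∑ k, algebraMap ℂ (SmoothFn W) (b k j) * crd k * D j g := Finset.sum_comm
    have e2 : ∀ j k, (2 : SmoothFn W) * (b j k / 2) • J j k g
        = algebraMap ℂ (SmoothFn W) (b j k) * J j k g := by
      intro j k
      rw [Algebra.smul_def, ← mul_assoc,
        show (2 : SmoothFn W) = algebraMap ℂ (SmoothFn W) 2 from (map_ofNat _ 2).symm, ← map_mul]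
      congr 2
      field_simp
    rw [hvf, two_mul]
    nth_rewrite 2 [e1]
    simp only [Finset.mul_sum, e2, ← Finset.sum_add_distrib]
    refine Finset.sum_congr rfl fun j _ => Finset.sum_congr rfl fun k _ => ?_
    rw [hanti k j, J_apply, map_neg]
    ring
  have hcomm : ∀ g, laplaceS (vf B g) = vf B (laplaceS g) := by
    intro g
    have e : ∀ j k, laplaceS (J j k g) = J j k (laplaceS g) := fun j k =>
      LinearMap.congr_fun (commute_laplaceS_J j k) g
    simp only [hvJ, map_sum, map_smul, e]
  -- Since X now commutes with Δ, only order at most one is left. The value at 1 is the zeroth-order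
  -- part, and the values at the coordinates then give ∇f. As this implies Δf = QV, the zeroth-order
  -- part reduces to XV = 0.
  have e0 := hE 1
  simp only [hcomm, sub_self, hQ1, hL1, mul_one, mul_zero, sub_zero, one_mul] at e0
  have hf : ∀ k, D k f = Gam Q V (crd k) := by
    intro k
    have e1 := hE (crd k)
    rw [apply_mul Q V, apply_mul laplaceS f, hcomm, hQ1, hL1, Gam_comm laplaceS f,
      Gam_laplaceS_crd] at e1
    apply two_mul_cancel
    linear_combination -e1 + crd k * e0
  refine ⟨b, f, hanti, fun k => ?_, ?_, fun g => by rw [hSg, hvf]⟩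
  · rw [hf, Gam_comm, Gam_comm S, ← sum_Gam_crd_mul_D hQ2, ← sum_Gam_crd_mul_D hS]
    simp only [hSQ]
  · have : laplaceS f = Q V := by rw [laplaceS_apply, ← sum_D_Gam hQ]; simp only [hf]
    rw [← hvf]
    linear_combination e0 + this

section

/-! ### The potentials -/

/-- The function `1 / √(s₁² + s₂² + s₃²)`. -/
def rinv (hW : W ≤ regular) : SmoothFn W :=
  ofAmbient W (fun s => (((√(s 0 ^ 2 + s 1 ^ 2 + s 2 ^ 2))⁻¹ : ℝ) : ℂ)) (fun s hs => by
    have h0 : (s : E4) 0 ≠ 0 := (hW hs).1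
    have hc (i : Fin 4) : ContDiffAt ℝ ∞ (fun x : E4 => x i) s :=
      (contDiff_piLp_apply (p := 2)).contDiffAt
    have hpos : 0 < (s : E4) 0 ^ 2 + (s : E4) 1 ^ 2 + (s : E4) 2 ^ 2 := by positivity
    exact Complex.ofRealCLM.contDiff.contDiffAt.comp (s : E4)
      ((((((hc 0).pow 2).add ((hc 1).pow 2)).add ((hc 2).pow 2)).sqrt hpos.ne').inv
        (Real.sqrt_pos.2 hpos).ne'))

lemma crd_zero_ne (hW : W ≤ regular) (s : W) : ((((s : S3) : E4) 0 : ℝ) : ℂ) ≠ 0 :=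
  Complex.ofReal_ne_zero.2 (hW s.2).1

lemma crd_one_ne (hW : W ≤ regular) (s : W) : ((((s : S3) : E4) 1 : ℝ) : ℂ) ≠ 0 :=
  Complex.ofReal_ne_zero.2 (hW s.2).2

variable (hW : W ≤ regular)

lemma rinv_sq : rinv hW ^ 2 * (crd 0 ^ 2 + crd 1 ^ 2 + crd 2 ^ 2) = 1 := by
  apply SmoothFn.ext; intro s
  have h0 : ((s : S3) : E4) 0 ≠ 0 := (hW s.2).1
  have hpos : 0 < ((s : S3) : E4) 0 ^ 2 + ((s : S3) : E4) 1 ^ 2 + ((s : S3) : E4) 2 ^ 2 := by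
    positivity
  have h1 : ((√(((s : S3) : E4) 0 ^ 2 + ((s : S3) : E4) 1 ^ 2 + ((s : S3) : E4) 2 ^ 2))⁻¹) ^ 2
      * (((s : S3) : E4) 0 ^ 2 + ((s : S3) : E4) 1 ^ 2 + ((s : S3) : E4) 2 ^ 2) = 1 := by
    rw [inv_pow, Real.sq_sqrt hpos.le, inv_mul_cancel₀ hpos.ne']
  have h2 := congrArg (fun t : ℝ => (t : ℂ)) h1
  simpa [rinv, ofAmbient] using h2

lemma V1_eq : V1 hW = crd 3 * rinv hW := by
  apply SmoothFn.ext; intro s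
  simp [V1, rinv, ofAmbient, div_eq_mul_inv]

lemma V2_mul : V2 hW * crd 0 ^ 2 = 1 := by
  apply SmoothFn.ext; intro s
  simp [V2, ofAmbient, crd_zero_ne hW s]

lemma V3_mul : V3 hW * crd 1 ^ 2 = 1 := by
  apply SmoothFn.ext; intro s
  simp [V3, ofAmbient, crd_one_ne hW s]

/-- As a function of degree −1 on ℝ⁴, 1/r has gradient −s_k/r³ in the first three directions and
none in the last. Differentiating r⁻² · r² = 1 avoids handling the root. -/
lemma wd_rinv (k : Fin 4) : wd (-1) k (rinv hW) = if k = 3 then 0 else -(rinv hW ^ 3 * crd k) := by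
  have h := congrArg (D k) (rinv_sq hW)
  have h1 := rinv_sq hW
  simp only [sq, D_mul, map_add, D_crd, D_one] at h h1
  have h2 : 2 * D k (rinv hW) = -2 * (rinv hW ^ 3 * (crd 0 * proj k 0 + crd 1 * proj k 1
      + crd 2 * proj k 2)) := by
    linear_combination rinv hW * h - 2 * D k (rinv hW) * h1
  have h2' : D k (rinv hW) = -(rinv hW ^ 3 * (crd 0 * proj k 0 + crd 1 * proj k 1
      + crd 2 * proj k 2)) := two_mul_cancel (by rw [h2]; ring)
  rw [wd, h2']
  have h3 := fun i => congrArg (fun t => rinv hW * crd i * t) h1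
  push_cast
  rcases eq_or_ne k 3 with rfl | hk
  · simp only [proj, if_true, Fin.reduceEq, if_false]
    linear_combination h3 3
  · rw [if_neg hk]
    have h4 : ∀ k : Fin 4, k ≠ 3 → (crd 0 * proj k 0 + crd 1 * proj k 1 + crd 2 * proj k 2 : SmoothFn W)
        = crd k - crd k * (crd 0 * crd 0 + crd 1 * crd 1 + crd 2 * crd 2) := by
      intro k hk
      fin_cases k <;> simp [proj] at hk ⊢ <;> ring
    rw [h4 k hk]
    linear_combination h3 k

lemma D_of_mul_sq {f x : SmoothFn W} (h : f * x ^ 2 = 1) (k : Fin 4) :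
    D k f = -2 * (x * f ^ 2) * D k x := by
  have h1 := congrArg (D k) h
  simp only [sq, D_mul, D_one] at h1
  linear_combination f * h1 - D k f * h

lemma wd_of_mul_sq {f : SmoothFn W} {i : Fin 4} (h : f * crd i ^ 2 = 1) (k : Fin 4) :
    wd (-2) k f = if k = i then -2 * (crd i * f ^ 2) else 0 := by
  rw [wd, D_of_mul_sq h, D_crd, proj]
  push_cast
  split_ifs <;> linear_combination 2 * f * crd k * h

/-! ### The five symmetries -/

lemma D_V1 (k : Fin 4) : D k (V1 hW) = (if k = 3 then rinv hW else 0)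
    + crd 3 * (if k = 3 then 0 else -(rinv hW ^ 3 * crd k)) := by
  rw [← wd_degree_zero, V1_eq, show (0 : ℤ) = 1 + (-1) by norm_num, wd_mul, wd_rinv, wd_crd]
  split_ifs <;> ring

lemma J_eq_wd (d : ℤ) (a b : Fin 4) (f : SmoothFn W) :
    J a b f = crd a * wd d b f - crd b * wd d a f := by
  simp only [J_apply, wd]; ring

lemma sum_crd_sq' : crd 0 ^ 2 + crd 1 ^ 2 + crd 2 ^ 2 + crd 3 ^ 2 = (1 : SmoothFn W) := by
  rw [← sum_crd_sq, Fin.sum_univ_four]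

/-- V₁ depends only on r and s₄, so rotations among the first three coordinates annihilate it.
Rotation into the last one gives s_a/r + s_a s₄²/r³, which is s_a/r³ because r² + s₄² = 1. -/
lemma J_V1 (a b : Fin 4) (h : a ≠ 3) : J a b (V1 hW) = if b = 3 then rinv hW ^ 3 * crd a else 0 := by
  have h1 := rinv_sq hW
  rw [J_apply, D_V1, D_V1]
  rw [if_neg h, if_neg h]
  split_ifs with hb
  · subst hb
    linear_combination rinv hW ^ 3 * crd a * sum_crd_sq' (W := W) - rinv hW * crd a * h1
  · ring

lemma J_V2 (a b : Fin 4) : J a b (V2 hW) = (if b = 0 then -2 * (crd 0 * V2 hW ^ 2) * crd a else 0)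
    - (if a = 0 then -2 * (crd 0 * V2 hW ^ 2) * crd b else 0) := by
  rw [J_eq_wd (-2), wd_of_mul_sq (V2_mul hW), wd_of_mul_sq (V2_mul hW)]
  split_ifs <;> ring

lemma J_V3 (a b : Fin 4) : J a b (V3 hW) = (if b = 1 then -2 * (crd 1 * V3 hW ^ 2) * crd a else 0)
    - (if a = 1 then -2 * (crd 1 * V3 hW ^ 2) * crd b else 0) := by
  rw [J_eq_wd (-2), wd_of_mul_sq (V3_mul hW), wd_of_mul_sq (V3_mul hW)]
  split_ifs <;> ring

/-- The potential `a₁ V₁ + a₂ V₂ + a₃ V₃`. -/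
def pot (a : Fin 3 → ℂ) : SmoothFn W := ∑ i, a i • (![V1 hW, V2 hW, V3 hW] : Fin 3 → SmoothFn W) i

lemma pot_eq (a : Fin 3 → ℂ) : pot hW a = a 0 • V1 hW + a 1 • V2 hW + a 2 • V3 hW := by
  simp [pot, Fin.sum_univ_three]

lemma D_crd_mul (i k : Fin 4) (f : SmoothFn W) :
    D k (crd i * f) = crd i * wd (-1) k f + (if k = i then 1 else 0) * f := by
  rw [← wd_degree_zero, show (0 : ℤ) = 1 + (-1) by norm_num, wd_mul, wd_crd]

lemma D_crd_mul_crd_mul (i j k : Fin 4) (f : SmoothFn W) :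
    D k (crd i * crd j * f) = crd i * crd j * wd (-2) k f
      + ((if k = i then 1 else 0) * crd j + (if k = j then 1 else 0) * crd i) * f := by
  rw [← wd_degree_zero, show (0 : ℤ) = (1 + 1) + (-2) by norm_num, wd_mul, wd_mul 1 1, wd_crd,
    wd_crd]
  ring

lemma J_pot (a : Fin 3 → ℂ) (i j : Fin 4) : J i j (pot hW a) =
    algebraMap ℂ _ (a 0) * J i j (V1 hW) + algebraMap ℂ _ (a 1) * J i j (V2 hW)
      + algebraMap ℂ _ (a 2) * J i j (V3 hW) := by
  simp only [pot_eq, map_add, LinearMap.map_smul]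
  simp only [Algebra.smul_def]

lemma D_algebraMap_mul (k : Fin 4) (c : ℂ) (f : SmoothFn W) :
    D k (algebraMap ℂ _ c * f) = algebraMap ℂ _ c * D k f := by
  rw [← Algebra.smul_def, ← Algebra.smul_def, Derivation.map_smul]

/-- The zeroth-order part of `L₁₂`. -/
def phi12 (a : Fin 3 → ℂ) : SmoothFn W :=
  algebraMap ℂ _ (a 2) * (crd 0 * crd 0 * V3 hW) + algebraMap ℂ _ (a 1) * (crd 1 * crd 1 * V2 hW)

/-- The zeroth-order part of `L₁₃`. -/
def phi13 (a : Fin 3 → ℂ) : SmoothFn W := algebraMap ℂ _ (a 1) * (crd 2 * crd 2 * V2 hW)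

/-- The zeroth-order part of `L₂₃`. -/
def phi23 (a : Fin 3 → ℂ) : SmoothFn W := algebraMap ℂ _ (a 2) * (crd 2 * crd 2 * V3 hW)

/-- The zeroth-order part of `L`. -/
def phiL (a : Fin 3 → ℂ) : SmoothFn W :=
  algebraMap ℂ _ (a 0) * (crd 2 * rinv hW) + algebraMap ℂ _ (2 * a 1) * (crd 2 * crd 3 * V2 hW)
    + algebraMap ℂ _ (2 * a 2) * (crd 2 * crd 3 * V3 hW)

/-- The gradient condition required by `commute_of_D_eq_Gam`; the next three lemmas serve the other
symmetries in the same way. -/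
lemma D_phi12 (a : Fin 3 → ℂ) (k : Fin 4) :
    D k (phi12 hW a) = Gam (J 0 1 ^ 2) (pot hW a) (crd k) := by
  have h2 := V2_mul hW
  have h3 := V3_mul hW
  rw [Gam_sq_J, J_pot, J_crd, phi12, map_add, D_algebraMap_mul, D_algebraMap_mul,
    D_crd_mul_crd_mul, D_crd_mul_crd_mul, wd_of_mul_sq h2, wd_of_mul_sq h3, J_V1 hW 0 1 (by decide),
    J_V2, J_V3]
  fin_cases k <;> simp
  · linear_combination (-2) * algebraMap ℂ _ (a 2) * crd 0 * V3 hW * h3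
  · linear_combination (-2) * algebraMap ℂ _ (a 1) * crd 1 * V2 hW * h2

lemma D_phi13 (a : Fin 3 → ℂ) (k : Fin 4) :
    D k (phi13 hW a) = Gam (J 0 2 ^ 2) (pot hW a) (crd k) := by
  have h2 := V2_mul hW
  rw [Gam_sq_J, J_pot, J_crd, phi13, D_algebraMap_mul,
    D_crd_mul_crd_mul, wd_of_mul_sq h2, J_V1 hW 0 2 (by decide), J_V2, J_V3]
  fin_cases k <;> simp
  · ring
  · linear_combination (-2) * algebraMap ℂ _ (a 1) * crd 2 * V2 hW * h2

lemma D_phi23 (a : Fin 3 → ℂ) (k : Fin 4) :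
    D k (phi23 hW a) = Gam (J 1 2 ^ 2) (pot hW a) (crd k) := by
  have h3 := V3_mul hW
  rw [Gam_sq_J, J_pot, J_crd, phi23, D_algebraMap_mul,
    D_crd_mul_crd_mul, wd_of_mul_sq h3, J_V1 hW 1 2 (by decide), J_V2, J_V3]
  fin_cases k <;> simp
  · ring
  · linear_combination (-2) * algebraMap ℂ _ (a 2) * crd 2 * V3 hW * h3

lemma D_phiL (a : Fin 3 → ℂ) (k : Fin 4) :
    D k (phiL hW a) =
      Gam (symm (J 0 2) (J 0 3) + symm (J 1 2) (J 1 3) : Op W) (pot hW a) (crd k) := by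
  have h1 := rinv_sq hW
  have h2 := V2_mul hW
  have h3 := V3_mul hW
  rw [Gam_add, Gam_symm_J, Gam_symm_J]
  simp only [J_pot, J_crd, phiL, map_add, D_algebraMap_mul, D_crd_mul, wd_rinv,
    D_crd_mul_crd_mul, wd_of_mul_sq h2, wd_of_mul_sq h3, J_V1 hW 0 2 (by decide), J_V2, J_V3,
    J_V1 hW 0 3 (by decide), J_V1 hW 1 2 (by decide), J_V1 hW 1 3 (by decide)]
  have h4 : algebraMap ℂ (SmoothFn W) 2 = 2 := map_ofNat _ 2
  fin_cases k <;> simp [h4]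
  · ring
  · ring
  · linear_combination -algebraMap ℂ _ (a 0) * rinv hW * h1
      - 2 * algebraMap ℂ _ (a 1) * crd 3 * V2 hW * h2
      - 2 * algebraMap ℂ _ (a 2) * crd 3 * V3 hW * h3
  · linear_combination - 2 * algebraMap ℂ _ (a 1) * crd 2 * V2 hW * h2
      - 2 * algebraMap ℂ _ (a 2) * crd 2 * V3 hW * h3

lemma helmholtz_eq (a : Fin 3 → ℂ) (c : ℂ) :
    helmholtz ![V1 hW, V2 hW, V3 hW] a c = laplaceS + mulOp (pot hW a) + c • 1 := rfl

lemma commute_helmholtz_iff (a : Fin 3 → ℂ) (c : ℂ) (P : Op W) :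
    Commute P (helmholtz ![V1 hW, V2 hW, V3 hW] a c) ↔ Commute P (laplaceS + mulOp (pot hW a)) := by
  rw [helmholtz_eq]
  have h (f : SmoothFn W) : (c • 1 : Op W) f = c • f := rfl
  have key : ∀ A : Op W, Commute P A ↔ ∀ f, P (A f) = A (P f) := fun A =>
    ⟨fun h f => congrArg (fun T : Op W => T f) h, fun h => LinearMap.ext h⟩
  rw [key, key]
  refine forall_congr' fun f => ?_
  rw [LinearMap.add_apply _ (c • 1), LinearMap.add_apply _ (c • 1), h, h, map_add,
    LinearMap.map_smul, add_left_inj]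

lemma L12_eq (a : Fin 3 → ℂ) : L12 hW (a 1) (a 2) = J 0 1 ^ 2 + mulOp (phi12 hW a) := by
  rw [L12]
  congr 2
  apply SmoothFn.ext; intro s
  have h0 := crd_zero_ne hW s
  have h1 := crd_one_ne hW s
  simp [phi12, ofAmbient, V2, V3]
  field_simp

lemma L13_eq (a : Fin 3 → ℂ) : L13 hW (a 1) = J 0 2 ^ 2 + mulOp (phi13 hW a) := by
  rw [L13]
  congr 2
  apply SmoothFn.ext; intro s
  have h0 := crd_zero_ne hW s
  simp [phi13, ofAmbient, V2]
  field_simp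

lemma L23_eq (a : Fin 3 → ℂ) : L23 hW (a 2) = J 1 2 ^ 2 + mulOp (phi23 hW a) := by
  rw [L23]
  congr 2
  apply SmoothFn.ext; intro s
  have h1 := crd_one_ne hW s
  simp [phi23, ofAmbient, V3]
  field_simp

lemma L_eq (a : Fin 3 → ℂ) : L hW (a 0) (a 1) (a 2) =
    (symm (J 0 2) (J 0 3) + symm (J 1 2) (J 1 3) : Op W) + mulOp (phiL hW a) := by
  rw [L]
  congr 2
  apply SmoothFn.ext; intro s
  have h0 := crd_zero_ne hW s
  have h1 := crd_one_ne hW s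
  simp [phiL, ofAmbient, V2, V3, rinv, div_eq_mul_inv]
  ring

/-- The five symmetries. -/
def syms (a : Fin 3 → ℂ) (c : ℂ) : Fin 5 → Op W :=
  ![helmholtz ![V1 hW, V2 hW, V3 hW] a c, L12 hW (a 1) (a 2), L13 hW (a 1), L23 hW (a 2),
    L hW (a 0) (a 1) (a 2)]

lemma add_mulOp_mem_symmetries {Q : Op W} (hQ : Q ∈ quadOps W) {f : SmoothFn W} {a : Fin 3 → ℂ}
    (c : ℂ) (h : ∀ k, D k f = Gam Q (pot hW a) (crd k)) :
    Q + mulOp f ∈ symmetries W (helmholtz ![V1 hW, V2 hW, V3 hW] a c) := by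
  refine ⟨add_mem (quadOps_le hQ) (mulOp_mem_diffOps_two f), ?_⟩
  have h1 := (commute_helmholtz_iff hW a c _).2 (commute_of_D_eq_Gam hQ h)
  rw [SetLike.mem_coe, Subalgebra.mem_toSubmodule, Subalgebra.mem_centralizer_iff]
  rintro _ rfl
  exact h1.symm

lemma mem_symmetries_iff {P H : Op W} : P ∈ symmetries W H ↔ P ∈ diffOps W 2 ∧ Commute P H := by
  rw [symmetries, Submodule.mem_inf, Subalgebra.mem_toSubmodule, Subalgebra.mem_centralizer_iff]
  simp only [Set.mem_singleton_iff, forall_eq]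
  exact and_congr_right fun _ => ⟨fun h => Eq.symm h, fun h => Eq.symm h⟩

lemma syms_mem (a : Fin 3 → ℂ) (c : ℂ) (i : Fin 5) :
    syms hW a c i ∈ symmetries W (helmholtz ![V1 hW, V2 hW, V3 hW] a c) := by
  fin_cases i
  · refine mem_symmetries_iff.2 ⟨?_, Commute.refl _⟩
    refine add_mem (add_mem (quadOps_le laplaceS_mem_quadOps) (mulOp_mem_diffOps_two _)) ?_
    have h1 : (1 : Op W) ∈ diffOps W 2 := by
      rw [← map_one (mulOp (W := W))]; exact mulOp_mem_diffOps_two 1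
    exact Submodule.smul_mem _ c h1
  · change L12 hW (a 1) (a 2) ∈ _
    rw [L12_eq]
    exact add_mulOp_mem_symmetries hW (J_sq_mem_quadOps _ _) c (D_phi12 hW a)
  · change L13 hW (a 1) ∈ _
    rw [L13_eq]
    exact add_mulOp_mem_symmetries hW (J_sq_mem_quadOps _ _) c (D_phi13 hW a)
  · change L23 hW (a 2) ∈ _
    rw [L23_eq]
    exact add_mulOp_mem_symmetries hW (J_sq_mem_quadOps _ _) c (D_phi23 hW a)
  · change L hW (a 0) (a 1) (a 2) ∈ _
    rw [L_eq]
    exact add_mulOp_mem_symmetries hW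
      (add_mem (symm_J_mem_quadOps _ _ _ _) (symm_J_mem_quadOps _ _ _ _)) c (D_phiL hW a)

lemma one_mem_symmetries (H : Op W) : 1 ∈ symmetries W H := by
  refine mem_symmetries_iff.2 ⟨?_, Commute.one_left H⟩
  rw [← map_one (mulOp (W := W))]
  exact mulOp_mem_diffOps_two 1

/-- The symbols of the five symmetries, as bilinear forms in a pair of functions. -/
def symsQuad : Fin 5 → Op W :=
  ![laplaceS, J 0 1 ^ 2, J 0 2 ^ 2, J 1 2 ^ 2, symm (J 0 2) (J 0 3) + symm (J 1 2) (J 1 3)]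

lemma Gam_syms (a : Fin 3 → ℂ) (c : ℂ) (i : Fin 5) (g h : SmoothFn W) :
    Gam (syms hW a c i) g h = Gam (symsQuad i) g h := by
  fin_cases i
  · change Gam (laplaceS + mulOp _ + c • 1) g h = Gam laplaceS g h
    rw [Gam_add, Gam_add, Gam_mulOp, Gam_smul, Gam_one_op, smul_zero, add_zero, add_zero]
  · change Gam (L12 hW (a 1) (a 2)) g h = Gam (J 0 1 ^ 2) g h
    rw [L12_eq, Gam_add, Gam_mulOp, add_zero]
  · change Gam (L13 hW (a 1)) g h = Gam (J 0 2 ^ 2) g h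
    rw [L13_eq, Gam_add, Gam_mulOp, add_zero]
  · change Gam (L23 hW (a 2)) g h = Gam (J 1 2 ^ 2) g h
    rw [L23_eq, Gam_add, Gam_mulOp, add_zero]
  · change Gam (L hW (a 0) (a 1) (a 2)) g h =
      Gam (symm (J 0 2) (J 0 3) + symm (J 1 2) (J 1 3) : Op W) g h
    rw [L_eq, Gam_add, Gam_mulOp, add_zero]

end

section

/-! ### Analytic continuation of homogeneous functions -/

/-- The complement of the line `x₁ = x₂ = x₃ = 0`. -/
def offAxis : Set E4 := {x | x 0 ^ 2 + x 1 ^ 2 + x 2 ^ 2 ≠ 0}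

lemma offAxis_eq : offAxis = ((Submodule.span ℝ {e 3} : Submodule ℝ E4) : Set E4)ᶜ := by
  ext x
  rw [Set.mem_compl_iff, SetLike.mem_coe, Submodule.mem_span_singleton, offAxis, Set.mem_ofPred_eq,
    not_iff_not]
  constructor
  · intro h
    have h0 : x 0 = 0 := by nlinarith [sq_nonneg (x 0), sq_nonneg (x 1), sq_nonneg (x 2)]
    have h1 : x 1 = 0 := by nlinarith [sq_nonneg (x 0), sq_nonneg (x 1), sq_nonneg (x 2)]
    have h2 : x 2 = 0 := by nlinarith [sq_nonneg (x 0), sq_nonneg (x 1), sq_nonneg (x 2)]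
    refine ⟨x 3, ?_⟩
    ext i
    fin_cases i <;> simp [h0, h1, h2]
  · rintro ⟨t, rfl⟩
    simp

lemma isPreconnected_offAxis : IsPreconnected offAxis := by
  rw [offAxis_eq]
  refine (isConnected_compl_of_one_lt_codim ?_).isPreconnected
  have h1 : Module.finrank ℝ (E4 ⧸ (Submodule.span ℝ {e 3} : Submodule ℝ E4)) = 3 := by
    have h2 := Submodule.finrank_quotient_add_finrank (Submodule.span ℝ {e 3} : Submodule ℝ E4)
    have h3 : e 3 ≠ 0 := by
      intro h
      have := congrArg (fun x : E4 => x 3) h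
      simp at this
    rw [finrank_span_singleton h3, finrank_euclideanSpace_fin] at h2
    omega
  rw [← Module.finrank_eq_rank, h1]
  norm_num

lemma offAxis_of_ne {x : E4} {i : Fin 4} (hi : i ≠ 3) (h : x i ≠ 0) : x ∈ offAxis := by
  have : 0 < x i ^ 2 := by positivity
  fin_cases i <;> simp [offAxis] at hi this ⊢ <;> positivity

/-- Homogeneity spreads the vanishing from `W` to the open cone, and the identity theorem spreads it
to the complement of the axis, connected since a line has codimension three. Points with x₁ = 0 or
x₂ = 0, which lie outside the cone, thereby become available for evaluation. -/
lemma eq_zero_of_homogeneous [Nonempty W] (hW : W ≤ regular) {F : E4 → ℂ}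
    (hF : ∀ x ∈ offAxis, ContDiffAt ℝ ω F x) (n : ℕ)
    (hn : ∀ (r : ℝ) (x : E4), 0 < r → F (r • x) = (r : ℂ) ^ n * F x)
    (h0 : ∀ s : W, F ((s : S3) : E4) = 0) {x : E4} (hx : x ∈ offAxis) : F x = 0 := by
  obtain ⟨s⟩ := ‹Nonempty W›
  have hs : ((s : S3) : E4) ∈ offAxis := offAxis_of_ne (i := 0) (by decide) (hW s.2).1
  refine AnalyticOnNhd.eqOn_zero_of_preconnected_of_eventuallyEq_zero
    (fun y hy => (hF y hy).analyticAt) isPreconnected_offAxis hs ?_ hx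
  filter_upwards [(isOpen_cone W).mem_nhds (coe_mem_cone s)] with y hy
  have h1 := h0 ⟨toSphere y hy.1, hy.2⟩
  have h2 : F (‖y‖⁻¹ • y) = 0 := h1
  rw [hn _ _ (inv_pos.2 (norm_pos_iff.2 hy.1))] at h2
  have h3 : ((‖y‖⁻¹ : ℝ) : ℂ) ^ n ≠ 0 :=
    pow_ne_zero _ (Complex.ofReal_ne_zero.2 (inv_ne_zero (norm_ne_zero_iff.2 hy.1)))
  exact (mul_eq_zero.1 h2).resolve_left h3

/-- The function `1 / √(x₁² + x₂² + x₃²)` on 4-space. -/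
def rinvAmb (x : E4) : ℂ := (((√(x 0 ^ 2 + x 1 ^ 2 + x 2 ^ 2))⁻¹ : ℝ) : ℂ)

lemma contDiffAt_rinvAmb {x : E4} (hx : x ∈ offAxis) : ContDiffAt ℝ ω rinvAmb x := by
  have hc (i : Fin 4) : ContDiffAt ℝ ω (fun x : E4 => x i) x :=
    (contDiff_piLp_apply (p := 2)).contDiffAt
  have hpos : 0 < x 0 ^ 2 + x 1 ^ 2 + x 2 ^ 2 := lt_of_le_of_ne (by positivity) (Ne.symm hx)
  exact Complex.ofRealCLM.contDiff.contDiffAt.comp x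
    ((((((hc 0).pow 2).add ((hc 1).pow 2)).add ((hc 2).pow 2)).sqrt hpos.ne').inv
      (Real.sqrt_pos.2 hpos).ne')

lemma rinvAmb_smul {r : ℝ} (hr : 0 < r) (x : E4) : rinvAmb (r • x) = (r : ℂ)⁻¹ * rinvAmb x := by
  have h : (r • x) 0 ^ 2 + (r • x) 1 ^ 2 + (r • x) 2 ^ 2
      = r ^ 2 * (x 0 ^ 2 + x 1 ^ 2 + x 2 ^ 2) := by
    simp; ring
  rw [rinvAmb, h, Real.sqrt_mul (by positivity), Real.sqrt_sq hr.le, rinvAmb, mul_inv]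
  push_cast
  rfl

lemma contDiff_coord_omega (i : Fin 4) : ContDiff ℝ ω (fun x : E4 => ((x i : ℝ) : ℂ)) :=
  Complex.ofRealCLM.contDiff.comp (contDiff_piLp_apply (p := 2))

/-! ### Tangential derivatives of the potential -/

variable (hW : W ≤ regular)

lemma D_V2 (k : Fin 4) : D k (V2 hW) = (if k = 0 then -2 * (crd 0 * V2 hW ^ 2) else 0)
    + 2 * (crd k * V2 hW) := by
  have := wd_of_mul_sq (V2_mul hW) k
  rw [wd] at this
  push_cast at this
  linear_combination this

lemma D_V3 (k : Fin 4) : D k (V3 hW) = (if k = 1 then -2 * (crd 1 * V3 hW ^ 2) else 0)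
    + 2 * (crd k * V3 hW) := by
  have := wd_of_mul_sq (V3_mul hW) k
  rw [wd] at this
  push_cast at this
  linear_combination this

/-- For tangent T the radial parts of the gradients drop out. The inverse squares contribute one
component each; for V₁, tangency replaces the sum over the first three directions by the last, and
r² + s₄² = 1 collects the result into T₃/r³. -/
lemma sum_mul_D_pot (a : Fin 3 → ℂ) {T : Fin 4 → SmoothFn W} (hT : ∑ k, crd k * T k = 0) :
    ∑ k, T k * D k (pot hW a) = algebraMap ℂ _ (a 0) * (rinv hW ^ 3 * T 3)
      + algebraMap ℂ _ (-2 * a 1) * (crd 0 * V2 hW ^ 2 * T 0)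
      + algebraMap ℂ _ (-2 * a 2) * (crd 1 * V3 hW ^ 2 * T 1) := by
  have h1 := rinv_sq hW
  have hD (k : Fin 4) : D k (pot hW a) = algebraMap ℂ _ (a 0) * D k (V1 hW)
      + algebraMap ℂ _ (a 1) * D k (V2 hW) + algebraMap ℂ _ (a 2) * D k (V3 hW) := by
    simp only [pot_eq, map_add, Derivation.map_smul]
    simp only [Algebra.smul_def]
  have h2 : algebraMap ℂ (SmoothFn W) 2 = 2 := map_ofNat _ 2
  simp only [hD, D_V1, D_V2, D_V3, Fin.sum_univ_four] at hT ⊢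
  simp [h2]
  linear_combination (2 * algebraMap ℂ _ (a 1) * V2 hW + 2 * algebraMap ℂ _ (a 2) * V3 hW
    - algebraMap ℂ _ (a 0) * rinv hW ^ 3 * crd 3) * hT
    - algebraMap ℂ _ (a 0) * T 3 * rinv hW * h1
    + algebraMap ℂ _ (a 0) * T 3 * rinv hW ^ 3 * sum_crd_sq' (W := W)

lemma wd_rinv_cube (i : Fin 4) :
    wd (-3) i (rinv hW ^ 3) = (if i = 3 then 0 else -3 * crd i) * rinv hW ^ 5 := by
  rw [show rinv hW ^ 3 = rinv hW * rinv hW * rinv hW by ring,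
    show (-3 : ℤ) = (-1) + (-1) + (-1) by norm_num, wd_mul, wd_mul (-1) (-1), wd_rinv]
  split_ifs <;> ring

lemma wd_crd_mul_sq {f : SmoothFn W} {j : Fin 4} (h : f * crd j ^ 2 = 1) (i : Fin 4) :
    wd (-3) i (crd j * f ^ 2) = (if i = j then -3 else 0) * f ^ 2 := by
  rw [sq f, show (-3 : ℤ) = 1 + ((-2) + (-2)) by norm_num, wd_mul, wd_mul (-2) (-2),
    wd_of_mul_sq h, wd_crd]
  split_ifs with hi
  · linear_combination (-4 * f ^ 2) * h
  · ring

lemma wd_algebraMap_mul (d : ℤ) (k : Fin 4) (c : ℂ) (f : SmoothFn W) :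
    wd d k (algebraMap ℂ _ c * f) = algebraMap ℂ _ c * wd d k f := by
  rw [wd, wd, D_algebraMap_mul]; ring

/-! ### The integrability obstruction for the zeroth-order part. -/

/-- The quadratic form `½ ∑ c_{ijlm} x_i x_j` of a curvature tensor `c`. -/
def quadPoly (c : Fin 4 → Fin 4 → Fin 4 → Fin 4 → ℂ) (l m : Fin 4) (x : Fin 4 → ℂ) : ℂ :=
  (∑ i, ∑ j, x i * x j * c i j l m) / 2

/-- The derivatives of `quadPoly`. -/
def linPoly (c : Fin 4 → Fin 4 → Fin 4 → Fin 4 → ℂ) (j l m : Fin 4) (x : Fin 4 → ℂ) : ℂ :=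
  ∑ i, x i * c i j l m

/-- The obstruction to the integrability of the equation for the zeroth-order part of a symmetry,
cleared of its poles along `x₁ = 0` and `x₂ = 0`. -/
def curlFn (c : Fin 4 → Fin 4 → Fin 4 → Fin 4 → ℂ) (a : Fin 3 → ℂ) (i k : Fin 4)
    (x : Fin 4 → ℂ) (u : ℂ) : ℂ :=
  a 0 * x 0 ^ 4 * x 1 ^ 4 * (u ^ 3 * (linPoly c i 3 k x - linPoly c k 3 i x)
    + u ^ 5 * ((if i = 3 then 0 else -3 * x i) * quadPoly c 3 k x
      - (if k = 3 then 0 else -3 * x k) * quadPoly c 3 i x))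
  - 2 * a 1 * x 1 ^ 4 * (x 0 * (linPoly c i 0 k x - linPoly c k 0 i x)
    + ((if i = 0 then -3 else 0) * quadPoly c 0 k x - (if k = 0 then -3 else 0) * quadPoly c 0 i x))
  - 2 * a 2 * x 0 ^ 4 * (x 1 * (linPoly c i 1 k x - linPoly c k 1 i x)
    + ((if i = 1 then -3 else 0) * quadPoly c 1 k x - (if k = 1 then -3 else 0) * quadPoly c 1 i x))

lemma quadPoly_smul (c) (l m : Fin 4) (r : ℂ) (x : Fin 4 → ℂ) :
    quadPoly c l m (fun i => r * x i) = r ^ 2 * quadPoly c l m x := by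
  rw [quadPoly, quadPoly, ← mul_div_assoc, Finset.mul_sum]
  congr 1
  refine Finset.sum_congr rfl fun i _ => ?_
  rw [Finset.mul_sum]
  exact Finset.sum_congr rfl fun j _ => by ring

lemma linPoly_smul (c) (j l m : Fin 4) (r : ℂ) (x : Fin 4 → ℂ) :
    linPoly c j l m (fun i => r * x i) = r * linPoly c j l m x := by
  rw [linPoly, linPoly, Finset.mul_sum]
  exact Finset.sum_congr rfl fun j _ => by ring

/-- Weight count with u of weight −1: the first term has 8 − 3 + 1, the others 4 + 2. -/
lemma curlFn_smul (c) (a : Fin 3 → ℂ) (i k : Fin 4) {r : ℂ} (hr : r ≠ 0) (x : Fin 4 → ℂ) (u : ℂ) :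
    curlFn c a i k (fun i => r * x i) (r⁻¹ * u) = r ^ 6 * curlFn c a i k x u := by
  simp only [curlFn, quadPoly_smul, linPoly_smul, mul_pow]
  split_ifs <;> field_simp <;> ring

lemma contDiff_quadPoly (c) (l m : Fin 4) :
    ContDiff ℝ ω (fun x : E4 => quadPoly c l m (fun i => ((x i : ℝ) : ℂ))) := by
  have := contDiff_coord_omega
  unfold quadPoly
  exact (ContDiff.sum fun i _ => ContDiff.sum fun j _ =>
    ((this i).mul (this j)).mul contDiff_const).div_const 2

lemma contDiff_linPoly (c) (j l m : Fin 4) :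
    ContDiff ℝ ω (fun x : E4 => linPoly c j l m (fun i => ((x i : ℝ) : ℂ))) := by
  have := contDiff_coord_omega
  unfold linPoly
  exact ContDiff.sum fun i _ => (this i).mul contDiff_const

lemma contDiffAt_curlFn (c) (a : Fin 3 → ℂ) (i k : Fin 4) {x : E4} (hx : x ∈ offAxis) :
    ContDiffAt ℝ ω (fun x : E4 => curlFn c a i k (fun i => ((x i : ℝ) : ℂ)) (rinvAmb x)) x := by
  have h1 := contDiffAt_rinvAmb hx
  have h2 (i) := (contDiff_coord_omega i).contDiffAt (x := x)
  have h3 (l m) := (contDiff_quadPoly c l m).contDiffAt (x := x)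
  have h4 (j l m) := (contDiff_linPoly c j l m).contDiffAt (x := x)
  unfold curlFn
  split_ifs <;> fun_prop

/-- Evaluation at a point. -/
def evalAt (s : W) : SmoothFn W →ₐ[ℂ] ℂ := (Pi.evalAlgHom ℂ (fun _ : W => ℂ) s).comp (SmoothFn W).val

lemma evalAt_apply (s : W) (f : SmoothFn W) : evalAt s f = (f : W → ℂ) s := rfl

/-- The coordinates of a point. -/
def coords (x : E4) (i : Fin 4) : ℂ := ((x i : ℝ) : ℂ)

lemma evalAt_crd (s : W) (i : Fin 4) : evalAt s (crd i) = coords ((s : S3) : E4) i := rfl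

lemma evalAt_rinv (s : W) : evalAt s (rinv hW) = rinvAmb ((s : S3) : E4) := rfl

lemma evalAt_V2 (s : W) : evalAt s (V2 hW) * coords ((s : S3) : E4) 0 ^ 2 = 1 := by
  rw [← evalAt_crd, ← map_pow, ← map_mul, V2_mul, map_one]

lemma evalAt_V3 (s : W) : evalAt s (V3 hW) * coords ((s : S3) : E4) 1 ^ 2 = 1 := by
  rw [← evalAt_crd, ← map_pow, ← map_mul, V3_mul, map_one]

section Curl

variable {a : Fin 3 → ℂ} {S : Op W} {f : SmoothFn W} {c : Fin 4 → Fin 4 → Fin 4 → Fin 4 → ℂ}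

lemma evalAt_Gam (hA2 : ∀ l m, 2 * Gam S (crd l) (crd m)
        = ∑ i, ∑ j, crd i * crd j * algebraMap ℂ (SmoothFn W) (c i j l m)) (s : W) (l m : Fin 4) :
    evalAt s (Gam S (crd l) (crd m)) = quadPoly c l m (coords ((s : S3) : E4)) := by
  have h := congrArg (evalAt s) (hA2 l m)
  simp only [map_mul, map_ofNat, map_sum, evalAt_crd, AlgHom.commutes, Algebra.algebraMap_self,
    RingHom.id_apply] at h
  rw [quadPoly, ← h]
  ring

/-- The factors from the potential have degree −3 and the symbol has degree 2, so ∇f has degree −1,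
which dictates the degree of the outer derivative. -/
lemma wd_D_pot (hS : S ∈ diffOps W 2) (hf : ∀ k, D k f = Gam S (pot hW a) (crd k)) (i k : Fin 4) :
    wd (-1) i (wd 0 k f) =
      algebraMap ℂ _ (a 0) * (rinv hW ^ 3 * wd 2 i (Gam S (crd 3) (crd k))
        + (if i = 3 then 0 else -3 * crd i) * rinv hW ^ 5 * Gam S (crd 3) (crd k))
      + algebraMap ℂ _ (-2 * a 1) * (crd 0 * V2 hW ^ 2 * wd 2 i (Gam S (crd 0) (crd k))
        + (if i = 0 then -3 else 0) * V2 hW ^ 2 * Gam S (crd 0) (crd k))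
      + algebraMap ℂ _ (-2 * a 2) * (crd 1 * V3 hW ^ 2 * wd 2 i (Gam S (crd 1) (crd k))
        + (if i = 1 then -3 else 0) * V3 hW ^ 2 * Gam S (crd 1) (crd k)) := by
  rw [wd_degree_zero, hf, Gam_comm, ← sum_Gam_crd_mul_D hS,
    sum_mul_D_pot hW a (sum_crd_mul_Gam hS (crd k)), wd_add, wd_add, wd_algebraMap_mul,
    wd_algebraMap_mul, wd_algebraMap_mul,
    show (-1 : ℤ) = (-3) + 2 by norm_num, wd_mul, wd_mul, wd_mul, wd_rinv_cube,
    wd_crd_mul_sq (V2_mul hW), wd_crd_mul_sq (V3_mul hW)]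
  simp only [Gam_comm S (crd k)]

/-- Mixed second derivatives of f commute. Inserting the prescribed gradient and multiplying by x₀⁴
x₁⁴ to clear the poles turns this into the vanishing of the obstruction. -/
lemma curlFn_eq_zero_on (hS : S ∈ diffOps W 2)
    (hA1 : ∀ j l m, wd 2 j (Gam S (crd l) (crd m))
        = ∑ i, crd i * algebraMap ℂ (SmoothFn W) (c i j l m))
    (hA2 : ∀ l m, 2 * Gam S (crd l) (crd m)
        = ∑ i, ∑ j, crd i * crd j * algebraMap ℂ (SmoothFn W) (c i j l m))
    (hf : ∀ k, D k f = Gam S (pot hW a) (crd k)) (i k : Fin 4) (s : W) :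
    curlFn c a i k (coords ((s : S3) : E4)) (rinvAmb ((s : S3) : E4)) = 0 := by
  have h := congrArg (evalAt s) (wd_comm (d := 0) (d' := -1) (by norm_num) i k f)
  rw [wd_D_pot hW hS hf, wd_D_pot hW hS hf] at h
  have hl (j l m : Fin 4) : evalAt s (wd 2 j (Gam S (crd l) (crd m)))
      = linPoly c j l m (coords ((s : S3) : E4)) := by
    rw [hA1]
    simp only [map_mul, map_sum, evalAt_crd, AlgHom.commutes, Algebra.algebraMap_self,
      RingHom.id_apply, linPoly]
  have h2 := evalAt_V2 hW s
  have h3 := evalAt_V3 hW s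
  simp only [map_add, map_mul, map_pow, evalAt_crd, evalAt_rinv, AlgHom.commutes,
    Algebra.algebraMap_self, RingHom.id_apply, evalAt_Gam hA2, hl, apply_ite (evalAt s), map_zero,
    map_neg, map_ofNat] at h
  generalize coords ((s : S3) : E4) = x at *
  generalize rinvAmb ((s : S3) : E4) = u at *
  generalize evalAt s (V2 hW) = v at *
  generalize evalAt s (V3 hW) = w at *
  have h2' : v ^ 2 * x 0 ^ 4 = 1 := by linear_combination (v * x 0 ^ 2 + 1) * h2
  have h3' : w ^ 2 * x 1 ^ 4 = 1 := by linear_combination (w * x 1 ^ 2 + 1) * h3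
  rw [curlFn]
  linear_combination x 0 ^ 4 * x 1 ^ 4 * h + 2 * a 1 * x 1 ^ 4 *
      (x 0 * (linPoly c i 0 k x - linPoly c k 0 i x) + ((if i = 0 then -3 else 0) * quadPoly c 0 k x
        - (if k = 0 then -3 else 0) * quadPoly c 0 i x)) * h2'
    + 2 * a 2 * x 0 ^ 4 * (x 1 * (linPoly c i 1 k x - linPoly c k 1 i x)
      + ((if i = 1 then -3 else 0) * quadPoly c 1 k x
        - (if k = 1 then -3 else 0) * quadPoly c 1 i x)) * h3'

lemma curlFn_eq_zero [Nonempty W] (hS : S ∈ diffOps W 2)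
    (hA1 : ∀ j l m, wd 2 j (Gam S (crd l) (crd m))
        = ∑ i, crd i * algebraMap ℂ (SmoothFn W) (c i j l m))
    (hA2 : ∀ l m, 2 * Gam S (crd l) (crd m)
        = ∑ i, ∑ j, crd i * crd j * algebraMap ℂ (SmoothFn W) (c i j l m))
    (hf : ∀ k, D k f = Gam S (pot hW a) (crd k)) (i k : Fin 4) {x : E4} (hx : x ∈ offAxis) :
    curlFn c a i k (coords x) (rinvAmb x) = 0 := by
  refine eq_zero_of_homogeneous hW (fun x hx => contDiffAt_curlFn c a i k hx) 6 ?_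
    (curlFn_eq_zero_on hW hS hA1 hA2 hf i k) hx
  intro r x hr
  have h1 : coords (r • x) = fun i => (r : ℂ) * coords x i := by
    funext i; simp [coords]
  have h2 := curlFn_smul c a i k (Complex.ofReal_ne_zero.2 hr.ne') (coords x) (rinvAmb x)
  rw [← h1, ← rinvAmb_smul hr] at h2
  exact h2

end Curl

end

section

/-! ### Curvature tensors with vanishing obstruction -/

lemma coords_vec (x : Fin 4 → ℝ) : coords (WithLp.toLp 2 x) = fun i => (x i : ℂ) := rfl

lemma rinvAmb_vec {x : Fin 4 → ℝ} {r : ℝ} (hr : 0 < r) (h : x 0 ^ 2 + x 1 ^ 2 + x 2 ^ 2 = r ^ 2) :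
    rinvAmb (WithLp.toLp 2 x) = (r : ℂ)⁻¹ := by
  have h1 : rinvAmb (WithLp.toLp 2 x) = (((√(x 0 ^ 2 + x 1 ^ 2 + x 2 ^ 2))⁻¹ : ℝ) : ℂ) := rfl
  rw [h1, h, Real.sqrt_sq hr.le, Complex.ofReal_inv]

lemma IsCurvature.three {c : Fin 4 → Fin 4 → Fin 4 → Fin 4 → ℂ} (hc : IsCurvature c)
    (a b : Fin 4) : c a a a b = 0 ∧ c a a b a = 0 ∧ c a b a a = 0 ∧ c b a a a = 0 := by
  have h1 := hc.cyclic a a a b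
  have h2 := hc.symm_right a a a b
  have h3 := hc.pair_symm a b a a
  have h4 := hc.symm_left a b a a
  have h : c a a a b = 0 := by linear_combination (h1 - h3) / 3
  refine ⟨h, ?_, ?_, ?_⟩
  · rw [← h2, h]
  · rw [h3, h]
  · rw [← h4, h3, h]

lemma IsCurvature.two {c : Fin 4 → Fin 4 → Fin 4 → Fin 4 → ℂ} (hc : IsCurvature c)
    (a b d : Fin 4) : c a b a d = -(c a a b d / 2) ∧ c a b d a = -(c a a b d / 2) ∧
      c b a a d = -(c a a b d / 2) ∧ c b a d a = -(c a a b d / 2) := by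
  have h1 := hc.cyclic a b a d
  have h3 := hc.pair_symm a d b a
  have h4 := hc.symm_left a b a d
  have h5 := hc.symm_left a b d a
  have h6 := hc.symm_right a b a d
  have h : c a b a d = -(c a a b d / 2) := by linear_combination (h1 - h3 + h4) / 2
  refine ⟨h, ?_, ?_, ?_⟩
  · rw [← h6, h]
  · rw [← h4, h]
  · rw [← h5, ← h6, h]

section

variable {c : Fin 4 → Fin 4 → Fin 4 → Fin 4 → ℂ} {a : Fin 3 → ℂ}

/-- On x₀ = 0 every term of the obstruction with i = 0 drops out except the leading polar term of
V₂, which carries the factor −3. -/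
lemma quadPoly_zero_eq_zero (ha : a 1 ≠ 0)
    (h : ∀ i k x, x ∈ offAxis → curlFn c a i k (coords x) (rinvAmb x) = 0) {k : Fin 4} (hk : k ≠ 0)
    {x : Fin 4 → ℝ} (h0 : x 0 = 0) (h1 : x 1 ≠ 0) : quadPoly c 0 k (fun i => (x i : ℂ)) = 0 := by
  have hx : WithLp.toLp 2 x ∈ offAxis := offAxis_of_ne (i := 1) (by decide) h1
  have := h 0 k _ hx
  rw [coords_vec] at this
  simpa [curlFn, h0, h1, hk, ha] using this

lemma quadPoly_one_eq_zero (ha : a 2 ≠ 0)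
    (h : ∀ i k x, x ∈ offAxis → curlFn c a i k (coords x) (rinvAmb x) = 0) {k : Fin 4} (hk : k ≠ 1)
    {x : Fin 4 → ℝ} (h0 : x 0 ≠ 0) (h1 : x 1 = 0) : quadPoly c 1 k (fun i => (x i : ℂ)) = 0 := by
  have hx : WithLp.toLp 2 x ∈ offAxis := offAxis_of_ne (i := 0) (by decide) h0
  have := h 1 k _ hx
  rw [coords_vec] at this
  simpa [curlFn, h0, h1, hk, ha] using this

/-- On x₀ = 0 the form `quadPoly c 0 k` has six coefficients. The six sample points, all with x₁ =
1, determine them by polarization. -/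
lemma curvature_zero (hc : IsCurvature c) (ha : a 1 ≠ 0)
    (h : ∀ i k x, x ∈ offAxis → curlFn c a i k (coords x) (rinvAmb x) = 0) {i j k : Fin 4}
    (hi : i ≠ 0) (hj : j ≠ 0) (hk : k ≠ 0) : c i j 0 k = 0 := by
  have key (x : Fin 4 → ℝ) (h0 : x 0 = 0) (h1 : x 1 ≠ 0) := quadPoly_zero_eq_zero ha h hk h0 h1
  simp only [quadPoly, Fin.sum_univ_four] at key
  have e1 := key ![0, 1, 0, 0] rfl (by simp)
  have e2 := key ![0, 1, 1, 0] rfl (by simp)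
  have e3 := key ![0, 1, -1, 0] rfl (by simp)
  have e4 := key ![0, 1, 0, 1] rfl (by simp)
  have e5 := key ![0, 1, 0, -1] rfl (by simp)
  have e6 := key ![0, 1, 1, 1] rfl (by simp)
  have s12 := hc.symm_left 1 2 0 k
  have s13 := hc.symm_left 1 3 0 k
  have s23 := hc.symm_left 2 3 0 k
  simp at e1 e2 e3 e4 e5 e6
  have h11 : c 1 1 0 k = 0 := e1
  have h12 : c 1 2 0 k = 0 := by linear_combination (e2 - e3 + 2 * s12) / 4
  have h13 : c 1 3 0 k = 0 := by linear_combination (e4 - e5 + 2 * s13) / 4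
  have h22 : c 2 2 0 k = 0 := by linear_combination (e2 + e3 - 2 * e1) / 2
  have h33 : c 3 3 0 k = 0 := by linear_combination (e4 + e5 - 2 * e1) / 2
  have h23 : c 2 3 0 k = 0 := by
    linear_combination (e6 + s23 - h11 - h22 - h33 - 2 * h12 - 2 * h13 + s12 + s13) / 2
  fin_cases i <;> fin_cases j <;> first
    | exact absurd rfl hi | exact absurd rfl hj | assumption | (rw [hc.symm_left]; assumption)

lemma curvature_one (hc : IsCurvature c) (ha : a 2 ≠ 0)
    (h : ∀ i k x, x ∈ offAxis → curlFn c a i k (coords x) (rinvAmb x) = 0) {i j k : Fin 4}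
    (hi : i ≠ 1) (hj : j ≠ 1) (hk : k ≠ 1) : c i j 1 k = 0 := by
  have key (x : Fin 4 → ℝ) (h0 : x 0 ≠ 0) (h1 : x 1 = 0) := quadPoly_one_eq_zero ha h hk h0 h1
  simp only [quadPoly, Fin.sum_univ_four] at key
  have e1 := key ![1, 0, 0, 0] (by simp) rfl
  have e2 := key ![1, 0, 1, 0] (by simp) rfl
  have e3 := key ![1, 0, -1, 0] (by simp) rfl
  have e4 := key ![1, 0, 0, 1] (by simp) rfl
  have e5 := key ![1, 0, 0, -1] (by simp) rfl
  have e6 := key ![1, 0, 1, 1] (by simp) rfl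
  have s12 := hc.symm_left 0 2 1 k
  have s13 := hc.symm_left 0 3 1 k
  have s23 := hc.symm_left 2 3 1 k
  simp at e1 e2 e3 e4 e5 e6
  have h11 : c 0 0 1 k = 0 := e1
  have h12 : c 0 2 1 k = 0 := by linear_combination (e2 - e3 + 2 * s12) / 4
  have h13 : c 0 3 1 k = 0 := by linear_combination (e4 - e5 + 2 * s13) / 4
  have h22 : c 2 2 1 k = 0 := by linear_combination (e2 + e3 - 2 * e1) / 2
  have h33 : c 3 3 1 k = 0 := by linear_combination (e4 + e5 - 2 * e1) / 2
  have h23 : c 2 3 1 k = 0 := by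
    linear_combination (e6 + s23 - h11 - h22 - h33 - 2 * h12 - 2 * h13 + s12 + s13) / 2
  fin_cases i <;> fin_cases j <;> first
    | exact absurd rfl hi | exact absurd rfl hj | assumption | (rw [hc.symm_left]; assumption)

/-- Curvature tensors without components `c i j 0 k`, `i, j, k ≠ 0`, and `c i j 1 k`,
`i, j, k ≠ 1`. -/
structure IsReduced (c : Fin 4 → Fin 4 → Fin 4 → Fin 4 → ℂ) : Prop extends IsCurvature c where
  zero : ∀ {i j k}, i ≠ 0 → j ≠ 0 → k ≠ 0 → c i j 0 k = 0
  one : ∀ {i j k}, i ≠ 1 → j ≠ 1 → k ≠ 1 → c i j 1 k = 0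

/-- Rewriting rules for arbitrary components. Up to symmetry only c₀₀₁₁, c₀₀₂₂, c₀₀₃₃, c₀₀₂₃, c₁₁₂₂,
c₁₁₃₃, c₁₁₂₃ and c₂₂₃₃ survive them. -/
lemma IsReduced.normal_form (hc : IsReduced c) :
    (∀ a b, c a a a b = 0 ∧ c a a b a = 0 ∧ c a b a a = 0 ∧ c b a a a = 0) ∧
    (∀ i j k, i ≠ 0 → j ≠ 0 → k ≠ 0 →
      c i j 0 k = 0 ∧ c i j k 0 = 0 ∧ c 0 k i j = 0 ∧ c k 0 i j = 0) ∧
    (∀ i j k, i ≠ 1 → j ≠ 1 → k ≠ 1 →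
      c i j 1 k = 0 ∧ c i j k 1 = 0 ∧ c 1 k i j = 0 ∧ c k 1 i j = 0) ∧
    (∀ a b d, c a b a d = -(c a a b d / 2) ∧ c a b d a = -(c a a b d / 2) ∧
      c b a a d = -(c a a b d / 2) ∧ c b a d a = -(c a a b d / 2)) := by
  have hc' := hc.toIsCurvature
  refine ⟨hc'.three, fun i j k hi hj hk => ?_, fun i j k hi hj hk => ?_, hc'.two⟩
  · have h := hc.zero hi hj hk
    have h1 : c i j k 0 = 0 := by rw [hc'.symm_right, h]
    exact ⟨h, h1, by rw [hc'.pair_symm, h], by rw [hc'.pair_symm, h1]⟩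
  · have h := hc.one hi hj hk
    have h1 : c i j k 1 = 0 := by rw [hc'.symm_right, h]
    exact ⟨h, h1, by rw [hc'.pair_symm, h], by rw [hc'.pair_symm, h1]⟩

lemma IsReduced.quadPoly_eq (hc : IsReduced c) (x : Fin 4 → ℂ) :
    quadPoly c 0 0 x = (x 1 ^ 2 * c 0 0 1 1 + x 2 ^ 2 * c 0 0 2 2 + 2 * x 2 * x 3 * c 0 0 2 3
      + x 3 ^ 2 * c 0 0 3 3) / 2 ∧
    quadPoly c 0 1 x = -(x 0 * x 1 * c 0 0 1 1) / 2 ∧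
    quadPoly c 0 2 x = -(x 0 * (x 2 * c 0 0 2 2 + x 3 * c 0 0 2 3)) / 2 ∧
    quadPoly c 0 3 x = -(x 0 * (x 2 * c 0 0 2 3 + x 3 * c 0 0 3 3)) / 2 := by
  obtain ⟨h1, h2, h3, h4⟩ := hc.normal_form
  simp only [forall_and] at h1 h2 h3 h4
  have h5 := hc.pair_symm
  have e1 := h5 1 1 0 0
  have e2 := h5 2 2 0 0
  have e3 := h5 2 3 0 0
  have e4 := h5 3 3 0 0
  have e5 := h5 3 2 0 0
  have e6 := hc.symm_right 0 0 3 2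
  refine ⟨?_, ?_, ?_, ?_⟩ <;> simp [quadPoly, Fin.sum_univ_four, h1, h2, h3, h4, e1, e2, e3, e4, e5, e6]
  all_goals ring

lemma IsReduced.quadPoly_eq' (hc : IsReduced c) (x : Fin 4 → ℂ) :
    quadPoly c 1 1 x = (x 0 ^ 2 * c 0 0 1 1 + x 2 ^ 2 * c 1 1 2 2 + 2 * x 2 * x 3 * c 1 1 2 3
      + x 3 ^ 2 * c 1 1 3 3) / 2 ∧
    quadPoly c 1 2 x = -(x 1 * (x 2 * c 1 1 2 2 + x 3 * c 1 1 2 3)) / 2 ∧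
    quadPoly c 1 3 x = -(x 1 * (x 2 * c 1 1 2 3 + x 3 * c 1 1 3 3)) / 2 ∧
    quadPoly c 2 2 x = (x 0 ^ 2 * c 0 0 2 2 + x 1 ^ 2 * c 1 1 2 2 + x 3 ^ 2 * c 2 2 3 3) / 2 ∧
    quadPoly c 2 3 x = (x 0 ^ 2 * c 0 0 2 3 + x 1 ^ 2 * c 1 1 2 3 - x 2 * x 3 * c 2 2 3 3) / 2 ∧
    quadPoly c 3 3 x = (x 0 ^ 2 * c 0 0 3 3 + x 1 ^ 2 * c 1 1 3 3 + x 2 ^ 2 * c 2 2 3 3) / 2 := by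
  obtain ⟨h1, h2, h3, h4⟩ := hc.normal_form
  simp only [forall_and] at h1 h2 h3 h4
  have h5 := hc.pair_symm
  have p12 := h5 2 2 1 1
  have p13 := h5 3 3 1 1
  have p23 := h5 3 3 2 2
  have q1 := h5 2 3 1 1
  have r1 := h5 3 2 1 1
  have t1 := hc.symm_right 1 1 3 2
  refine ⟨?_, ?_, ?_, ?_, ?_, ?_⟩ <;>
    simp [quadPoly, Fin.sum_univ_four, h1, h2, h3, h4, p12, p13, p23, q1, r1, t1]
  all_goals ring

lemma IsReduced.linPoly_eq (hc : IsReduced c) (x : Fin 4 → ℂ) :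
    linPoly c 3 3 0 x = -(x 0 * c 0 0 3 3) / 2 ∧ linPoly c 0 3 3 x = x 0 * c 0 0 3 3 ∧
    linPoly c 3 0 0 x = x 2 * c 0 0 2 3 + x 3 * c 0 0 3 3 ∧
    linPoly c 0 0 3 x = -(x 2 * c 0 0 2 3 + x 3 * c 0 0 3 3) / 2 ∧
    linPoly c 3 1 0 x = 0 ∧ linPoly c 0 1 3 x = 0 ∧
    linPoly c 0 3 2 x = x 0 * c 0 0 2 3 ∧ linPoly c 2 3 0 x = -(x 0 * c 0 0 2 3) / 2 ∧
    linPoly c 0 0 2 x = -(x 2 * c 0 0 2 2 + x 3 * c 0 0 2 3) / 2 ∧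
    linPoly c 2 0 0 x = x 2 * c 0 0 2 2 + x 3 * c 0 0 2 3 ∧
    linPoly c 0 1 2 x = 0 ∧ linPoly c 2 1 0 x = 0 := by
  obtain ⟨h1, h2, h3, h4⟩ := hc.normal_form
  simp only [forall_and] at h1 h2 h3 h4
  have h5 := hc.pair_symm
  have p02 := h5 2 2 0 0
  have p03 := h5 3 3 0 0
  have q0 := h5 2 3 0 0
  have r0 := h5 3 2 0 0
  have t0 := hc.symm_right 0 0 3 2
  refine ⟨?_, ?_, ?_, ?_, ?_, ?_, ?_, ?_, ?_, ?_, ?_, ?_⟩ <;>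
    simp [linPoly, Fin.sum_univ_four, h1, h2, h3, h4, p02, p03, q0, r0, t0]
  all_goals ring

/-- In the curl components (3,0) and (0,2) the contributions of V₂ and V₃ cancel identically for
reduced c, so only the Coulomb term is left and `a 0` can be divided out. -/
lemma IsReduced.relations (hc : IsReduced c) (ha : a 0 ≠ 0)
    (h : ∀ i k x, x ∈ offAxis → curlFn c a i k (coords x) (rinvAmb x) = 0) :
    c 1 1 3 3 = c 0 0 3 3 ∧ c 2 2 3 3 = c 0 0 3 3 ∧ c 1 1 2 3 = c 0 0 2 3 := by
  have hs (l m : Fin 4) (x : Fin 4 → ℂ) : quadPoly c l m x = quadPoly c m l x := by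
    simp only [quadPoly, fun i j => hc.symm_right i j l m]
  have key (i k : Fin 4) (x : Fin 4 → ℝ) (h0 : x 0 ≠ 0) (hx : x 0 ^ 2 + x 1 ^ 2 + x 2 ^ 2 = 3 ^ 2) :
      curlFn c a i k (fun i => (x i : ℂ)) 3⁻¹ = 0 := by
    have := h i k _ (offAxis_of_ne (x := WithLp.toLp 2 x) (i := 0) (by decide) h0)
    rw [rinvAmb_vec (by norm_num) hx] at this
    rw [coords_vec] at this
    simpa using this
  -- The sample points have x₀² + x₁² + x₂² = 9, so that 1/r = 1/3 is rational.
  have k1 := key 3 0 ![1, 2, 2, 1] (by simp) (by simp; norm_num)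
  have k2 := key 3 0 ![2, 1, 2, 1] (by simp) (by simp; norm_num)
  have k3 := key 0 2 ![1, 2, 2, 1] (by simp) (by simp; norm_num)
  simp only [curlFn, hs 3 0, hs 1 0, hs 3 2, hc.quadPoly_eq, hc.quadPoly_eq', hc.linPoly_eq] at k1 k2 k3
  simp at k1 k2 k3
  have e1 : a 0 * (c 1 1 3 3 + c 2 2 3 3 - 2 * c 0 0 3 3) = 0 := by
    linear_combination (243 / 96) * k1
  have e2 : a 0 * (c 1 1 3 3 + 4 * c 2 2 3 3 - 5 * c 0 0 3 3) = 0 := by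
    linear_combination (243 / 48) * k2
  have e3 : a 0 * (c 1 1 2 3 - c 0 0 2 3 - (c 2 2 3 3 - c 0 0 3 3) / 2) = 0 := by
    linear_combination (-243 / 96) * k3
  have e1 := (mul_eq_zero.1 e1).resolve_left ha
  have e2 := (mul_eq_zero.1 e2).resolve_left ha
  have e3 := (mul_eq_zero.1 e3).resolve_left ha
  have e4 : c 2 2 3 3 = c 0 0 3 3 := by linear_combination (e2 - e1) / 3
  exact ⟨by linear_combination (4 * e1 - e2) / 3, e4,
    by linear_combination e3 + e4 / 2⟩

end

end

/-! ### The space of all second-order symmetries -/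

/-- The coefficients of a symmetry with curvature tensor `c`. -/
def symsCoeff (c : Fin 4 → Fin 4 → Fin 4 → Fin 4 → ℂ) : Fin 5 → ℂ :=
  ![c 0 0 3 3 / 2, (c 0 0 1 1 - c 0 0 3 3) / 2, (c 0 0 2 2 - c 0 0 3 3) / 2,
    (c 1 1 2 2 - c 0 0 3 3) / 2, c 0 0 2 3 / 2]

/-- The relations give J₀₃², J₁₃² and J₂₃² the same coefficient, so these complete to the Laplacian;
the other three squares take the excess over it. The norm relation is needed on the diagonal, where
the symbol of the Laplacian is 1 − s_i². -/
lemma quadPoly_eq_sum {c : Fin 4 → Fin 4 → Fin 4 → Fin 4 → ℂ} (hc : IsReduced c)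
    (h1 : c 1 1 3 3 = c 0 0 3 3) (h2 : c 2 2 3 3 = c 0 0 3 3) (h3 : c 1 1 2 3 = c 0 0 2 3)
    (s : W) (l m : Fin 4) : quadPoly c l m (coords ((s : S3) : E4)) =
      ∑ i, symsCoeff c i * evalAt s (Gam (symsQuad i) (crd l) (crd m)) := by
  have hs (l m : Fin 4) (x : Fin 4 → ℂ) : quadPoly c l m x = quadPoly c m l x := by
    simp only [quadPoly, fun i j => hc.symm_right i j l m]
  have hx : ∑ i, coords ((s : S3) : E4) i ^ 2 = 1 := by
    have := congrArg (evalAt s) (sum_crd_sq (W := W))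
    simpa only [map_sum, map_pow, evalAt_crd, map_one] using this
  have e0 : Gam (symsQuad 0) (crd l) (crd m) = (proj l m : SmoothFn W) :=
    (Gam_laplaceS_crd l (crd m)).trans (D_crd l m)
  have e1 : Gam (symsQuad 1) (crd l) (crd m) = (_ : SmoothFn W) := Gam_sq_J 0 1 (crd l) (crd m)
  have e2 : Gam (symsQuad 2) (crd l) (crd m) = (_ : SmoothFn W) := Gam_sq_J 0 2 (crd l) (crd m)
  have e3 : Gam (symsQuad 3) (crd l) (crd m) = (_ : SmoothFn W) := Gam_sq_J 1 2 (crd l) (crd m)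
  have e4 : Gam (symsQuad 4) (crd l) (crd m) = (_ : SmoothFn W) :=
    (Gam_add _ _ _ _).trans (congrArg₂ (· + ·) (Gam_symm_J 0 2 0 3 (crd l) (crd m))
      (Gam_symm_J 1 2 1 3 (crd l) (crd m)))
  simp only [Fin.sum_univ_four, Fin.sum_univ_five, e0, e1, e2, e3, e4, J_crd, proj, map_add,
    map_sub, map_mul, apply_ite (evalAt s), map_zero, map_one, evalAt_crd] at hx ⊢
  generalize coords ((s : S3) : E4) = x at *
  fin_cases l <;> fin_cases m <;>
    simp [symsCoeff, hs 1 0, hs 2 0, hs 3 0, hs 2 1, hs 3 1, hs 3 2, hc.quadPoly_eq,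
      hc.quadPoly_eq', h1, h2, h3] <;>
    first | ring1 | linear_combination (c 0 0 3 3 / 2) * hx

/-! ### Killing fields annihilating the potential, and the spanning theorem. -/

/-- The derivative of the potential along the Killing field with matrix `b`, cleared of its
poles. -/
def killingFn (b : Fin 4 → Fin 4 → ℂ) (a : Fin 3 → ℂ) (x : Fin 4 → ℂ) (u : ℂ) : ℂ :=
  a 0 * x 0 ^ 3 * x 1 ^ 3 * (u ^ 3 * ∑ j, b j 3 * x j) - 2 * a 1 * x 1 ^ 3 * ∑ j, b j 0 * x j
    - 2 * a 2 * x 0 ^ 3 * ∑ j, b j 1 * x j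

lemma killingFn_smul (b : Fin 4 → Fin 4 → ℂ) (a : Fin 3 → ℂ) {r : ℂ} (hr : r ≠ 0) (x : Fin 4 → ℂ)
    (u : ℂ) : killingFn b a (fun i => r * x i) (r⁻¹ * u) = r ^ 4 * killingFn b a x u := by
  have h (k : Fin 4) : ∑ j, b j k * (r * x j) = r * ∑ j, b j k * x j := by
    rw [Finset.mul_sum]
    exact Finset.sum_congr rfl fun j _ => by ring
  simp only [killingFn, h, mul_pow]
  field_simp

lemma contDiffAt_killingFn (b : Fin 4 → Fin 4 → ℂ) (a : Fin 3 → ℂ) {x : E4} (hx : x ∈ offAxis) :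
    ContDiffAt ℝ ω (fun x : E4 => killingFn b a (coords x) (rinvAmb x)) x := by
  have h1 := contDiffAt_rinvAmb hx
  have h2 (i) : ContDiffAt ℝ ω (fun x : E4 => coords x i) x := (contDiff_coord_omega i).contDiffAt
  have h3 (k : Fin 4) : ContDiffAt ℝ ω (fun x : E4 => ∑ j, b j k * coords x j) x :=
    ContDiffAt.sum fun j _ => contDiffAt_const.mul (h2 j)
  unfold killingFn
  fun_prop

/-- On x₀ = 0 and on x₁ = 0 the polar terms of V₂ and V₃ kill all entries of b with an index 0 or 1.
What remains is a rotation in the (2,3)-plane, which does not preserve V₁. -/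
lemma killing_eq_zero [Nonempty W] (hW : W ≤ regular) {a : Fin 3 → ℂ} (ha : ∀ i, a i ≠ 0)
    {b : Fin 4 → Fin 4 → ℂ} (hb : ∀ j k, b j k = -b k j)
    (h : ∑ j, ∑ k, algebraMap ℂ (SmoothFn W) (b j k) * crd j * D k (pot hW a) = 0) (j k : Fin 4) :
    b j k = 0 := by
  -- Antisymmetry of b means that the field is tangent, as `sum_mul_D_pot` requires.
  have hB : ∑ k, crd k * ∑ j, algebraMap ℂ (SmoothFn W) (b j k) * crd j = 0 := by
    simp only [Finset.mul_sum]
    apply two_mul_cancel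
    rw [mul_zero, two_mul]
    conv_lhs => enter [2]; rw [Finset.sum_comm]
    simp only [← Finset.sum_add_distrib]
    refine Finset.sum_eq_zero fun k _ => Finset.sum_eq_zero fun j _ => ?_
    rw [hb j k, map_neg]; ring
  have h1 : ∑ k, (∑ j, algebraMap ℂ (SmoothFn W) (b j k) * crd j) * D k (pot hW a) = 0 := by
    rw [← h, Finset.sum_comm]
    exact Finset.sum_congr rfl fun k _ => Finset.sum_mul _ _ _
  rw [sum_mul_D_pot hW a hB] at h1
  have h2 (s : W) : killingFn b a (coords ((s : S3) : E4)) (rinvAmb ((s : S3) : E4)) = 0 := by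
    have h3 := congrArg (evalAt s) h1
    have h4 := evalAt_V2 hW s
    have h5 := evalAt_V3 hW s
    simp only [map_add, map_mul, map_pow, map_sum, evalAt_crd, evalAt_rinv, AlgHom.commutes,
      Algebra.algebraMap_self, RingHom.id_apply, map_zero] at h3
    generalize coords ((s : S3) : E4) = x at *
    generalize rinvAmb ((s : S3) : E4) = u at *
    generalize evalAt s (V2 hW) = v at *
    generalize evalAt s (V3 hW) = w at *
    have h4' : v ^ 2 * x 0 ^ 4 = 1 := by linear_combination (v * x 0 ^ 2 + 1) * h4
    have h5' : w ^ 2 * x 1 ^ 4 = 1 := by linear_combination (w * x 1 ^ 2 + 1) * h5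
    rw [killingFn]
    linear_combination x 0 ^ 3 * x 1 ^ 3 * h3 + 2 * a 1 * x 1 ^ 3 * (∑ j, b j 0 * x j) * h4'
      + 2 * a 2 * x 0 ^ 3 * (∑ j, b j 1 * x j) * h5'
  have h3 (x : Fin 4 → ℝ) (hx : WithLp.toLp 2 x ∈ offAxis) :
      killingFn b a (fun i => (x i : ℂ)) (rinvAmb (WithLp.toLp 2 x)) = 0 := by
    refine eq_zero_of_homogeneous hW (fun x hx => contDiffAt_killingFn b a hx) 4 ?_ h2 hx
    intro r x hr
    have h1 : coords (r • x) = fun i => (r : ℂ) * coords x i := by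
      funext i; simp [coords]
    have h2 := killingFn_smul b a (Complex.ofReal_ne_zero.2 hr.ne') (coords x) (rinvAmb x)
    rw [← h1, ← rinvAmb_smul hr] at h2
    exact h2
  have h4 (j : Fin 4) : b j j = 0 := self_eq_neg.1 (hb j j)
  have k0 (x : Fin 4 → ℝ) (h0 : x 0 = 0) (h1 : x 1 ≠ 0) : ∑ j, b j 0 * (x j : ℂ) = 0 := by
    have := h3 x (offAxis_of_ne (i := 1) (by decide) h1)
    simpa [killingFn, h0, h1, ha] using this
  have k1 (x : Fin 4 → ℝ) (h0 : x 0 ≠ 0) (h1 : x 1 = 0) : ∑ j, b j 1 * (x j : ℂ) = 0 := by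
    have := h3 x (offAxis_of_ne (i := 0) (by decide) h0)
    simpa [killingFn, h0, h1, ha] using this
  have b10 : b 1 0 = 0 := by simpa [Fin.sum_univ_four] using k0 ![0, 1, 0, 0] rfl (by simp)
  have b20 : b 2 0 = 0 := by simpa [Fin.sum_univ_four, b10] using k0 ![0, 1, 1, 0] rfl (by simp)
  have b30 : b 3 0 = 0 := by simpa [Fin.sum_univ_four, b10] using k0 ![0, 1, 0, 1] rfl (by simp)
  have b01 : b 0 1 = 0 := by simpa [Fin.sum_univ_four] using k1 ![1, 0, 0, 0] (by simp) rfl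
  have b21 : b 2 1 = 0 := by simpa [Fin.sum_univ_four, b01] using k1 ![1, 0, 1, 0] (by simp) rfl
  have b31 : b 3 1 = 0 := by simpa [Fin.sum_univ_four, b01] using k1 ![1, 0, 0, 1] (by simp) rfl
  have b02 : b 0 2 = 0 := by rw [hb, b20, neg_zero]
  have b03 : b 0 3 = 0 := by rw [hb, b30, neg_zero]
  have b12 : b 1 2 = 0 := by rw [hb, b21, neg_zero]
  have b13 : b 1 3 = 0 := by rw [hb, b31, neg_zero]
  have b23 : b 2 3 = 0 := by
    -- Again a point with r = 3; only the entry `b 2 3` contributes there.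
    have hx : (WithLp.toLp 2 ![2, 2, 1, 0] : E4) ∈ offAxis :=
      offAxis_of_ne (i := 0) (by decide) (by simp)
    have := h3 _ hx
    rw [rinvAmb_vec (r := 3) (by norm_num) (by simp; norm_num)] at this
    simpa [killingFn, Fin.sum_univ_four, b10, b20, b30, b01, b21, b31, b03, b13, h4, ha] using this
  have b32 : b 3 2 = 0 := by rw [hb, b23, neg_zero]
  fin_cases j <;> fin_cases k <;> first | exact h4 _ | assumption

/-- The second-order symmetries are the linear combinations of the five symmetries and the
constants. -/
lemma mem_span_of_mem_symmetries (hconn : IsPreconnected (W : Set S3)) [Nonempty W]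
    (hW : W ≤ regular) {a : Fin 3 → ℂ} (ha : ∀ i, a i ≠ 0) (a₄ : ℂ) {S : Op W}
    (hS : S ∈ symmetries W (helmholtz ![V1 hW, V2 hW, V3 hW] a a₄)) :
    ∃ (r : Fin 5 → ℂ) (t : ℂ), S = ∑ i, r i • syms hW a a₄ i + t • 1 := by
  obtain ⟨hS2, hSc⟩ := mem_symmetries_iff.1 hS
  obtain ⟨c, hc, hA1, hA2⟩ := exists_curvature hconn hS2 ((commute_helmholtz_iff hW a a₄ S).1 hSc)
  obtain ⟨Q, hQ, hSQ⟩ := exists_quadOps hc hA2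
  -- At this stage only the existence of a function with the prescribed gradient matters: it
  -- supplies the integrability conditions on c.
  obtain ⟨-, f, -, hf, -, -⟩ :=
    symmetry_structure hconn hS2 ((commute_helmholtz_iff hW a a₄ S).1 hSc) hQ hSQ
  have hcurl := fun i k x (hx : x ∈ offAxis) => curlFn_eq_zero hW hS2 hA1 hA2 hf i k hx
  have hr : IsReduced c := { hc with
    zero := fun hi hj hk => curvature_zero hc (ha 1) hcurl hi hj hk
    one := fun hi hj hk => curvature_one hc (ha 2) hcurl hi hj hk }
  obtain ⟨h1, h2, h3⟩ := hr.relations (ha 0) hcurl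
  set P : Op W := ∑ i, symsCoeff c i • syms hW a a₄ i with hP
  have hPmem : P ∈ symmetries W (helmholtz ![V1 hW, V2 hW, V3 hW] a a₄) :=
    Submodule.sum_mem _ fun i _ => Submodule.smul_mem _ _ (syms_mem hW a a₄ i)
  obtain ⟨hR2, hRc⟩ := mem_symmetries_iff.1 (op_sub_mem hS hPmem)
  have hR0 (l m : Fin 4) : Gam (S - P) (crd l) (crd m) = 0 := by
    have h4 (i : Fin 5) : Gam (symsCoeff c i • syms hW a a₄ i) (crd l) (crd m)
        = symsCoeff c i • Gam (symsQuad i) (crd l) (crd m) := by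
      rw [Gam_smul, Gam_syms]
    have h5 : Gam P (crd l) (crd m) = ∑ i, symsCoeff c i • Gam (symsQuad i) (crd l) (crd m) := by
      rw [hP, Gam_sum]
      exact Finset.sum_congr rfl fun i _ => h4 i
    rw [Gam_sub, h5]
    apply SmoothFn.ext; intro s
    change evalAt s (_ - _) = 0
    rw [map_sub, evalAt_Gam hA2, quadPoly_eq_sum hr h1 h2 h3, map_sum]
    simp only [map_smul, smul_eq_mul, sub_self]
  have hR (V : SmoothFn W) (k : Fin 4) : Gam (S - P) V (crd k) = 0 := by
    rw [Gam_comm, ← sum_Gam_crd_mul_D hR2]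
    exact Finset.sum_eq_zero fun m _ => by rw [hR0, zero_mul]
  -- The structure theorem is applied again with Q = 0, since the remainder has zero symbol.
  obtain ⟨b, g, hb, hg, hbV, hSg⟩ := symmetry_structure hconn hR2
    ((commute_helmholtz_iff hW a a₄ _).1 hRc) (Submodule.zero_mem (quadOps W))
    (fun l m => by rw [hR0, Gam_zero])
  have hb0 := killing_eq_zero hW ha hb hbV
  obtain ⟨t, rfl⟩ := exists_eq_algebraMap_of_D_eq_zero hconn g
    (fun k => by rw [hg, hR])
  refine ⟨symsCoeff c, t, ?_⟩
  have h6 : S - P = t • 1 := by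
    apply LinearMap.ext; intro φ
    rw [hSg]
    simp only [hb0, map_zero, zero_mul, Finset.sum_const_zero, add_zero, ← Algebra.smul_def]
    rw [LinearMap.zero_apply, zero_add]
    rfl
  rw [← h6, ← hP]
  abel

lemma span_eq_symmetries (hconn : IsPreconnected (W : Set S3)) [Nonempty W]
    (hW : W ≤ regular) {a : Fin 3 → ℂ} (ha : ∀ i, a i ≠ 0) (a₄ : ℂ) :
    Submodule.span ℂ (Set.range (Fin.cons 1 (syms hW a a₄) : Fin 6 → Op W))
      = symmetries W (helmholtz ![V1 hW, V2 hW, V3 hW] a a₄) := by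
  apply le_antisymm
  · rw [Submodule.span_le]
    rintro _ ⟨i, rfl⟩
    refine Fin.cases ?_ (fun i => ?_) i
    · exact one_mem_symmetries _
    · exact syms_mem hW a a₄ i
  · intro S hS
    obtain ⟨r, t, rfl⟩ := mem_span_of_mem_symmetries hconn hW ha a₄ hS
    refine Submodule.add_mem _ (Submodule.sum_mem _ fun i _ => Submodule.smul_mem _ _ ?_)
      (Submodule.smul_mem _ _ ?_)
    · exact Submodule.subset_span ⟨i.succ, rfl⟩
    · exact Submodule.subset_span ⟨0, rfl⟩

lemma card_le_card_of_range_subset_span {M : Type*} [AddCommMonoid M] [Module ℂ M] {m n : ℕ}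
    {S : Fin m → M} (hS : LinearIndependent ℂ S) {T : Fin n → M}
    (h : Submodule.span ℂ (Set.range S) ≤ Submodule.span ℂ (Set.range T)) : m ≤ n := by
  let _ : AddCommGroup M := Module.addCommMonoidToAddCommGroup ℂ
  have : FiniteDimensional ℂ (Submodule.span ℂ (Set.range T)) :=
    FiniteDimensional.span_of_finite ℂ (Set.finite_range _)
  have h2 := Submodule.finrank_mono h
  rw [finrank_span_eq_card hS, Fintype.card_fin] at h2
  have h3 := finrank_range_le_card (R := ℂ) T
  rw [Fintype.card_fin] at h3
  exact h2.trans h3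

/-- For generic parameters there are not six symmetries. -/
lemma not_admitsSixSymmetries (hconn : IsPreconnected (W : Set S3)) [Nonempty W]
    (hW : W ≤ regular) {a : Fin 3 → ℂ} (ha : ∀ i, a i ≠ 0) (a₄ : ℂ) :
    ¬ AdmitsSixSymmetries (helmholtz ![V1 hW, V2 hW, V3 hW] a a₄) := by
  rintro ⟨S, hS, hli⟩
  have h1 : Submodule.span ℂ (Set.range (Fin.cons 1 S : Fin 7 → Op W)) ≤
      Submodule.span ℂ (Set.range (Fin.cons 1 (syms hW a a₄) : Fin 6 → Op W)) := by
    rw [span_eq_symmetries hconn hW ha, Submodule.span_le]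
    rintro _ ⟨i, rfl⟩
    refine Fin.cases ?_ (fun i => ?_) i
    · exact one_mem_symmetries _
    · exact hS i
  have h2 := card_le_card_of_range_subset_span hli h1
  omega

/-! ### Functional independence -/

/-- A real-analytic function on the whole space that is nonzero at one point vanishes on no nonempty
open set. The point y need not lie in Ω. -/
lemma subset_closure_ne_zero {E : Type*} [NormedAddCommGroup E] [NormedSpace ℝ E] {F : E → ℝ}
    (hF : ContDiff ℝ ω F) {y : E} (hy : F y ≠ 0) {Ω : Set E} (hΩ : IsOpen Ω) :
    Ω ⊆ closure {x ∈ Ω | F x ≠ 0} := by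
  have hd : Dense {x | F x ≠ 0} := by
    have h1 : interior {x | F x = 0} = ∅ := by
      by_contra hne
      obtain ⟨x, hx⟩ := Set.nonempty_iff_ne_empty.2 hne
      have h2 : AnalyticOnNhd ℝ F Set.univ := fun x _ => hF.contDiffAt.analyticAt
      refine hy (h2.eqOn_zero_of_preconnected_of_eventuallyEq_zero isPreconnected_univ
        (Set.mem_univ x) ?_ (Set.mem_univ y))
      exact mem_interior_iff_mem_nhds.1 hx
    exact interior_eq_empty_iff_dense_compl.1 h1
  exact hd.open_subset_closure_inter hΩ

lemma functionallyIndependentOn_of_forall {ι E : Type*} [Fintype ι] [NormedAddCommGroup E]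
    [NormedSpace ℝ E] {f : ι → E → ℂ} {Ω : Set E} (hΩ : IsOpen Ω) (hf : ∀ i, ContDiffOn ℝ ∞ (f i) Ω)
    {F : E → ℝ} (hF : ContDiff ℝ ω F) {y : E} (hy : F y ≠ 0)
    (h : ∀ x ∈ Ω, F x ≠ 0 → ∀ r : ι → ℂ, (∀ v, ∑ i, r i * fderiv ℝ (f i) x v = 0) → ∀ i, r i = 0) :
    FunctionallyIndependentOn f Ω := by
  refine ⟨hf, (subset_closure_ne_zero hF hy hΩ).trans (closure_mono ?_)⟩
  rintro x ⟨hx, hx0⟩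
  refine ⟨hx, Fintype.linearIndependent_iff.2 fun r hr => h x hx hx0 r fun v => ?_⟩
  have := congrArg (fun T : E →L[ℝ] ℂ => T v) hr
  simpa using this

/-- A linear relation with constant coefficients can be differentiated at a point where the
differentials are independent. -/
lemma eq_zero_of_functionallyIndependentOn {ι E : Type*} [Fintype ι] [NormedAddCommGroup E]
    [NormedSpace ℝ E] {f : ι → E → ℂ} {Ω : Set E} (hΩ : IsOpen Ω) (hne : Ω.Nonempty)
    (hf : FunctionallyIndependentOn f Ω) {r : ι → ℂ} (h : ∀ x ∈ Ω, ∑ i, r i * f i x = 0) (i : ι) :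
    r i = 0 := by
  obtain ⟨x, hx, hli⟩ : {x ∈ Ω | LinearIndependent ℂ (fun i => fderiv ℝ (f i) x)}.Nonempty :=
    closure_nonempty_iff.1 (hne.mono hf.2)
  refine Fintype.linearIndependent_iff.1 hli r ?_ i
  have h1 : (fun y => ∑ i, r i * f i y) =ᶠ[nhds x] fun _ => 0 := by
    filter_upwards [hΩ.mem_nhds hx] with y hy using h y hy
  have hd (i : ι) : DifferentiableAt ℝ (f i) x :=
    ((hf.1 i).contDiffAt (hΩ.mem_nhds hx)).differentiableAt (by simp)
  have h2 : HasFDerivAt (fun y => ∑ i, r i * f i y) (∑ i, r i • fderiv ℝ (f i) x) x :=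
    HasFDerivAt.fun_sum fun i _ => (hd i).hasFDerivAt.const_mul (r i)
  rw [← h2.fderiv, h1.fderiv_eq]
  simp

/-- The functions `x_a p_b - x_b p_a` on phase space. -/
def rotSymbol (a b : Fin 4) (q : E4 × E4) : ℝ := q.1 a * q.2 b - q.1 b * q.2 a

lemma contDiff_fst_coord (a : Fin 4) : ContDiff ℝ ω (fun q : E4 × E4 => q.1 a) :=
  (contDiff_piLp_apply (p := 2)).comp contDiff_fst

lemma contDiff_snd_coord (a : Fin 4) : ContDiff ℝ ω (fun q : E4 × E4 => q.2 a) :=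
  (contDiff_piLp_apply (p := 2)).comp contDiff_snd

lemma contDiff_rotSymbol (a b : Fin 4) : ContDiff ℝ ω (rotSymbol a b) :=
  ((contDiff_fst_coord a).mul (contDiff_snd_coord b)).sub
    ((contDiff_fst_coord b).mul (contDiff_snd_coord a))

lemma fderiv_rotSymbol (a b : Fin 4) (q v : E4 × E4) :
    fderiv ℝ (rotSymbol a b) q v = rotSymbol a b (q.1, v.2) + rotSymbol a b (v.1, q.2) := by
  have h1 (i : Fin 4) : HasFDerivAt (fun q : E4 × E4 => q.1 i)
      ((EuclideanSpace.proj i).comp (ContinuousLinearMap.fst ℝ E4 E4)) q :=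
    ((EuclideanSpace.proj (𝕜 := ℝ) i).comp (ContinuousLinearMap.fst ℝ E4 E4)).hasFDerivAt
  have h2 (i : Fin 4) : HasFDerivAt (fun q : E4 × E4 => q.2 i)
      ((EuclideanSpace.proj i).comp (ContinuousLinearMap.snd ℝ E4 E4)) q :=
    ((EuclideanSpace.proj (𝕜 := ℝ) i).comp (ContinuousLinearMap.snd ℝ E4 E4)).hasFDerivAt
  have h := (((h1 a).fun_mul (h2 b)).fun_sub ((h1 b).fun_mul (h2 a))).fderiv
  have h' : fderiv ℝ (rotSymbol a b) q v = _ := congrArg (fun T => T v) h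
  rw [h']
  simp [rotSymbol]
  ring

/-- The symbols of the five symmetries, up to the factor `‖x‖²`. -/
def symsSymbol : Fin 5 → E4 × E4 → ℝ :=
  ![fun q => rotSymbol 0 1 q * rotSymbol 0 1 q + rotSymbol 0 2 q * rotSymbol 0 2 q + rotSymbol 0 3 q * rotSymbol 0 3 q + rotSymbol 1 2 q * rotSymbol 1 2 q
      + rotSymbol 1 3 q * rotSymbol 1 3 q + rotSymbol 2 3 q * rotSymbol 2 3 q,
    fun q => rotSymbol 0 1 q * rotSymbol 0 1 q, fun q => rotSymbol 0 2 q * rotSymbol 0 2 q, fun q => rotSymbol 1 2 q * rotSymbol 1 2 q,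
    fun q => 2 * (rotSymbol 0 2 q * rotSymbol 0 3 q + rotSymbol 1 2 q * rotSymbol 1 3 q)]

lemma contDiff_symsSymbol (i : Fin 5) : ContDiff ℝ ω (symsSymbol i) := by
  have h := contDiff_rotSymbol
  fin_cases i <;> simp [symsSymbol] <;> fun_prop

lemma fderiv_symsSymbol (i : Fin 5) (q v : E4 × E4) : fderiv ℝ (symsSymbol i) q v =
    (![fun d => 2 * (rotSymbol 0 1 q * d 0 1 + rotSymbol 0 2 q * d 0 2 + rotSymbol 0 3 q * d 0 3
        + rotSymbol 1 2 q * d 1 2 + rotSymbol 1 3 q * d 1 3 + rotSymbol 2 3 q * d 2 3),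
      fun d => 2 * (rotSymbol 0 1 q * d 0 1), fun d => 2 * (rotSymbol 0 2 q * d 0 2),
      fun d => 2 * (rotSymbol 1 2 q * d 1 2),
      fun d => 2 * (rotSymbol 0 2 q * d 0 3 + rotSymbol 0 3 q * d 0 2 + rotSymbol 1 2 q * d 1 3
        + rotSymbol 1 3 q * d 1 2)] : Fin 5 → (Fin 4 → Fin 4 → ℝ) → ℝ) i
      (fun a b => rotSymbol a b (q.1, v.2) + rotSymbol a b (v.1, q.2)) := by
  have h (a b : Fin 4) : HasFDerivAt (rotSymbol a b) (fderiv ℝ (rotSymbol a b) q) q :=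
    ((contDiff_rotSymbol a b).differentiable (by simp) q).hasFDerivAt
  simp only [← fderiv_rotSymbol]
  have hs (a b : Fin 4) := (h a b).fun_mul (h a b)
  fin_cases i
  · have h1 := ((((((hs 0 1).fun_add (hs 0 2)).fun_add (hs 0 3)).fun_add (hs 1 2)).fun_add
      (hs 1 3)).fun_add (hs 2 3)).fderiv
    refine (congrArg (fun T => T v) h1).trans ?_
    simp; ring
  · refine (congrArg (fun T => T v) (hs 0 1).fderiv).trans ?_
    simp; ring
  · refine (congrArg (fun T => T v) (hs 0 2).fderiv).trans ?_
    simp; ring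
  · refine (congrArg (fun T => T v) (hs 1 2).fderiv).trans ?_
    simp; ring
  · have h1 := ((((h 0 2).fun_mul (h 0 3)).fun_add ((h 1 2).fun_mul (h 1 3))).const_mul 2).fderiv
    refine (congrArg (fun T => T v) h1).trans ?_
    simp; ring

/-- The obstruction to the functional independence of the symbols. -/
def symsDet (q : E4 × E4) : ℝ :=
  ((rotSymbol 0 3 q * q.1 0 + rotSymbol 1 3 q * q.1 1 + rotSymbol 2 3 q * q.1 2)
      * (rotSymbol 0 2 q * q.2 0 + rotSymbol 1 2 q * q.2 1)
    - (rotSymbol 0 3 q * q.2 0 + rotSymbol 1 3 q * q.2 1 + rotSymbol 2 3 q * q.2 2)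
      * (rotSymbol 0 2 q * q.1 0 + rotSymbol 1 2 q * q.1 1))
    * (rotSymbol 0 1 q * rotSymbol 0 2 q * rotSymbol 1 2 q * q.1 2)

lemma contDiff_symsDet : ContDiff ℝ ω symsDet := by
  have h := contDiff_rotSymbol
  have h1 := contDiff_fst_coord
  have h2 := contDiff_snd_coord
  unfold symsDet
  fun_prop

/-- Testing on well-chosen directions makes the system block triangular. The directions e₃ in p and
in x involve only the first and last symbols, and the bracket in `symsDet` is their 2×2 determinant.
Then e₀ in p and in x separates J₀₁² from J₀₂², and e₁ in p leaves J₁₂². -/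
lemma symsSymbol_independent {q : E4 × E4} (hq : symsDet q ≠ 0) {r : Fin 5 → ℂ}
    (h : ∀ v, ∑ i, r i * (fderiv ℝ (symsSymbol i) q v : ℂ) = 0) (i : Fin 5) : r i = 0 := by
  have hd : (((rotSymbol 0 3 q * q.1 0 + rotSymbol 1 3 q * q.1 1 + rotSymbol 2 3 q * q.1 2)
      * (rotSymbol 0 2 q * q.2 0 + rotSymbol 1 2 q * q.2 1)
    - (rotSymbol 0 3 q * q.2 0 + rotSymbol 1 3 q * q.2 1 + rotSymbol 2 3 q * q.2 2)
      * (rotSymbol 0 2 q * q.1 0 + rotSymbol 1 2 q * q.1 1) : ℝ) : ℂ) ≠ 0 :=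
    Complex.ofReal_ne_zero.2 (left_ne_zero_of_mul hq)
  have hm := right_ne_zero_of_mul hq
  have hx2 : (q.1 2 : ℂ) ≠ 0 := Complex.ofReal_ne_zero.2 (right_ne_zero_of_mul hm)
  have h12 : (rotSymbol 1 2 q : ℂ) ≠ 0 :=
    Complex.ofReal_ne_zero.2 (right_ne_zero_of_mul (left_ne_zero_of_mul hm))
  have hm' := left_ne_zero_of_mul (left_ne_zero_of_mul hm)
  have h02 : (rotSymbol 0 2 q : ℂ) ≠ 0 := Complex.ofReal_ne_zero.2 (right_ne_zero_of_mul hm')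
  have h01 : (rotSymbol 0 1 q : ℂ) ≠ 0 := Complex.ofReal_ne_zero.2 (left_ne_zero_of_mul hm')
  simp only [fderiv_symsSymbol, Fin.sum_univ_five] at h
  have p3 := h (0, e 3)
  have x3 := h (e 3, 0)
  have p0 := h (0, e 0)
  have x0 := h (e 0, 0)
  have p1 := h (0, e 1)
  simp [rotSymbol] at p3 x3 p0 x0 p1 hd h12 h02 h01
  obtain ⟨x, p⟩ := q
  simp only at *
  have hr0 : r 0 = 0 := by
    refine (mul_eq_zero.1 ?_).resolve_right hd
    linear_combination (p3 / 2) * ((x 0 * p 2 - x 2 * p 0) * p 0 + (x 1 * p 2 - x 2 * p 1) * p 1)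
      + (x3 / 2) * ((x 0 * p 2 - x 2 * p 0) * x 0 + (x 1 * p 2 - x 2 * p 1) * x 1)
  have hr4 : r 4 = 0 := by
    refine (mul_eq_zero.1 ?_).resolve_right hd
    linear_combination (-x3 / 2) * ((x 0 * p 3 - x 3 * p 0) * x 0 + (x 1 * p 3 - x 3 * p 1) * x 1
        + (x 2 * p 3 - x 3 * p 2) * x 2)
      - (p3 / 2) * ((x 0 * p 3 - x 3 * p 0) * p 0 + (x 1 * p 3 - x 3 * p 1) * p 1
        + (x 2 * p 3 - x 3 * p 2) * p 2)
  simp only [hr0, hr4, zero_mul, zero_add, add_zero] at p0 x0 p1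
  have hr1 : r 1 = 0 := by
    refine (mul_eq_zero.1 ?_).resolve_right h01
    refine (mul_eq_zero.1 ?_).resolve_right h12
    linear_combination (-p0 / 2) * p 2 - (x0 / 2) * x 2
  have hr2 : r 2 = 0 := by
    refine (mul_eq_zero.1 ?_).resolve_right h02
    refine (mul_eq_zero.1 ?_).resolve_right h12
    linear_combination (x0 / 2) * x 1 + (p0 / 2) * p 1
  simp only [hr1, zero_mul, zero_add] at p1
  have hr3 : r 3 = 0 := by
    refine (mul_eq_zero.1 ?_).resolve_right h12
    refine (mul_eq_zero.1 ?_).resolve_right hx2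
    linear_combination (-p1 / 2)
  fin_cases i <;> assumption

/-! ### The symbols of the symmetries -/

lemma linearFn_eq (p : E4) : (linearFn p : SmoothFn W) = ∑ i, (p i : ℂ) • crd i := by
  apply SmoothFn.ext; intro s
  change _ = evalAt s (∑ i, (p i : ℂ) • crd i)
  simp only [map_sum, map_smul, evalAt_crd, smul_eq_mul]
  change ((inner ℝ p ((s : S3) : E4) : ℝ) : ℂ) = _
  simp [PiLp.inner_apply, coords, mul_comm]

lemma evalAt_J_linearFn (a b : Fin 4) (p : E4) (s : W) :
    evalAt s (J a b (linearFn p)) = (rotSymbol a b (((s : S3) : E4), p) : ℂ) := by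
  simp only [linearFn_eq, map_sum, J_crd, map_smul, map_sub,
    apply_ite (evalAt s), map_zero, evalAt_crd, smul_eq_mul, mul_sub, Finset.sum_sub_distrib,
    mul_ite, mul_zero, Finset.sum_ite_eq, Finset.mem_univ, if_true, rotSymbol, coords]
  push_cast
  ring

lemma evalAt_Gam_symsQuad (i : Fin 5) (p : E4) (s : W) :
    evalAt s (Gam (symsQuad i) (linearFn p) (linearFn p))
      = (symsSymbol i (((s : S3) : E4), p) : ℂ) := by
  have h := evalAt_J_linearFn (W := W)
  fin_cases i
  · change evalAt s (Gam laplaceS (linearFn p) (linearFn p)) = _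
    rw [laplaceS_eq_six]
    simp only [Gam_add, Gam_sq_J, map_add, map_mul, h]
    simp [symsSymbol]
  · change evalAt s (Gam (J 0 1 ^ 2) (linearFn p) (linearFn p)) = _
    rw [Gam_sq_J, map_mul, h]
    simp [symsSymbol]
  · change evalAt s (Gam (J 0 2 ^ 2) (linearFn p) (linearFn p)) = _
    rw [Gam_sq_J, map_mul, h]
    simp [symsSymbol]
  · change evalAt s (Gam (J 1 2 ^ 2) (linearFn p) (linearFn p)) = _
    rw [Gam_sq_J, map_mul, h]
    simp [symsSymbol]
  · change evalAt s (Gam (symm (J 0 2) (J 0 3) + symm (J 1 2) (J 1 3) : Op W) (linearFn p)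
      (linearFn p)) = _
    rw [Gam_add, Gam_symm_J, Gam_symm_J]
    simp only [map_add, map_mul, h]
    simp [symsSymbol]
    ring

lemma symsSymbol_smul (i : Fin 5) (t : ℝ) (x p : E4) :
    symsSymbol i (t • x, p) = t ^ 2 * symsSymbol i (x, p) := by
  fin_cases i <;> (simp [symsSymbol, rotSymbol]; ring)

lemma symbol_syms (hW : W ≤ regular) (a : Fin 3 → ℂ) (c : ℂ) (i : Fin 5) {q : E4 × E4}
    (hq : q ∈ cone W ×ˢ (Set.univ : Set E4)) :
    symbol (syms hW a c i) q = (((‖q.1‖ ^ 2)⁻¹ * symsSymbol i q : ℝ) : ℂ) := by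
  obtain ⟨x, p⟩ := q
  have hx : x ∈ cone W := hq.1
  have h1 : symbol (syms hW a c i) (x, p)
      = radialExt (Gam (syms hW a c i) (linearFn p) (linearFn p) : W → ℂ) x := rfl
  rw [h1, Gam_syms, radialExt, dif_pos hx, ← evalAt_apply, evalAt_Gam_symsQuad]
  change ((symsSymbol i (‖x‖⁻¹ • x, p) : ℝ) : ℂ) = _
  rw [symsSymbol_smul, inv_pow]

lemma isOpen_phaseSpace : IsOpen (cone W ×ˢ (Set.univ : Set E4)) :=
  (isOpen_cone W).prod isOpen_univ

lemma contDiffOn_symbol (hW : W ≤ regular) (a : Fin 3 → ℂ) (c : ℂ) (i : Fin 5) :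
    ContDiffOn ℝ ∞ (symbol (syms hW a c i)) (cone W ×ˢ Set.univ) := by
  have h : ContDiffOn ℝ ∞ (fun q : E4 × E4 => (((‖q.1‖ ^ 2)⁻¹ * symsSymbol i q : ℝ) : ℂ))
      (cone W ×ˢ Set.univ) := by
    intro q hq
    have hq0 : q.1 ≠ 0 := hq.1.1
    have h1 : ContDiffAt ℝ ∞ (fun q : E4 × E4 => ‖q.1‖ ^ 2) q := contDiffAt_fst.norm_sq ℝ
    have h2 : ContDiffAt ℝ ∞ (symsSymbol i) q :=
      ((contDiff_symsSymbol i).of_le (by simp)).contDiffAt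
    exact (Complex.ofRealCLM.contDiff.contDiffAt.comp q
      ((h1.inv (pow_ne_zero 2 (norm_ne_zero_iff.2 hq0))).mul h2)).contDiffWithinAt
  exact h.congr fun q hq => symbol_syms hW a c i hq

lemma fderiv_symbol (hW : W ≤ regular) (a : Fin 3 → ℂ) (c : ℂ) (i : Fin 5) {q : E4 × E4}
    (hq : q ∈ cone W ×ˢ (Set.univ : Set E4)) (v : E4 × E4) :
    fderiv ℝ (symbol (syms hW a c i)) q v =
      (((‖q.1‖ ^ 2)⁻¹ * fderiv ℝ (symsSymbol i) q v
        + symsSymbol i q * fderiv ℝ (fun x : E4 => (‖x‖ ^ 2)⁻¹) q.1 v.1 : ℝ) : ℂ) := by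
  have hq0 : q.1 ≠ 0 := hq.1.1
  have h0 : symbol (syms hW a c i) =ᶠ[nhds q]
      fun q => (((‖q.1‖ ^ 2)⁻¹ * symsSymbol i q : ℝ) : ℂ) := by
    filter_upwards [isOpen_phaseSpace.mem_nhds hq] with y hy using symbol_syms hW a c i hy
  have h1 : DifferentiableAt ℝ (fun x : E4 => (‖x‖ ^ 2)⁻¹) q.1 :=
    ((contDiff_norm_sq ℝ (n := 1)).contDiffAt.inv
      (pow_ne_zero 2 (norm_ne_zero_iff.2 hq0))).differentiableAt (by simp)
  have h2 : HasFDerivAt (fun q : E4 × E4 => (‖q.1‖ ^ 2)⁻¹) _ q :=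
    h1.hasFDerivAt.comp q hasFDerivAt_fst
  have h3 : HasFDerivAt (symsSymbol i) (fderiv ℝ (symsSymbol i) q) q :=
    ((contDiff_symsSymbol i).differentiable (by simp) q).hasFDerivAt
  have h4 := Complex.ofRealCLM.hasFDerivAt.comp q (h2.fun_mul h3)
  rw [h0.fderiv_eq]
  refine (congrArg (fun T => T v) h4.fderiv).trans ?_
  simp

lemma opsFunctionallyIndependent_syms (hW : W ≤ regular) (a : Fin 3 → ℂ) (c : ℂ) :
    OpsFunctionallyIndependent (syms hW a c) := by
  refine functionallyIndependentOn_of_forall isOpen_phaseSpace (contDiffOn_symbol hW a c)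
    contDiff_symsDet (y := (WithLp.toLp 2 ![1, 2, 1, 0], WithLp.toLp 2 ![0, 1, 1, 1])) ?_ ?_
  · simp [symsDet, rotSymbol]; norm_num
  · intro q hq hdet r hr
    have hn : (‖q.1‖ : ℂ) ≠ 0 := Complex.ofReal_ne_zero.2 (norm_ne_zero_iff.2 hq.1.1)
    simp only [fderiv_symbol hW a c _ hq] at hr
    -- Euler's relation in the momenta, along a direction that fixes x. It yields the relation among
    -- the symbols themselves, which removes the terms coming from the derivative of ‖x‖⁻².
    have hE (i : Fin 5) : fderiv ℝ (symsSymbol i) q (0, q.2) = 2 * symsSymbol i q := by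
      rw [fderiv_symsSymbol]
      fin_cases i <;> simp [symsSymbol, rotSymbol] <;> ring
    have h0 : ∑ i, r i * (symsSymbol i q : ℂ) = 0 := by
      have := hr (0, q.2)
      simp only [hE, map_zero, mul_zero, add_zero] at this
      have h1 : ((‖q.1‖ ^ 2 : ℝ) : ℂ) / 2 * ∑ i, r i * (((‖q.1‖ ^ 2)⁻¹ * (2 * symsSymbol i q) : ℝ) : ℂ)
          = ∑ i, r i * (symsSymbol i q : ℂ) := by
        rw [Finset.mul_sum]
        refine Finset.sum_congr rfl fun i _ => ?_
        push_cast
        field_simp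
      rw [← h1, this, mul_zero]
    refine symsSymbol_independent hdet fun v => ?_
    have h2 := hr v
    have h3 : ∑ i, r i * (fderiv ℝ (symsSymbol i) q v : ℂ) = ((‖q.1‖ ^ 2 : ℝ) : ℂ) *
        (∑ i, r i * (((‖q.1‖ ^ 2)⁻¹ * fderiv ℝ (symsSymbol i) q v
          + symsSymbol i q * fderiv ℝ (fun x : E4 => (‖x‖ ^ 2)⁻¹) q.1 v.1 : ℝ) : ℂ)
        - (fderiv ℝ (fun x : E4 => (‖x‖ ^ 2)⁻¹) q.1 v.1 : ℂ) * ∑ i, r i * (symsSymbol i q : ℂ)) := by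
      rw [Finset.mul_sum, ← Finset.sum_sub_distrib, Finset.mul_sum]
      refine Finset.sum_congr rfl fun i _ => ?_
      push_cast
      field_simp
      ring
    rw [h3, h2, h0]
    ring

lemma linearIndependent_of_forall {M ι : Type*} [AddCommMonoid M] [Module ℂ M] [Fintype ι]
    {S : ι → M} (h : ∀ r : ι → ℂ, ∑ i, r i • S i = 0 → ∀ i, r i = 0) : LinearIndependent ℂ S := by
  let _ : AddCommGroup M := Module.addCommMonoidToAddCommGroup ℂ
  exact Fintype.linearIndependent_iff.2 h

/-- Constants have zero symbol, so functional independence kills the other five coefficients;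
applying the relation to the function 1 kills the last one. -/
lemma linearIndependent_syms [Nonempty W] (hW : W ≤ regular) (a : Fin 3 → ℂ) (c : ℂ) :
    LinearIndependent ℂ (Fin.cons 1 (syms hW a c) : Fin 6 → Op W) := by
  obtain ⟨s⟩ := ‹Nonempty W›
  refine linearIndependent_of_forall fun r hr => ?_
  rw [Fin.sum_univ_succ] at hr
  simp only [Fin.cons_zero, Fin.cons_succ] at hr
  have h1 (i : Fin 5) : r i.succ = 0 := by
    refine eq_zero_of_functionallyIndependentOn isOpen_phaseSpace
      ⟨(((s : S3) : E4), 0), coe_mem_cone s, trivial⟩ (opsFunctionallyIndependent_syms hW a c)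
      (r := fun i => r i.succ) ?_ i
    rintro ⟨x, p⟩ hq
    have hx : x ∈ cone W := hq.1
    have h2 : Gam (r 0 • 1 + ∑ i : Fin 5, r i.succ • syms hW a c i) (linearFn p) (linearFn p)
        = (0 : SmoothFn W) := by rw [hr, Gam_zero]
    rw [Gam_add, Gam_smul, Gam_one_op, smul_zero, zero_add, Gam_sum] at h2
    have h3 := congrArg (evalAt ⟨toSphere x hx.1, hx.2⟩) h2
    rw [map_sum, map_zero] at h3
    rw [← h3]
    refine Finset.sum_congr rfl fun i _ => ?_
    rw [Gam_smul, map_smul, smul_eq_mul]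
    congr 1
    change radialExt (Gam (syms hW a c i) (linearFn p) (linearFn p) : W → ℂ) x = _
    rw [radialExt, dif_pos hx]
    rfl
  intro i
  refine Fin.cases ?_ h1 i
  have h4 := congrArg (fun T : Op W => evalAt s (T 1)) hr
  simp only [h1, zero_smul, Finset.sum_const_zero, add_zero] at h4
  have h5 : evalAt s ((r 0 • (1 : Op W)) 1) = r 0 := by
    change evalAt s (r 0 • (1 : SmoothFn W)) = _
    rw [map_smul, map_one, smul_eq_mul, mul_one]
  rw [← h5, h4]
  simp

/-! ### Semidegeneracy -/

/-- The rotations J₂₃, J₂₀ and J₂₁ each see exactly one of the three potentials, with a factor that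
is nonzero where x₂ ≠ 0. -/
lemma functionallyIndependentOn_potential (hW : W ≤ regular) :
    FunctionallyIndependentOn (fun i => radialExt
      ((![V1 hW, V2 hW, V3 hW] : Fin 3 → SmoothFn W) i : W → ℂ)) (cone W) := by
  refine functionallyIndependentOn_of_forall (isOpen_cone W)
    (fun i => (contMDiff_iff_radialExt _).1 (![V1 hW, V2 hW, V3 hW] i).2)
    (F := fun x : E4 => x 2) (contDiff_piLp_apply (p := 2)) (y := e 2) (by simp) ?_
  intro x hx hx2 r hr
  set s : W := ⟨toSphere x hx.1, hx.2⟩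
  have hD (k : Fin 4) : r 0 * evalAt s (D k (V1 hW)) + r 1 * evalAt s (D k (V2 hW))
      + r 2 * evalAt s (D k (V3 hW)) = 0 := by
    have h (f : SmoothFn W) : evalAt s (D k f) = ‖x‖ * fderiv ℝ (radialExt (f : W → ℂ)) x (e k) := by
      rw [← radialExt_D k f hx, radialExt, dif_pos hx]
      rfl
    have h1 : r 0 * fderiv ℝ (radialExt (V1 hW : W → ℂ)) x (e k)
        + r 1 * fderiv ℝ (radialExt (V2 hW : W → ℂ)) x (e k)
        + r 2 * fderiv ℝ (radialExt (V3 hW : W → ℂ)) x (e k) = 0 :=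
      (Fin.sum_univ_three _).symm.trans (hr (e k))
    rw [h, h, h]
    linear_combination (‖x‖ : ℂ) * h1
  have hJ (a b : Fin 4) : r 0 * evalAt s (J a b (V1 hW)) + r 1 * evalAt s (J a b (V2 hW))
      + r 2 * evalAt s (J a b (V3 hW)) = 0 := by
    simp only [J_apply, map_sub, map_mul]
    linear_combination evalAt s (crd a) * hD b - evalAt s (crd b) * hD a
  have h2 : evalAt s (crd 2) ≠ 0 := by
    have : ‖x‖⁻¹ * x 2 ≠ 0 := mul_ne_zero (inv_ne_zero (norm_ne_zero_iff.2 hx.1)) hx2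
    exact Complex.ofReal_ne_zero.2 this
  have h0 : evalAt s (crd 0) ≠ 0 := crd_zero_ne hW s
  have h1 : evalAt s (crd 1) ≠ 0 := crd_one_ne hW s
  have hu : evalAt s (rinv hW) ≠ 0 := fun h => by
    have := congrArg (evalAt s) (rinv_sq hW)
    rw [map_mul, map_pow, h] at this
    simp at this
  have hV2 : evalAt s (V2 hW) ≠ 0 := fun h => by simpa [h] using evalAt_V2 hW s
  have hV3 : evalAt s (V3 hW) ≠ 0 := fun h => by simpa [h] using evalAt_V3 hW s
  have e0 := hJ 2 3
  have e1 := hJ 2 0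
  have e2 := hJ 2 1
  rw [J_V1 hW 2 _ (by decide), J_V2, J_V3] at e0 e1 e2
  have h3 : evalAt s (2 : SmoothFn W) ≠ 0 := by rw [map_ofNat]; norm_num
  simp [h0, h1, h2, h3, hu, hV2, hV3] at e0 e1 e2
  intro i
  fin_cases i <;> assumption

lemma isSuperintegrable_helmholtz (hW : W ≤ regular) (a : Fin 3 → ℂ) (c : ℂ) :
    IsSuperintegrable (helmholtz ![V1 hW, V2 hW, V3 hW] a c) :=
  ⟨syms hW a c, rfl, syms_mem hW a c, opsFunctionallyIndependent_syms hW a c⟩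

lemma isSemidegenerate_potential (hconn : IsPreconnected (W : Set S3)) [Nonempty W]
    (hW : W ≤ regular) : IsSemidegenerate ![V1 hW, V2 hW, V3 hW] := by
  -- The generic set consists of the parameters with all three entries nonzero.
  refine ⟨isSuperintegrable_helmholtz hW, functionallyIndependentOn_potential hW,
    {a | ∀ i, a i ≠ 0}, ?_, ?_, fun a ha c => not_admitsSixSymmetries hconn hW ha c⟩
  · have h : {a : Fin 3 → ℂ | ∀ i, a i ≠ 0} = Set.univ.pi fun _ => {0}ᶜ := by ext; simp
    rw [h]
    exact isOpen_set_pi Set.finite_univ fun _ _ => isOpen_compl_singleton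
  · have h : {a : Fin 3 → ℂ | ∀ i, a i ≠ 0} = Set.univ.pi fun _ => {0}ᶜ := by ext; simp
    rw [h]
    exact dense_pi _ fun _ _ => dense_compl_singleton 0

/-! ### Homogeneous extensions of real degree -/

/-- The derivatives of homogeneous extensions of degree `d`, restricted to the sphere. -/
def wdr (d : ℝ) (k : Fin 4) (f : SmoothFn W) : SmoothFn W :=
  D k f + algebraMap ℂ _ (d : ℂ) * (crd k * f)

lemma wdr_comm (d : ℝ) (i j : Fin 4) (f : SmoothFn W) :
    wdr (d - 1) i (wdr d j f) = wdr (d - 1) j (wdr d i f) := by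
  simp only [wdr, map_add, D_mul, D_crd, Derivation.map_algebraMap, Complex.ofReal_sub, Complex.ofReal_one,
    map_sub, map_one, proj_comm j i]
  linear_combination D_D_sub i j f

lemma sum_crd_mul_wdr (d : ℝ) (f : SmoothFn W) :
    ∑ k, crd k * wdr d k f = algebraMap ℂ _ (d : ℂ) * f := by
  have h1 := sum_crd_mul_D f
  have h2 := sum_crd_sq (W := W)
  simp only [wdr, Fin.sum_univ_four] at *
  linear_combination h1 + algebraMap ℂ _ (d : ℂ) * f * h2

/-- The Laplacian of ℝ⁴ in polar form on functions homogeneous of degree d: the radial part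
contributes d(d + 2). -/
lemma sum_wdr_wdr (d : ℝ) (f : SmoothFn W) :
    ∑ k, wdr (d - 1) k (wdr d k f) = laplaceS f + algebraMap ℂ _ ((d * (d + 2) : ℝ) : ℂ) * f := by
  have h1 := sum_crd_mul_D f
  have h2 := sum_crd_sq (W := W)
  rw [laplaceS_apply]
  simp only [wdr, map_add, D_mul, D_crd, Derivation.map_algebraMap, Complex.ofReal_sub, Complex.ofReal_one,
    map_sub, map_one, proj, Fin.sum_univ_four, if_true, Complex.ofReal_mul, Complex.ofReal_add,
    map_mul, Complex.ofReal_ofNat] at *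
  have h3 : algebraMap ℂ (SmoothFn W) 2 = 2 := map_ofNat _ 2
  rw [h3]
  linear_combination (2 * algebraMap ℂ _ (d : ℂ) - 1) * h1
    + (algebraMap ℂ _ (d : ℂ) * (algebraMap ℂ _ (d : ℂ) - 2) * f) * h2

/-- The homogeneous extension of degree `d` of a function to the cone. -/
def homExt (d : ℝ) (f : SmoothFn W) (x : E4) : ℂ :=
  ((‖x‖ ^ d : ℝ) : ℂ) * radialExt (f : W → ℂ) x

lemma homExt_eq (d : ℝ) (f : SmoothFn W) {x : E4} (hx : x ∈ cone W) :
    homExt d f x = ((‖x‖ ^ d : ℝ) : ℂ) * evalAt ⟨toSphere x hx.1, hx.2⟩ f := by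
  rw [homExt, radialExt, dif_pos hx]
  rfl

lemma hasFDerivAt_norm_rpow' (d : ℝ) {x : E4} (hx : x ≠ 0) :
    HasFDerivAt (fun y : E4 => ‖y‖ ^ d) ((d * ‖x‖ ^ (d - 2)) • innerSL ℝ x) x := by
  have h1 := (hasStrictFDerivAt_norm_sq x).hasFDerivAt.rpow_const (p := d / 2)
    (Or.inl (pow_ne_zero 2 (norm_ne_zero_iff.2 hx)))
  have h2 (y : E4) (t : ℝ) : (‖y‖ ^ 2) ^ t = ‖y‖ ^ (2 * t) := by
    rw [← Real.rpow_natCast, ← Real.rpow_mul (norm_nonneg y)]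
    norm_num
  simp only [h2] at h1
  have e1 : 2 * (d / 2) = d := by ring
  have e2 : (d / 2 * ‖x‖ ^ (2 * (d / 2 - 1))) • 2 • innerSL ℝ x
      = (d * ‖x‖ ^ (d - 2)) • innerSL ℝ x := by
    rw [show 2 * (d / 2 - 1) = d - 2 by ring, ← Nat.cast_smul_eq_nsmul ℝ, smul_smul]
    congr 1
    push_cast
    ring
  rwa [e1, e2] at h1

lemma contDiffAt_homExt (d : ℝ) (f : SmoothFn W) {x : E4} (hx : x ∈ cone W) :
    ContDiffAt ℝ ∞ (homExt d f) x := by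
  have h1 : ContDiffAt ℝ ∞ (fun y : E4 => ‖y‖ ^ d) x :=
    (contDiffAt_norm ℝ hx.1).rpow_const_of_ne (norm_ne_zero_iff.2 hx.1)
  exact (Complex.ofRealCLM.contDiff.contDiffAt.comp x h1).mul (contDiffAt_radialExt f hx)

lemma fderiv_homExt (d : ℝ) (f : SmoothFn W) {x : E4} (hx : x ∈ cone W) (k : Fin 4) :
    fderiv ℝ (homExt d f) x (e k) = homExt (d - 1) (wdr d k f) x := by
  have hn : 0 < ‖x‖ := norm_pos_iff.2 hx.1
  have h1 := Complex.ofRealCLM.hasFDerivAt.comp x (hasFDerivAt_norm_rpow' d hx.1)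
  have h2 := ((contDiffAt_radialExt f hx).differentiableAt (by simp)).hasFDerivAt
  have h3 := (h1.fun_mul h2).fderiv
  refine (congrArg (fun T => T (e k)) h3).trans ?_
  have h4 := radialExt_D k f hx
  have h5 : radialExt (wdr d k f : W → ℂ) x = radialExt (D k f : W → ℂ) x
      + d * ((‖x‖⁻¹ * x k : ℝ) * radialExt (f : W → ℂ) x) := by
    simp only [radialExt, dif_pos hx]
    rfl
  have e1 : ‖x‖ ^ (d - 1) = ‖x‖ ^ (d - 2) * ‖x‖ := by
    rw [← Real.rpow_add_one hn.ne']; congr 1; ring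
  have e2 : ‖x‖ ^ d = ‖x‖ ^ (d - 2) * ‖x‖ * ‖x‖ := by
    rw [← e1, ← Real.rpow_add_one hn.ne']; congr 1; ring
  rw [homExt, h5, h4]
  simp [EuclideanSpace.inner_single_right, e1, e2]
  have hnc : (‖x‖ : ℂ) ≠ 0 := Complex.ofReal_ne_zero.2 hn.ne'
  field_simp

/-! ### Inverse stereographic projection -/

/-- The paraboloid `x ↦ (2x, 2y, 2z, 1 - r²)`. -/
def paraboloid (x : E3) : E4 := WithLp.toLp 2 ![2 * x 0, 2 * x 1, 2 * x 2, 1 - ‖x‖ ^ 2]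

lemma norm_sq_E3 (x : E3) : ‖x‖ ^ 2 = x 0 ^ 2 + x 1 ^ 2 + x 2 ^ 2 := by
  simp [EuclideanSpace.norm_sq_eq, Fin.sum_univ_three]

lemma stereo_eq (x : E3) : ((stereo x : S3) : E4) = (‖x‖ ^ 2 + 1)⁻¹ • paraboloid x := by
  ext i
  fin_cases i <;> simp [stereo, paraboloid, div_eq_inv_mul]

lemma norm_paraboloid (x : E3) : ‖paraboloid x‖ = ‖x‖ ^ 2 + 1 := by
  have hp : 0 < ‖x‖ ^ 2 + 1 := by positivity
  have h : ‖((stereo x : S3) : E4)‖ = 1 := by simp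
  rw [stereo_eq, norm_smul, norm_inv, Real.norm_of_nonneg hp.le] at h
  field_simp at h
  exact h

lemma toSphere_paraboloid (x : E3) (h : paraboloid x ≠ 0) : toSphere (paraboloid x) h = stereo x := by
  apply Subtype.ext
  change ‖paraboloid x‖⁻¹ • paraboloid x = _
  rw [stereo_eq, norm_paraboloid]

lemma paraboloid_mem_cone {x : E3} (hx : stereo x ∈ W) : paraboloid x ∈ cone W := by
  have h0 : paraboloid x ≠ 0 := by
    rw [← norm_ne_zero_iff, norm_paraboloid]; positivity
  exact ⟨h0, by rwa [toSphere_paraboloid]⟩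

/-- The derivative of the paraboloid. -/
def paraboloidDeriv (x : E3) : E3 →L[ℝ] E4 :=
  ∑ i : Fin 3, (EuclideanSpace.proj (𝕜 := ℝ) i : E3 →L[ℝ] ℝ).smulRight ((2 : ℝ) • e i.castSucc)
    - ((2 : ℝ) • innerSL ℝ x).smulRight (e 3)

lemma hasFDerivAt_paraboloid (x : E3) : HasFDerivAt paraboloid (paraboloidDeriv x) x := by
  have h1 : HasFDerivAt (fun y : E3 => ‖y‖ ^ 2) ((2 : ℝ) • innerSL ℝ x) x := by
    have := (hasStrictFDerivAt_norm_sq x).hasFDerivAt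
    rwa [← Nat.cast_smul_eq_nsmul ℝ, Nat.cast_ofNat] at this
  have h2 : HasFDerivAt (fun y : E3 => (∑ i : Fin 3,
      (EuclideanSpace.proj (𝕜 := ℝ) i : E3 →L[ℝ] ℝ).smulRight ((2 : ℝ) • e i.castSucc)) y
        - ‖y‖ ^ 2 • e 3 + e 3) (paraboloidDeriv x) x :=
    ((ContinuousLinearMap.hasFDerivAt _).fun_sub (h1.smul_const (e 3))).add_const (e 3)
  have h3 : paraboloid = fun y : E3 => (∑ i : Fin 3,
      (EuclideanSpace.proj (𝕜 := ℝ) i : E3 →L[ℝ] ℝ).smulRight ((2 : ℝ) • e i.castSucc)) y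
        - ‖y‖ ^ 2 • e 3 + e 3 := by
    funext y
    ext i
    fin_cases i <;> simp [paraboloid, Fin.sum_univ_three, mul_comm, sub_eq_neg_add, add_comm]
  rw [h3]
  exact h2

lemma paraboloidDeriv_apply (x v : E3) : paraboloidDeriv x v =
    WithLp.toLp 2 ![2 * v 0, 2 * v 1, 2 * v 2, -2 * inner ℝ x v] := by
  ext i
  fin_cases i <;> simp [paraboloidDeriv, Fin.sum_univ_three, mul_comm]

lemma hasFDerivAt_stereo (x : E3) : HasFDerivAt (fun x => ((stereo x : S3) : E4))
    ((‖x‖ ^ 2 + 1)⁻¹ • paraboloidDeriv x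
      + (-((‖x‖ ^ 2 + 1) ^ 2)⁻¹ • (2 : ℝ) • innerSL ℝ x).smulRight (paraboloid x)) x := by
  have h1 : HasFDerivAt (fun y : E3 => ‖y‖ ^ 2 + 1) ((2 : ℝ) • innerSL ℝ x) x := by
    have := (hasStrictFDerivAt_norm_sq x).hasFDerivAt
    rw [← Nat.cast_smul_eq_nsmul ℝ, Nat.cast_ofNat] at this
    exact this.add_const 1
  have h0 : ‖x‖ ^ 2 + 1 ≠ 0 := by positivity
  have h2 := ((hasDerivAt_inv h0).comp_hasFDerivAt x h1).fun_smul (hasFDerivAt_paraboloid x)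
  simp only [stereo_eq]
  exact h2

lemma norm_sq_fderiv_stereo (x v : E3) :
    ‖fderiv ℝ (fun x => ((stereo x : S3) : E4)) x v‖ ^ 2 = 4 / (‖x‖ ^ 2 + 1) ^ 2 * ‖v‖ ^ 2 := by
  have h0 : ‖x‖ ^ 2 + 1 ≠ 0 := by positivity
  have h1 : inner ℝ x v = x 0 * v 0 + x 1 * v 1 + x 2 * v 2 := by
    simp [PiLp.inner_apply, Fin.sum_univ_three, mul_comm]
  rw [(hasFDerivAt_stereo x).fderiv]
  simp only [_root_.add_apply, _root_.smul_apply,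
    ContinuousLinearMap.smulRight_apply, paraboloidDeriv_apply, paraboloid, innerSL_apply_apply, h1,
    EuclideanSpace.norm_sq_eq (𝕜 := ℝ) (n := Fin 4), Fin.sum_univ_four]
  simp
  rw [norm_sq_E3 v]
  rw [norm_sq_E3] at *
  field_simp
  ring

lemma contDiff_paraboloid : ContDiff ℝ ∞ paraboloid := by
  have hc (i : Fin 3) : ContDiff ℝ ∞ (fun x : E3 => x i) := contDiff_piLp_apply (p := 2)
  have hn : ContDiff ℝ ∞ (fun x : E3 => ‖x‖ ^ 2) := contDiff_norm_sq ℝ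
  refine (contDiff_piLp 2).2 fun i => ?_
  fin_cases i
  · exact contDiff_const.mul (hc 0)
  · exact contDiff_const.mul (hc 1)
  · exact contDiff_const.mul (hc 2)
  · exact contDiff_const.sub hn

lemma contDiff_stereo : ContDiff ℝ ∞ (fun x => ((stereo x : S3) : E4)) := by
  simp only [stereo_eq]
  have hn : ContDiff ℝ ∞ (fun x : E3 => ‖x‖ ^ 2) := contDiff_norm_sq ℝ
  exact ((hn.add contDiff_const).inv fun x => by positivity).smul contDiff_paraboloid

lemma continuous_stereo : Continuous stereo := contDiff_stereo.continuous.subtype_mk _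

lemma stereo_coord (x : E3) (i : Fin 3) :
    ((stereo x : S3) : E4) i.castSucc = 2 * x i / (‖x‖ ^ 2 + 1) := by
  fin_cases i <;> rfl

lemma stereo_last (x : E3) : ((stereo x : S3) : E4) 3 = (1 - ‖x‖ ^ 2) / (‖x‖ ^ 2 + 1) := rfl

lemma stereo_injective : Function.Injective stereo := by
  intro x y h
  have hx : ‖x‖ ^ 2 + 1 ≠ 0 := by positivity
  have hy : ‖y‖ ^ 2 + 1 ≠ 0 := by positivity
  have h3 : ((stereo x : S3) : E4) 3 = ((stereo y : S3) : E4) 3 := by rw [h]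
  rw [stereo_last, stereo_last, div_eq_div_iff hx hy] at h3
  have hn : ‖x‖ ^ 2 = ‖y‖ ^ 2 := by linarith
  ext i
  have hi : ((stereo x : S3) : E4) i.castSucc = ((stereo y : S3) : E4) i.castSucc := by rw [h]
  rw [stereo_coord, stereo_coord, hn, div_left_inj' hy] at hi
  linarith

lemma exists_stereo_eq {s : S3} (hs : (s : E4) 3 ≠ -1) : ∃ x, stereo x = s := by
  have h1 : 1 + (s : E4) 3 ≠ 0 := fun h => hs (by linarith)
  have h2 := sum_sq_coord s
  -- Stereographic projection from the pole s₄ = −1; there r² + 1 = 2/(1 + s₄).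
  refine ⟨WithLp.toLp 2 fun i => (s : E4) i.castSucc / (1 + (s : E4) 3), ?_⟩
  set x : E3 := WithLp.toLp 2 fun i => (s : E4) i.castSucc / (1 + (s : E4) 3)
  have hx (i : Fin 3) : x i = (s : E4) i.castSucc / (1 + (s : E4) 3) := rfl
  have hn : ‖x‖ ^ 2 + 1 = 2 / (1 + (s : E4) 3) := by
    rw [norm_sq_E3, hx, hx, hx]
    simp
    field_simp
    linear_combination h2
  apply Subtype.ext
  ext i
  refine Fin.lastCases ?_ (fun i => ?_) i
  · change ((stereo x : S3) : E4) 3 = (s : E4) 3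
    rw [stereo_last, show 1 - ‖x‖ ^ 2 = 2 - (‖x‖ ^ 2 + 1) by ring, hn]
    field_simp
    ring
  · rw [stereo_coord, hx, hn]
    field_simp

/-- The only point missed is the pole (0, 0, 0, −1), which is not in `W` because its first
coordinate is zero. -/
lemma bijOn_stereo (hW : W ≤ regular) : Set.BijOn stereo (stereo ⁻¹' W) W := by
  refine ⟨fun x hx => hx, stereo_injective.injOn, fun s hs => ?_⟩
  have h0 : (s : E4) 0 ≠ 0 := (hW hs).1
  obtain ⟨x, rfl⟩ := exists_stereo_eq (s := s) (fun h => by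
    have h1 := sum_sq_coord s
    have : 0 < (s : E4) 0 ^ 2 := by positivity
    rw [h] at h1
    nlinarith [sq_nonneg ((s : E4) 1), sq_nonneg ((s : E4) 2)])
  exact ⟨x, hs, rfl⟩

/-! ### The Laplacian in stereographic coordinates -/

lemma laplacian_eq_sum {h : E3 → ℂ} {x : E3} (hh : ContDiffAt ℝ 2 h x) :
    Laplacian.laplacian h x = ∑ i : Fin 3, fderiv ℝ
      (fun y => fderiv ℝ h y (EuclideanSpace.single i 1)) x (EuclideanSpace.single i 1) := by
  have h1 := congrFun (InnerProductSpace.laplacian_eq_iteratedFDeriv_orthonormalBasis h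
    (EuclideanSpace.basisFun (Fin 3) ℝ)) x
  rw [h1]
  refine Finset.sum_congr rfl fun i _ => ?_
  have h2 : DifferentiableAt ℝ (fderiv ℝ h) x :=
    (hh.fderiv_right (m := 1) (by norm_cast)).differentiableAt (by simp)
  have h3 := (h2.hasFDerivAt.clm_apply (hasFDerivAt_const (EuclideanSpace.single i (1 : ℝ)) x)).fderiv
  rw [h3, iteratedFDeriv_two_apply]
  simp

lemma fderiv_comp_paraboloid {K : E4 → ℂ} {x : E3} (hK : DifferentiableAt ℝ K (paraboloid x))
    (i : Fin 3) : fderiv ℝ (fun y => K (paraboloid y)) x (EuclideanSpace.single i 1)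
      = 2 * fderiv ℝ K (paraboloid x) (e i.castSucc)
        - 2 * x i * fderiv ℝ K (paraboloid x) (e 3) := by
  have h := (hK.hasFDerivAt.comp x (hasFDerivAt_paraboloid x)).fderiv
  refine (congrArg (fun T => T (EuclideanSpace.single i 1)) h).trans ?_
  have h1 : paraboloidDeriv x (EuclideanSpace.single i 1)
      = (2 : ℝ) • e i.castSucc - (2 * x i) • e 3 := by
    rw [paraboloidDeriv_apply]
    ext j
    fin_cases i <;> fin_cases j <;> simp [EuclideanSpace.inner_single_right]
  rw [ContinuousLinearMap.comp_apply, h1, map_sub, map_smul, map_smul]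
  simp

lemma isOpen_preimage_stereo : IsOpen (stereo ⁻¹' (W : Set S3)) := W.isOpen.preimage continuous_stereo

lemma fderiv_homExt_paraboloid (d : ℝ) (f : SmoothFn W) {x : E3} (hx : stereo x ∈ W) (i : Fin 3) :
    fderiv ℝ (fun y => homExt d f (paraboloid y)) x (EuclideanSpace.single i 1)
      = 2 * homExt (d - 1) (wdr d i.castSucc f) (paraboloid x)
        - 2 * x i * homExt (d - 1) (wdr d 3 f) (paraboloid x) := by
  have hc := paraboloid_mem_cone hx
  rw [fderiv_comp_paraboloid ((contDiffAt_homExt d f hc).differentiableAt (by simp)),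
    fderiv_homExt d f hc, fderiv_homExt d f hc]

lemma contDiffAt_homExt_paraboloid (d : ℝ) (f : SmoothFn W) {x : E3} (hx : stereo x ∈ W) :
    ContDiffAt ℝ ∞ (fun y => homExt d f (paraboloid y)) x :=
  (contDiffAt_homExt d f (paraboloid_mem_cone hx)).comp x contDiff_paraboloid.contDiffAt

/-- Along the paraboloid the i-th derivative acts as 2∂_i − 2x_i ∂₄. The last term arises in the
second application, from differentiating the coefficient x_i. -/
lemma fderiv_fderiv_homExt_paraboloid (d : ℝ) (f : SmoothFn W) {x : E3} (hx : stereo x ∈ W)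
    (i : Fin 3) :
    fderiv ℝ (fun y => fderiv ℝ (fun y => homExt d f (paraboloid y)) y (EuclideanSpace.single i 1)) x
      (EuclideanSpace.single i 1) =
      4 * homExt (d - 2) (wdr (d - 1) i.castSucc (wdr d i.castSucc f)) (paraboloid x)
      - 8 * x i * homExt (d - 2) (wdr (d - 1) i.castSucc (wdr d 3 f)) (paraboloid x)
      + 4 * x i ^ 2 * homExt (d - 2) (wdr (d - 1) 3 (wdr d 3 f)) (paraboloid x)
      - 2 * homExt (d - 1) (wdr d 3 f) (paraboloid x) := by
  have h1 : (fun y => fderiv ℝ (fun y => homExt d f (paraboloid y)) y (EuclideanSpace.single i 1))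
      =ᶠ[nhds x] fun y => 2 * homExt (d - 1) (wdr d i.castSucc f) (paraboloid y)
        - 2 * ((y i : ℂ) * homExt (d - 1) (wdr d 3 f) (paraboloid y)) := by
    filter_upwards [isOpen_preimage_stereo.mem_nhds hx] with y hy
    rw [fderiv_homExt_paraboloid d f hy, mul_assoc]
  have hd (g : SmoothFn W) : HasFDerivAt (fun y => homExt (d - 1) g (paraboloid y))
      (fderiv ℝ (fun y => homExt (d - 1) g (paraboloid y)) x) x :=
    ((contDiffAt_homExt_paraboloid (d - 1) g hx).differentiableAt (by simp)).hasFDerivAt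
  have hi : HasFDerivAt (fun y : E3 => ((y i : ℝ) : ℂ))
      (Complex.ofRealCLM.comp (EuclideanSpace.proj (𝕜 := ℝ) i : E3 →L[ℝ] ℝ)) x :=
    (Complex.ofRealCLM.comp (EuclideanSpace.proj (𝕜 := ℝ) i : E3 →L[ℝ] ℝ)).hasFDerivAt
  have h2 := (((hd (wdr d i.castSucc f)).const_mul 2).fun_sub
    ((hi.fun_mul (hd (wdr d 3 f))).const_mul 2)).fderiv
  rw [h1.fderiv_eq]
  refine (congrArg (fun T => T (EuclideanSpace.single i 1)) h2).trans ?_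
  have h3 := fderiv_homExt_paraboloid (d - 1) (wdr d i.castSucc f) hx i
  have h4 := fderiv_homExt_paraboloid (d - 1) (wdr d 3 f) hx i
  rw [show d - 1 - 1 = d - 2 by ring] at h3 h4
  simp only [_root_.sub_apply, _root_.add_apply, _root_.smul_apply, h3, h4,
    ContinuousLinearMap.comp_apply]
  rw [wdr_comm d 3 i.castSucc]
  simp
  ring

/-- Summing the second derivatives leaves, beside 4 times the Laplacian of ℝ⁴, a multiple of ∂₄F:
Euler's relation for ∂₄F, of degree d − 1, turns the mixed terms into −4(d − 1)∂₄F, and the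
paraboloid's curvature adds −6∂₄F. These cancel exactly for d = −1/2, and then d(d + 2) = −3/4. -/
lemma laplacian_homExt_paraboloid (f : SmoothFn W) {x : E3} (hx : stereo x ∈ W) :
    Laplacian.laplacian (fun y => homExt (-1 / 2) f (paraboloid y)) x =
      4 * (((‖x‖ ^ 2 + 1) ^ (-5 / 2 : ℝ) : ℝ) : ℂ)
        * evalAt ⟨stereo x, hx⟩ (laplaceS f - algebraMap ℂ _ (3 / 4) * f) := by
  have hw : 0 < ‖x‖ ^ 2 + 1 := by positivity
  have hH (d : ℝ) (g : SmoothFn W) : homExt d g (paraboloid x)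
      = (((‖x‖ ^ 2 + 1) ^ d : ℝ) : ℂ) * evalAt ⟨stereo x, hx⟩ g := by
    have h := paraboloid_mem_cone hx
    have h1 : (⟨toSphere (paraboloid x) h.1, h.2⟩ : W) = ⟨stereo x, hx⟩ :=
      Subtype.ext (toSphere_paraboloid x h.1)
    rw [homExt_eq d g h, norm_paraboloid, h1]
  have hE := congrArg (evalAt ⟨stereo x, hx⟩) (sum_crd_mul_wdr (-1 / 2 - 1) (wdr (-1 / 2) 3 f))
  have hL := congrArg (evalAt ⟨stereo x, hx⟩) (sum_wdr_wdr (-1 / 2) f)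
  rw [laplacian_eq_sum ((contDiffAt_homExt_paraboloid _ f hx).of_le (by norm_cast))]
  simp only [fderiv_fderiv_homExt_paraboloid _ f hx, hH]
  have e1 : (‖x‖ ^ 2 + 1) ^ (-1 / 2 - 1 : ℝ) = (‖x‖ ^ 2 + 1) ^ (-5 / 2 : ℝ) * (‖x‖ ^ 2 + 1) := by
    rw [← Real.rpow_add_one hw.ne']; norm_num
  have e2 : (-1 / 2 - 2 : ℝ) = -5 / 2 := by norm_num
  rw [e1, e2]
  have hs (i : Fin 3) : evalAt ⟨stereo x, hx⟩ (crd i.castSucc : SmoothFn W)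
      = 2 * x i / (‖x‖ ^ 2 + 1) := by
    change ((((stereo x : S3) : E4) i.castSucc : ℝ) : ℂ) = _
    rw [stereo_coord]; push_cast; rfl
  have hs3 : evalAt ⟨stereo x, hx⟩ (crd 3 : SmoothFn W) = (1 - ‖x‖ ^ 2) / (‖x‖ ^ 2 + 1) := by
    change ((((stereo x : S3) : E4) 3 : ℝ) : ℂ) = _
    rw [stereo_last]; push_cast; rfl
  have hs0 := hs 0
  have hs1 := hs 1
  have hs2 := hs 2
  have hn : (‖x‖ : ℂ) ^ 2 = x 0 ^ 2 + x 1 ^ 2 + x 2 ^ 2 := by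
    exact_mod_cast norm_sq_E3 x
  have hwc : (‖x‖ : ℂ) ^ 2 + 1 ≠ 0 := by exact_mod_cast hw.ne'
  simp only [Fin.sum_univ_four, Fin.sum_univ_three, map_add, map_mul, map_sub,
    AlgHom.commutes, Algebra.algebraMap_self, RingHom.id_apply] at hE hL ⊢
  simp only [Fin.castSucc_zero, show Fin.castSucc (1 : Fin 3) = 1 from rfl,
    show Fin.castSucc (2 : Fin 3) = 2 from rfl] at hs0 hs1 hs2 ⊢
  rw [hs0, hs1, hs2, hs3] at hE
  generalize evalAt ⟨stereo x, hx⟩ (wdr (-1 / 2 - 1) 0 (wdr (-1 / 2) 3 f)) = g0 at *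
  generalize evalAt ⟨stereo x, hx⟩ (wdr (-1 / 2 - 1) 1 (wdr (-1 / 2) 3 f)) = g1 at *
  generalize evalAt ⟨stereo x, hx⟩ (wdr (-1 / 2 - 1) 2 (wdr (-1 / 2) 3 f)) = g2 at *
  generalize evalAt ⟨stereo x, hx⟩ (wdr (-1 / 2 - 1) 3 (wdr (-1 / 2) 3 f)) = g3 at *
  generalize evalAt ⟨stereo x, hx⟩ (wdr (-1 / 2) 3 f) = g at *
  generalize (‖x‖ ^ 2 + 1) ^ (-5 / 2 : ℝ) = κ at *
  field_simp at hE
  push_cast at hE hL ⊢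
  linear_combination 4 * (κ : ℂ) * hL - 4 * (κ : ℂ) * hE - 4 * (κ : ℂ) * g3 * hn

/-- The conformal factor and its fourth root. -/
lemma conformalFactor_rpow (x : E3) : (4 / (‖x‖ ^ 2 + 1) ^ 2 : ℝ) ^ (1 / 4 : ℝ)
    = (4 : ℝ) ^ (1 / 4 : ℝ) * (‖x‖ ^ 2 + 1) ^ (-1 / 2 : ℝ) := by
  have hw : 0 < ‖x‖ ^ 2 + 1 := by positivity
  rw [div_eq_mul_inv, Real.mul_rpow (by norm_num) (by positivity), Real.inv_rpow (by positivity),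
    ← Real.rpow_natCast, ← Real.rpow_mul hw.le, ← Real.rpow_neg hw.le]
  norm_num

lemma homExt_paraboloid (d : ℝ) (f : SmoothFn W) (x : E3) : homExt d f (paraboloid x)
    = (((‖x‖ ^ 2 + 1) ^ d : ℝ) : ℂ) * radialExt (f : W → ℂ) ((stereo x : S3) : E4) := by
  rw [homExt, norm_paraboloid, stereo_eq, radialExt_homogeneous _ (by positivity)]

/-- The potential of the flat system is the potential on the sphere times the conformal factor. -/
lemma flatPotential_eq (hW : W ≤ regular) (a₁ a₂ a₃ a₄ : ℂ) {x : E3} (hx : stereo x ∈ W) :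
    flatPotential a₁ a₂ a₃ a₄ x = ((4 / (‖x‖ ^ 2 + 1) ^ 2 : ℝ) : ℂ)
      * (evalAt ⟨stereo x, hx⟩ (pot hW ![a₁, a₂, a₃]) + a₄) := by
  have hw : 0 < ‖x‖ ^ 2 + 1 := by positivity
  have hwc : (‖x‖ : ℂ) ^ 2 + 1 ≠ 0 := by exact_mod_cast hw.ne'
  have h0 : ((stereo x : S3) : E4) 0 = 2 * x 0 / (‖x‖ ^ 2 + 1) := rfl
  have h1 : ((stereo x : S3) : E4) 1 = 2 * x 1 / (‖x‖ ^ 2 + 1) := rfl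
  have h2 : ((stereo x : S3) : E4) 2 = 2 * x 2 / (‖x‖ ^ 2 + 1) := rfl
  have h3 : ((stereo x : S3) : E4) 3 = (1 - ‖x‖ ^ 2) / (‖x‖ ^ 2 + 1) := rfl
  have hx0 : x 0 ≠ 0 := fun h => (hW hx).1 (by rw [h0, h]; simp)
  have hx1 : x 1 ≠ 0 := fun h => (hW hx).2 (by rw [h1, h]; simp)
  have hx0c : (x 0 : ℂ) ≠ 0 := Complex.ofReal_ne_zero.2 hx0
  have hx1c : (x 1 : ℂ) ≠ 0 := Complex.ofReal_ne_zero.2 hx1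
  have hn : 0 < ‖x‖ := norm_pos_iff.2 fun h => hx0 (by rw [h]; rfl)
  have hnc : (‖x‖ : ℂ) ≠ 0 := Complex.ofReal_ne_zero.2 hn.ne'
  have hr : √((2 * x 0 / (‖x‖ ^ 2 + 1)) ^ 2 + (2 * x 1 / (‖x‖ ^ 2 + 1)) ^ 2
      + (2 * x 2 / (‖x‖ ^ 2 + 1)) ^ 2) = 2 * ‖x‖ / (‖x‖ ^ 2 + 1) := by
    rw [Real.sqrt_eq_iff_eq_sq (by positivity) (by positivity)]
    have := norm_sq_E3 x
    field_simp
    linear_combination -this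
  have e1 : evalAt ⟨stereo x, hx⟩ (V1 hW) = (1 - ‖x‖ ^ 2) / (2 * ‖x‖) := by
    change ((((stereo x : S3) : E4) 3 / √(((stereo x : S3) : E4) 0 ^ 2
      + ((stereo x : S3) : E4) 1 ^ 2 + ((stereo x : S3) : E4) 2 ^ 2) : ℝ) : ℂ) = _
    rw [h0, h1, h2, h3, hr]
    push_cast
    field_simp
  have e2 : evalAt ⟨stereo x, hx⟩ (V2 hW) = (‖x‖ ^ 2 + 1) ^ 2 / (4 * x 0 ^ 2) := by
    change 1 / (((stereo x : S3) : E4) 0 : ℂ) ^ 2 = _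
    rw [h0]
    push_cast
    field_simp
    norm_num
  have e3 : evalAt ⟨stereo x, hx⟩ (V3 hW) = (‖x‖ ^ 2 + 1) ^ 2 / (4 * x 1 ^ 2) := by
    change 1 / (((stereo x : S3) : E4) 1 : ℂ) ^ 2 = _
    rw [h1]
    push_cast
    field_simp
    norm_num
  rw [pot_eq, map_add, map_add, map_smul, map_smul, map_smul, e1, e2, e3, flatPotential]
  simp
  field_simp
  ring

/-- The gauge factor U^{1/4} is a constant times (r² + 1)^{−1/2}, so it turns a function on the
sphere into its degree −1/2 extension restricted to the paraboloid. The outer factor U^{−1/4} U^{−1}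
then cancels the power of r² + 1 produced by the Laplacian. -/
lemma isStaeckelTransform_stereo (hW : W ≤ regular) (a₁ a₂ a₃ a₄ : ℂ) :
    IsStaeckelTransform stereo (fun x => 4 / (‖x‖ ^ 2 + 1) ^ 2) (Hflat a₁ a₂ a₃ a₄)
      (Hcoul hW a₁ a₂ a₃ (a₄ - 3 / 4)) := by
  refine ⟨isOpen_preimage_stereo, bijOn_stereo hW, contDiff_stereo.contDiffOn,
    fun x _ => ⟨by positivity, norm_sq_fderiv_stereo x⟩, fun f x hx => ?_⟩
  have hw : 0 < ‖x‖ ^ 2 + 1 := by positivity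
  have hψ : (fun y : E3 => (((4 / (‖y‖ ^ 2 + 1) ^ 2 : ℝ) ^ (1 / 4 : ℝ) : ℝ) : ℂ)
      * radialExt (f : W → ℂ) ((stereo y : S3) : E4))
      = (((4 : ℝ) ^ (1 / 4 : ℝ) : ℝ) : ℂ) • fun y => homExt (-1 / 2) f (paraboloid y) := by
    funext y
    rw [conformalFactor_rpow, Pi.smul_apply, homExt_paraboloid, smul_eq_mul]
    push_cast
    ring
  have hκ : ((4 : ℝ) ^ (1 / 4 : ℝ) : ℝ) ≠ 0 := by positivity
  have hLap := laplacian_homExt_paraboloid f hx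
  have hsm : Laplacian.laplacian ((((4 : ℝ) ^ (1 / 4 : ℝ) : ℝ) : ℂ)
      • fun y => homExt (-1 / 2) f (paraboloid y)) x = (((4 : ℝ) ^ (1 / 4 : ℝ) : ℝ) : ℂ)
      • Laplacian.laplacian (fun y => homExt (-1 / 2) f (paraboloid y)) x :=
    InnerProductSpace.laplacian_smul _
      ((contDiffAt_homExt_paraboloid _ f hx).of_le (by norm_cast))
  have hL : (Hcoul hW a₁ a₂ a₃ (a₄ - 3 / 4) f : W → ℂ) ⟨stereo x, hx⟩
      = evalAt ⟨stereo x, hx⟩ (laplaceS f) + evalAt ⟨stereo x, hx⟩ (pot hW ![a₁, a₂, a₃])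
        * evalAt ⟨stereo x, hx⟩ f + (a₄ - 3 / 4) * evalAt ⟨stereo x, hx⟩ f := rfl
  have hf : radialExt (f : W → ℂ) ((stereo x : S3) : E4) = evalAt ⟨stereo x, hx⟩ f :=
    radialExt_coe (f : W → ℂ) ⟨stereo x, hx⟩
  rw [hL, staeckelTransform, Hflat, hψ, hsm, hLap, flatPotential_eq hW a₁ a₂ a₃ a₄ hx,
    conformalFactor_rpow, hf, map_sub, map_mul, AlgHom.commutes]
  have e1 : (‖x‖ ^ 2 + 1) ^ (-5 / 2 : ℝ)
      = (‖x‖ ^ 2 + 1) ^ (-1 / 2 : ℝ) * ((‖x‖ ^ 2 + 1) ^ 2)⁻¹ := by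
    rw [← Real.rpow_two (‖x‖ ^ 2 + 1), ← Real.rpow_neg hw.le, ← Real.rpow_add hw]
    norm_num
  have hμ : (‖x‖ ^ 2 + 1) ^ (-1 / 2 : ℝ) ≠ 0 := (Real.rpow_pos_of_pos hw _).ne'
  rw [e1]
  generalize (‖x‖ ^ 2 + 1) ^ (-1 / 2 : ℝ) = μ at *
  generalize (4 : ℝ) ^ (1 / 4 : ℝ) = κ at *
  have hκc : (κ : ℂ) ≠ 0 := Complex.ofReal_ne_zero.2 hκ
  have hμc : (μ : ℂ) ≠ 0 := Complex.ofReal_ne_zero.2 hμ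
  have hwc : (‖x‖ : ℂ) ^ 2 + 1 ≠ 0 := by exact_mod_cast hw.ne'
  simp only [Algebra.algebraMap_self, RingHom.id_apply, smul_eq_mul]
  push_cast
  field_simp
  ring

end

end SphereSystem

theorem mainTheorem3 (W : TopologicalSpace.Opens SphereSystem.S3)
    (hconn : IsConnected (W : Set SphereSystem.S3)) (hW : W ≤ SphereSystem.regular) :
    -- the five operators are functionally independent symmetries of order at most two,
    -- linearly independent modulo constants, for all values of the parameters
    (∀ a₁ a₂ a₃ a₄ : ℂ,
      (∀ P ∈ [SphereSystem.Hcoul hW a₁ a₂ a₃ a₄, SphereSystem.L12 hW a₂ a₃,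
          SphereSystem.L13 hW a₂, SphereSystem.L23 hW a₃, SphereSystem.L hW a₁ a₂ a₃],
        P ∈ SphereSystem.diffOps W 2 ∧ Commute P (SphereSystem.Hcoul hW a₁ a₂ a₃ a₄)) ∧
      SphereSystem.OpsFunctionallyIndependent
        ![SphereSystem.Hcoul hW a₁ a₂ a₃ a₄, SphereSystem.L12 hW a₂ a₃,
          SphereSystem.L13 hW a₂, SphereSystem.L23 hW a₃, SphereSystem.L hW a₁ a₂ a₃] ∧
      LinearIndependent ℂ
        ![1, SphereSystem.Hcoul hW a₁ a₂ a₃ a₄, SphereSystem.L12 hW a₂ a₃,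
          SphereSystem.L13 hW a₂, SphereSystem.L23 hW a₃, SphereSystem.L hW a₁ a₂ a₃]) ∧
    -- together with the constants they span the space of all second-order symmetries
    (∀ a₁ a₂ a₃ a₄ : ℂ, a₁ ≠ 0 → a₂ ≠ 0 → a₃ ≠ 0 →
      Submodule.span ℂ (Set.range
        ![1, SphereSystem.Hcoul hW a₁ a₂ a₃ a₄, SphereSystem.L12 hW a₂ a₃,
          SphereSystem.L13 hW a₂, SphereSystem.L23 hW a₃, SphereSystem.L hW a₁ a₂ a₃])
        = SphereSystem.symmetries W (SphereSystem.Hcoul hW a₁ a₂ a₃ a₄)) ∧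
    -- the system is semidegenerate; this includes the functional independence of its potential
    SphereSystem.IsSemidegenerate
      ![SphereSystem.V1 hW, SphereSystem.V2 hW, SphereSystem.V3 hW] ∧
    -- the Stäckel transform of the flat-space system by the coefficient of its parameter `a₄`
    (∀ a₁ a₂ a₃ a₄ : ℂ,
      (∀ x, SphereSystem.flatPotential a₁ a₂ a₃ a₄ x =
        SphereSystem.flatPotential a₁ a₂ a₃ 0 x + a₄ * ((4 / (‖x‖ ^ 2 + 1) ^ 2 : ℝ) : ℂ)) ∧
      SphereSystem.IsStaeckelTransform SphereSystem.stereo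
        (fun x => 4 / (‖x‖ ^ 2 + 1) ^ 2)
        (SphereSystem.Hflat a₁ a₂ a₃ a₄)
        (SphereSystem.Hcoul hW a₁ a₂ a₃ (a₄ - 3 / 4))) := by
  have : Nonempty W := hconn.nonempty.to_subtype
  refine ⟨fun a₁ a₂ a₃ a₄ => ⟨fun P hP => ?_, ?_, ?_⟩, fun a₁ a₂ a₃ a₄ h₁ h₂ h₃ => ?_,
    SphereSystem.isSemidegenerate_potential hconn.isPreconnected hW,
    fun a₁ a₂ a₃ a₄ => ⟨fun x => ?_, SphereSystem.isStaeckelTransform_stereo hW a₁ a₂ a₃ a₄⟩⟩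
  -- The explicit operators are by definition the family `syms` at the parameter vector `![a₁, a₂,
  -- a₃]`.
  · have h : P ∈ List.ofFn (SphereSystem.syms hW ![a₁, a₂, a₃] a₄) := hP
    obtain ⟨i, rfl⟩ := List.mem_ofFn.1 h
    exact SphereSystem.mem_symmetries_iff.1 (SphereSystem.syms_mem hW ![a₁, a₂, a₃] a₄ i)
  · exact SphereSystem.opsFunctionallyIndependent_syms hW ![a₁, a₂, a₃] a₄
  · exact SphereSystem.linearIndependent_syms hW ![a₁, a₂, a₃] a₄
  · refine SphereSystem.span_eq_symmetries hconn.isPreconnected hW (a := ![a₁, a₂, a₃])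
      (fun i => ?_) a₄
    fin_cases i <;> assumption
  · simp only [SphereSystem.flatPotential]
    push_cast
    ring
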